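/- **Setting.** Let $E\subset\mathbb R^d$ be open and let $(\Phi,\lambda,Q)$ be the local characteristics of a piecewise-deterministic Markov process: $\Phi:\mathbb R^d\times\mathbb R^+\to\mathbb R^d$ is a continuous flow (each $\Phi(\cdot,t)$ is a homeomorphism and $\Phi(x,t+s)=\Phi(\Phi(x,s),t)$), $\lambda:\overline E\to\mathbb R^+$ is measurable with $0\le\lambda\le C_\lambda$ for a constant $C_\lambda>0$, and $Q$ is a Markov kernel on $\overline E$ with $Q(x,E\setminus\{x\})=1$ for all $x\in\overline E$. Put $t^*(x)=\inf\{t>0:\Phi(x,t)\in\partial E\}$ and $\Lambda(x,t)=\int_0^t\lambda(\Phi(x,s))\,ds$. Assume that there is a finite set $E_0=\{x_1,\dots,x_q\}\subset E$ with $Q(x,E_0)=1$ for all $x\in\overline E$ and $0<t^*(x_i)<\infty$; let $t^*_i=t^*(x_i)$, numbered so that $t_1^*\le\dots\le t_q^*$, and $t_0^*=0$. Let $\mathcal M_1(E_0)$ be the set of probability vectors $\pi=(\pi^1,\dots,\pi^q)$, with the norm $|\pi|=\sum_i|\pi^i|$, and let $[v]$ denote the Lipschitz constant of $v:\mathcal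 M_1(E_0)\to\mathbb R$. Let $g:\overline E\to\mathbb R$ be measurable with $|g|\le C_g$ and $|g(\Phi(x_i,t))-g(\Phi(x_i,u))|\le[g]_2|t-u|$ for all $i$ and $t,u\in[0,t_i^*]$. Let $(Z_n,S_n)_{n\ge0}$ be the embedded Markov chain of the process: $Z_0=x_0\in E_0$ is fixed, $S_0=0$, and, given the past up to step $n$, $S_{n+1}$ has survival function $t\mapsto e^{-\Lambda(Z_n,t)}\mathbf 1_{\{t<t^*(Z_n)\}}$ and, given moreover $S_{n+1}$, $Z_{n+1}$ has law $Q(\Phi(Z_n,S_{n+1}),\cdot)$. Let $Y_0=x_0$ and $Y_n=\varphi(Z_n)+W_n$ for $n\ge1$, where $\varphi:E_0\to\mathbb R^d$ and the $W_n$ are i.i.d. with a bounded density and independent of $(Z_n,S_n)_n$. The filter is $\Pi_n^i=\mathbf P(Z_n=x_i\mid Y_0,S_0,\dots,Y_n,S_n)$. Write $\mathbf E[\,\cdot\mid\Pi_0=\pi]$ for the expectation when $Z_0$ has law $\pi$ (and $\Pi_1$ is then the conditional law of $Z_1$ given $(Y_1,S_1)$). For a horizon $N$, let $v_N(\pi)=\sum_i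 g(x_i)\pi^i$ and, for $0\le n\le N-1$, $$v_n(\pi)=\sup_{u\ge0}\mathbf E\Big[\sum_{i=1}^q g(\Phi(x_i,u))\,\Pi_0^i\,\mathbf 1_{\{u<t_i^*\}}\mathbf 1_{\{S_1>u\}}+v_{n+1}(\Pi_1)\mathbf 1_{\{S_1\le u\}}\,\Big|\,\Pi_0=\pi\Big],\qquad V_n=v_n(\Pi_n).$$ **Approximation.** For finite grids $\Gamma_n\subset\mathcal M_1(E_0)\times\mathbb R^+$ let $(\widehat\Pi_n,\widehat S_n)$ be a (measurable) nearest-neighbour projection of $(\Pi_n,S_n)$ on $\Gamma_n$, for a fixed norm on $\mathbb R^q\times\mathbb R$. Let $0<\Delta<\frac12\min\{|t_i^*-t_j^*|:0\le i,j\le q,\ t_i^*\ne t_j^*\}$ and let $Gr(\Delta)$ be the union, over the $m\in\{0,\dots,q-1\}$ with $t_m^*<t_{m+1}^*$, of the sets $\{t_m^*+i\Delta: i\ge1,\ t_m^*+i\Delta\le t_{m+1}^*-\Delta\}\cup\{t_{m+1}^*-\Delta\}$. Let $\widehat v_N(\pi)=\sum_i g(x_i)\pi^i$ and, for $0\le n\le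 N-1$, let $\widehat v_n(\pi)$ be the maximum of $\mathbf E[\widehat v_{n+1}(\widehat\Pi_{n+1})\mid\widehat\Pi_n=\pi]$ and of $$\max_{u\in Gr(\Delta)}\Big\{\sum_{i=1}^q\pi^i\mathbf 1_{\{u<t_i^*\}}g(\Phi(x_i,u))\,\mathbf P(\widehat S_{n+1}>u\mid\widehat\Pi_n=\pi)+\mathbf E\big[\widehat v_{n+1}(\widehat\Pi_{n+1})\mathbf 1_{\{\widehat S_{n+1}\le u\}}\mid\widehat\Pi_n=\pi\big]\Big\},$$ and put $\widehat V_n=\widehat v_n(\widehat\Pi_n)$. Let $p\ge1$ and $\|X\|_p=(\mathbf E|X|^p)^{1/p}$. **Theorem.** For $0\le n\le N$, $|v_n|\le C_g$ and $v_n$ is Lipschitz with $[v_n]\le(2^{N-n+2}-3)C_g$, and $V_n-\widehat V_n\in L^p$. If $0\le n\le N-1$ and $$\Delta>(2C_\lambda)^{-1/2}\|S_{n+1}-\widehat S_{n+1}\|_p^{1/2},$$ then $$\|V_n-\widehat V_n\|_p\le\|V_{n+1}-\widehat V_{n+1}\|_p+a\Delta+b\,\|S_{n+1}-\widehat S_{n+1}\|_p^{1/2}+c_n\|\Pi_n-\widehat\Pi_n\|_p+2[v_{n+1}]\,\|\Pi_{n+1}-\widehat\Pi_{n+1}\|_p,$$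 where $a=[g]_2+2C_gC_\lambda$, $b=4C_g(2C_\lambda)^{1/2}$ and $c_n=[v_n]+4C_g+2[v_{n+1}]$. Consequently $\widehat V_0\to V_0$ as the quantization errors and the time step go to zero: for every $\varepsilon>0$ there is $\delta>0$ such that for all grids and all $\Delta$ as above with $\Delta<\delta$, with $\Delta>(2C_\lambda)^{-1/2}\|S_{n+1}-\widehat S_{n+1}\|_p^{1/2}$ for all $0\le n\le N-1$, and with $\|\Pi_n-\widehat\Pi_n\|_p<\delta$ and $\|S_n-\widehat S_n\|_p<\delta$ for all $0\le n\le N$, one has $\|V_0-\widehat V_0\|_p<\varepsilon$ and $|V_0-\widehat V_0|<\varepsilon$ almost surely. -/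

import Mathlib

open MeasureTheory ProbabilityTheory Set

namespace PODP

noncomputable section

/-- The ambient space `ℝ^d` with its Euclidean norm. -/
abbrev Vec (d : ℕ) := EuclideanSpace ℝ (Fin d)

/-- Local characteristics `(Φ, λ, Q)` of a piecewise-deterministic Markov process with state space
an open set `E ⊆ ℝ^d`.  Times are real numbers and only times `t ≥ 0` are constrained; the rate and
the kernel are constrained on the closure of `E` only. -/
structure LocalCharacteristics (d : ℕ) where
  E : Set (Vec d)
  isOpen_E : IsOpen E
  /-- the flow `Φ(x, t)` -/
  flow : Vec d → ℝ → Vec d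
  continuousOn_flow : ContinuousOn (fun p : Vec d × ℝ => flow p.1 p.2) (univ ×ˢ Ici (0 : ℝ))
  isHomeomorph_flow : ∀ t : ℝ, 0 ≤ t → IsHomeomorph (fun x => flow x t)
  flow_add : ∀ (x : Vec d) (s t : ℝ), 0 ≤ s → 0 ≤ t → flow x (t + s) = flow (flow x s) t
  /-- the jump rate `λ` -/
  rate : Vec d → ℝ
  rate_nonneg : ∀ x ∈ closure E, 0 ≤ rate x
  measurable_rate : Measurable ((closure E).domRestrict rate)
  rate_locally_integrable : ∀ x ∈ E, ∃ ε : ℝ, 0 < ε ∧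
    ∫⁻ t in Ioo (0 : ℝ) ε, ENNReal.ofReal (rate (flow x t)) < ⊤
  /-- the transition kernel `Q` -/
  Q : Kernel (Vec d) (Vec d)
  isProbabilityMeasure_Q : ∀ x ∈ closure E, IsProbabilityMeasure (Q x)
  Q_ne_self : ∀ x ∈ closure E, Q x (E \ {x}) = 1

namespace LocalCharacteristics

variable {d : ℕ} (D : LocalCharacteristics d)

/-- The deterministic exit time `t*(x) = inf {t > 0 : Φ(x, t) ∈ ∂E}`, with `inf ∅ = ∞`. -/
def exitTime (x : Vec d) : ENNReal :=
  sInf (ENNReal.ofReal '' {t : ℝ | 0 < t ∧ D.flow x t ∈ frontier D.E})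

/-- The cumulated rate `Λ(x, t) = ∫₀ᵗ λ(Φ(x, s)) ds`. -/
def cumRate (x : Vec d) (t : ℝ) : ℝ := ∫ s in (0 : ℝ)..t, D.rate (D.flow x s)

open Classical in
/-- The survival function of the first jump time from `x`: `exp(-Λ(x, t))` for `0 ≤ t < t*(x)`,
`0` for `t ≥ t*(x)` (and `1` for `t < 0`). -/
def survival (x : Vec d) (t : ℝ) : ℝ :=
  if t < 0 then 1
  else if ENNReal.ofReal t < D.exitTime x then Real.exp (-D.cumRate x t) else 0

/-- Generalized inverse of the survival function. -/
def survivalInv (x : Vec d) (u : ℝ) : ℝ := sInf {t : ℝ | 0 ≤ t ∧ D.survival x t ≤ u}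

/-- The law of the first jump time from `x`, i.e. the law on `ℝ` with survival function
`survival x`: the image of the uniform law on `(0, 1)` under the generalized inverse. -/
def jumpTimeLaw (x : Vec d) : Measure ℝ :=
  ((volume : Measure ℝ).restrict (Ioo 0 1)).map (D.survivalInv x)

end LocalCharacteristics

/-- A PDMP whose post-jump locations lie in a finite set `E₀ = {x_1, …, x_q} ⊆ E`, with fixed
starting point in `E₀`, observed through an additive noise.  A state `x_i ∈ E₀` is represented by
its index `i : Fin q`. -/
structure ObservedModel (d q : ℕ) extends LocalCharacteristics d where
  /-- the points of `E₀` -/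
  x : Fin q → Vec d
  x_injective : Function.Injective x
  x_mem : ∀ i, x i ∈ E
  /-- post-jump locations are in `E₀` -/
  Q_support : ∀ y ∈ closure E, Q y (range x) = 1
  exitTime_pos : ∀ i, 0 < toLocalCharacteristics.exitTime (x i)
  exitTime_lt_top : ∀ i, toLocalCharacteristics.exitTime (x i) < ⊤
  /-- the points are numbered by increasing exit time -/
  exitTime_mono : Monotone (fun i => toLocalCharacteristics.exitTime (x i))
  /-- the (index of the) initial state -/
  start : Fin q
  /-- the observation function `φ : E₀ → ℝ^d` -/
  obs : Fin q → Vec d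
  /-- the density of the noise -/
  noiseDensity : Vec d → ℝ
  measurable_noiseDensity : Measurable noiseDensity
  noiseDensity_nonneg : ∀ w, 0 ≤ noiseDensity w
  noiseDensity_bounded : ∃ B : ℝ, ∀ w, noiseDensity w ≤ B
  noiseDensity_mass : ∫⁻ w, ENNReal.ofReal (noiseDensity w) = 1

/-- The norm `|π| = ∑ |π^i|` on signed measures on `E₀`, identified with vectors of weights. -/
def l1 {q : ℕ} (π : Fin q → ℝ) : ℝ := ∑ i, |π i|

/-- The difference quotients `|v(π) - v(π')| / |π - π'|` of `v` on the set of probability measures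
on `E₀` (the standard simplex). -/
def lipQuotients {q : ℕ} (v : (Fin q → ℝ) → ℝ) : Set ℝ :=
  {r | ∃ π ∈ stdSimplex ℝ (Fin q), ∃ π' ∈ stdSimplex ℝ (Fin q),
    π ≠ π' ∧ r = |v π - v π'| / l1 (π - π')}

/-- The Lipschitz constant `[v]`: the supremum of the difference quotients. -/
def lipConst {q : ℕ} (v : (Fin q → ℝ) → ℝ) : ℝ := sSup (lipQuotients v)

/-- The `L^p` norm `(𝔼|X|^p)^{1/p}` of a real random variable. -/
def normLp {Ω : Type*} [MeasurableSpace Ω] (P : Measure Ω) (p : ℝ) (X : Ω → ℝ) : ℝ :=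
  (∫ ω, |X ω| ^ p ∂P) ^ (1 / p)

namespace ObservedModel

variable {d q : ℕ} (M : ObservedModel d q)

/-- The exit times `t*_0 = 0` and `t*_i = t*(x_i)`, `1 ≤ i ≤ q`. -/
def tStar : Fin (q + 1) → ℝ :=
  Fin.cons 0 (fun i : Fin q => (M.exitTime (M.x i)).toReal)

/-- The exit time `t*(x_i)`, for the state of index `i : Fin q`. -/
def exit (i : Fin q) : ℝ := M.tStar i.succ

/-- The law of (next post-jump state, inter-jump time) starting from `x_i`: the inter-jump time `s`
has law `jumpTimeLaw (x_i)` and, given `s`, the next state is `x_j` with probability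
`Q(Φ(x_i, s), {x_j})`. -/
def stepLaw (i : Fin q) : Measure (Fin q × ℝ) :=
  ∑ j, ((M.jumpTimeLaw (M.x i)).withDensity
    (fun s => M.Q (M.flow (M.x i) s) {M.x j})).map (fun s => (j, s))

/-- The law of the observation noise. -/
def noiseLaw : Measure (Vec d) :=
  (volume : Measure (Vec d)).withDensity (fun w => ENNReal.ofReal (M.noiseDensity w))

/-- The law of `(Z_1, (Y_1, S_1))` when `Z_0` has law `π`, i.e. given `Π_0 = π`. -/
def oneStepLaw (π : Fin q → ℝ) : Measure (Fin q × Vec d × ℝ) :=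
  ∑ i, ENNReal.ofReal (π i) •
    ((M.stepLaw i).prod M.noiseLaw).map (fun o => (o.1.1, M.obs o.1.1 + o.2, o.1.2))

/-- The filter `Π_1` given `Π_0 = π`: the conditional law of `Z_1` given `(Y_1, S_1)` when `Z_0`
has law `π`. -/
def oneStepFilter (π : Fin q → ℝ) (o : Fin q × Vec d × ℝ) : Fin q → ℝ := fun i =>
  ((M.oneStepLaw π)[({o : Fin q × Vec d × ℝ | o.1 = i}).indicator (fun _ => (1 : ℝ)) |
    MeasurableSpace.comap (fun o : Fin q × Vec d × ℝ => o.2) inferInstance]) o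

open Classical in
/-- `∑_i h(Φ(x_i, u)) π^i 1_{u < t*_i}`. -/
def flowReward (h : Vec d → ℝ) (π : Fin q → ℝ) (u : ℝ) : ℝ :=
  ∑ i, if u < M.exit i then h (M.flow (M.x i) u) * π i else 0

/-- `Gv(π, u) = 𝔼[v(Π_1) 1_{S_1 ≤ u} | Π_0 = π]`. -/
def G (v : (Fin q → ℝ) → ℝ) (π : Fin q → ℝ) (u : ℝ) : ℝ :=
  ∫ o, ({o : Fin q × Vec d × ℝ | o.2.2 ≤ u}).indicator (fun o => v (M.oneStepFilter π o)) o
    ∂(M.oneStepLaw π)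

/-- `Hh(π, u) = 𝔼[∑_i h(Φ(x_i, u)) Π_0^i 1_{u < t*_i} 1_{S_1 > u} | Π_0 = π]`. -/
def H (h : Vec d → ℝ) (π : Fin q → ℝ) (u : ℝ) : ℝ :=
  ∫ o, ({o : Fin q × Vec d × ℝ | u < o.2.2}).indicator (fun _ => M.flowReward h π u) o
    ∂(M.oneStepLaw π)

/-- `J(v, h) = Hh + Gv`. -/
def J (v : (Fin q → ℝ) → ℝ) (h : Vec d → ℝ) (π : Fin q → ℝ) (u : ℝ) : ℝ :=
  M.H h π u + M.G v π u

/-- The dynamic programming operator `L(v, h)(π) = sup_{u ≥ 0} J(v, h)(π, u)`. -/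
def L (v : (Fin q → ℝ) → ℝ) (h : Vec d → ℝ) (π : Fin q → ℝ) : ℝ :=
  sSup (M.J v h π '' Ici (0 : ℝ))

/-- The functions `v_n` indexed by the number `k = N - n` of remaining steps. -/
def valueRev (g : Vec d → ℝ) : ℕ → (Fin q → ℝ) → ℝ
  | 0 => fun π => ∑ i, g (M.x i) * π i
  | k + 1 => M.L (valueRev g k) g

/-- `v_N(π) = ∑_i g(x_i) π^i` and `v_{n-1} = L(v_n, g)`. -/
def value (g : Vec d → ℝ) (N n : ℕ) : (Fin q → ℝ) → ℝ := M.valueRev g (N - n)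

/-- The time grid `Gr_m(Δ)` on `]t*_m, t*_{m+1}[`. -/
def gridPart (m : Fin q) (Δ : ℝ) : Set ℝ :=
  {u | ∃ i : ℕ, 1 ≤ i ∧ M.tStar m.castSucc + i * Δ ≤ M.tStar m.succ - Δ ∧
    u = M.tStar m.castSucc + i * Δ} ∪ {M.tStar m.succ - Δ}

/-- The time grid `Gr(Δ)`, union of the `Gr_m(Δ)` over the `m` with `t*_m < t*_{m+1}`. -/
def grid (Δ : ℝ) : Set ℝ :=
  ⋃ m ∈ {m : Fin q | M.tStar m.castSucc < M.tStar m.succ}, M.gridPart m Δ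

/-- The admissibility condition
`Δ < ½ min {|t*_i - t*_j| : 0 ≤ i, j ≤ q, t*_i ≠ t*_j}` on a step `Δ > 0`. -/
def IsStep (Δ : ℝ) : Prop :=
  0 < Δ ∧ ∀ i j : Fin (q + 1), M.tStar i ≠ M.tStar j → Δ < 1 / 2 * |M.tStar i - M.tStar j|

end ObservedModel

/-- The post-jump states `Z_n`, inter-jump times `S_n` and observation noises on a probability
space: `(Z_n, S_n)` is the embedded Markov chain of the PDMP started from the fixed initial state,
and the noises are i.i.d. with the prescribed density and independent of the chain.
`W n` is the noise of the observation at the `(n+1)`-st jump. -/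
structure ObservedProcess {d q : ℕ} (M : ObservedModel d q) {Ω : Type*} [MeasurableSpace Ω]
    (P : Measure Ω) where
  Z : ℕ → Ω → Fin q
  S : ℕ → Ω → ℝ
  W : ℕ → Ω → Vec d
  measurable_Z : ∀ n, Measurable (Z n)
  measurable_S : ∀ n, Measurable (S n)
  measurable_W : ∀ n, Measurable (W n)
  Z_zero : ∀ ω, Z 0 ω = M.start
  S_zero : ∀ ω, S 0 ω = 0
  /-- Markov property: given `(Z_0, S_0, …, Z_n, S_n)`, the pair `(Z_{n+1}, S_{n+1})` has law
  `stepLaw Z_n` -/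
  markov : ∀ (n : ℕ) (B : Set (Fin q × ℝ)), MeasurableSet B →
    P[({ω | (Z (n + 1) ω, S (n + 1) ω) ∈ B}).indicator (fun _ => (1 : ℝ)) |
      MeasurableSpace.comap (fun ω (k : Fin (n + 1)) => (Z k ω, S k ω)) inferInstance]
    =ᵐ[P] fun ω => (M.stepLaw (Z n ω)).real B
  law_W : ∀ n, P.map (W n) = M.noiseLaw
  iIndepFun_W : iIndepFun W P
  indepFun_W : IndepFun (fun ω n => (Z n ω, S n ω)) (fun ω n => W n ω) P

namespace ObservedProcess

variable {d q : ℕ} {M : ObservedModel d q} {Ω : Type*} [MeasurableSpace Ω] {P : Measure Ω}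
  (X : ObservedProcess M P)

/-- The observations: `Y_0 = x_0` and `Y_n = φ(Z_n) + W_n` for `n ≥ 1`. -/
def Y : ℕ → Ω → Vec d
  | 0 => fun _ => M.x M.start
  | n + 1 => fun ω => M.obs (X.Z (n + 1) ω) + X.W n ω

/-- The information available at the `n`-th jump time: `σ(Y_0, S_0, …, Y_n, S_n)`. -/
abbrev observed (n : ℕ) : MeasurableSpace Ω :=
  MeasurableSpace.comap (fun ω (k : Fin (n + 1)) => (X.Y k ω, X.S k ω)) inferInstance

/-- The filter: `Π_n^i` is the conditional probability of `Z_n = x_i` given the observations. -/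
def filter (n : ℕ) (ω : Ω) : Fin q → ℝ := fun i =>
  (P[({ω | X.Z n ω = i}).indicator (fun _ => (1 : ℝ)) | X.observed n]) ω

/-- `V_n = v_n(Π_n)`. -/
def V (g : Vec d → ℝ) (N n : ℕ) (ω : Ω) : ℝ := M.value g N n (X.filter n ω)

end ObservedProcess

/-- Quantization grids `Γ_n`, finite subsets of `M_1(E₀) × ℝ⁺`, and measurable nearest-neighbour
projections onto them with respect to the norm `nrm` (ties are broken arbitrarily). -/
structure Quantizer (q : ℕ) (nrm : (Fin q → ℝ) × ℝ → ℝ) where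
  Γ : ℕ → Finset ((Fin q → ℝ) × ℝ)
  Γ_subset : ∀ n, (Γ n : Set ((Fin q → ℝ) × ℝ)) ⊆ stdSimplex ℝ (Fin q) ×ˢ Ici (0 : ℝ)
  proj : ℕ → (Fin q → ℝ) × ℝ → (Fin q → ℝ) × ℝ
  measurable_proj : ∀ n, Measurable (proj n)
  proj_mem : ∀ n θ, proj n θ ∈ Γ n
  proj_nearest : ∀ n, ∀ θ ∈ stdSimplex ℝ (Fin q) ×ˢ Ici (0 : ℝ), ∀ γ ∈ Γ n,
    nrm (θ - proj n θ) ≤ nrm (θ - γ)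

namespace ObservedProcess

variable {d q : ℕ} {M : ObservedModel d q} {Ω : Type*} [MeasurableSpace Ω] {P : Measure Ω}
  (X : ObservedProcess M P) {nrm : (Fin q → ℝ) × ℝ → ℝ} (K : Quantizer q nrm)

/-- The quantized filter `Π̂_n`. -/
def filterHat (n : ℕ) (ω : Ω) : Fin q → ℝ := (K.proj n (X.filter n ω, X.S n ω)).1

/-- The quantized inter-jump time `Ŝ_n`. -/
def SHat (n : ℕ) (ω : Ω) : ℝ := (K.proj n (X.filter n ω, X.S n ω)).2

/-- `𝔼[f | Π̂_n = π]`, the elementary conditional expectation given an event (it is only relevant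
at the values `π` that `Π̂_n` takes with positive probability). -/
def condHat (n : ℕ) (π : Fin q → ℝ) (f : Ω → ℝ) : ℝ :=
  ∫ ω, f ω ∂(ProbabilityTheory.cond P {ω | X.filterHat K n ω = π})

/-- `Ĝ_{n+1} v(π, u) = 𝔼[v(Π̂_{n+1}) 1_{Ŝ_{n+1} ≤ u} | Π̂_n = π]`. -/
def GHat (n : ℕ) (v : (Fin q → ℝ) → ℝ) (π : Fin q → ℝ) (u : ℝ) : ℝ :=
  X.condHat K n π
    (({ω | X.SHat K (n + 1) ω ≤ u}).indicator (fun ω => v (X.filterHat K (n + 1) ω)))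

/-- `Ĥ_{n+1} h(π, u) = ∑_i π^i 1_{u < t*_i} h(Φ(x_i, u)) 𝔼[1_{Ŝ_{n+1} > u} | Π̂_n = π]`. -/
def HHat (n : ℕ) (h : Vec d → ℝ) (π : Fin q → ℝ) (u : ℝ) : ℝ :=
  M.flowReward h π u *
    X.condHat K n π (({ω | u < X.SHat K (n + 1) ω}).indicator (fun _ => (1 : ℝ)))

/-- `Ĵ_{n+1}(v, h) = Ĥ_{n+1} h + Ĝ_{n+1} v`. -/
def JHat (n : ℕ) (v : (Fin q → ℝ) → ℝ) (h : Vec d → ℝ) (π : Fin q → ℝ) (u : ℝ) : ℝ :=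
  X.HHat K n h π u + X.GHat K n v π u

/-- `K̂_{n+1} v(π) = 𝔼[v(Π̂_{n+1}) | Π̂_n = π]`. -/
def KHat (n : ℕ) (v : (Fin q → ℝ) → ℝ) (π : Fin q → ℝ) : ℝ :=
  X.condHat K n π (fun ω => v (X.filterHat K (n + 1) ω))

/-- `L̂^d_{n+1}(v, h)(π)`: the maximum of `K̂_{n+1} v(π)` and of `Ĵ_{n+1}(v, h)(π, u)` over the
(finite, non-empty) time grid `Gr(Δ)`. -/
def LHat (Δ : ℝ) (n : ℕ) (v : (Fin q → ℝ) → ℝ) (h : Vec d → ℝ) (π : Fin q → ℝ) : ℝ :=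
  max (sSup (X.JHat K n v h π '' M.grid Δ)) (X.KHat K n v π)

/-- The functions `v̂_n` indexed by the number `k = N - n` of remaining steps. -/
def valueHatRev (Δ : ℝ) (g : Vec d → ℝ) (N : ℕ) : ℕ → (Fin q → ℝ) → ℝ
  | 0 => fun π => ∑ i, g (M.x i) * π i
  | k + 1 => X.LHat K Δ (N - (k + 1)) (valueHatRev Δ g N k) g

/-- `v̂_N(π) = ∑_i g(x_i) π^i` and `v̂_{n-1} = L̂^d_n(v̂_n, g)`. -/
def valueHat (Δ : ℝ) (g : Vec d → ℝ) (N n : ℕ) : (Fin q → ℝ) → ℝ :=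
  X.valueHatRev K Δ g N (N - n)

/-- `V̂_n = v̂_n(Π̂_n)`. -/
def VHat (Δ : ℝ) (g : Vec d → ℝ) (N n : ℕ) (ω : Ω) : ℝ :=
  X.valueHat K Δ g N n (X.filterHat K n ω)

/-- The quantization error `‖S_n - Ŝ_n‖_p`. -/
def errS (p : ℝ) (n : ℕ) : ℝ := normLp P p (fun ω => X.S n ω - X.SHat K n ω)

/-- The quantization error `‖Π_n - Π̂_n‖_p`, with respect to the norm `∑ |π^i|`. -/
def errFilter (p : ℝ) (n : ℕ) : ℝ :=
  normLp P p (fun ω => l1 (X.filter n ω - X.filterHat K n ω))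

/-- The approximation error `‖V_n - V̂_n‖_p`. -/
def errV (Δ : ℝ) (g : Vec d → ℝ) (p : ℝ) (N n : ℕ) : ℝ :=
  normLp P p (fun ω => X.V g N n ω - X.VHat K Δ g N n ω)

end ObservedProcess

end

end PODP

open PODP

/-! The filter evolves by Bayes' rule. Given the observations up to step `n`, the next state,
observation and jump time have the mixture law with weights `Π_n` (`map_obsHist_next`), so `Π_{n+1}`
is the normalised vector of the mixture densities (`filter_succ_ae_eq`). The same formula describes
`oneStepFilter`, hence the expectation that defines `J` is a genuine conditional expectation along
the process (`setIntegral_J`).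

Regularity of `v_n`. Under a common reference measure the densities are linear in `π`, and the total
density times `v` at the normalised vector is the 1-homogeneous extension of `v`. If `v` is
`K`-Lipschitz and bounded by `C`, this extension is `(2K + C)`-Lipschitz (`abs_homogeneous_sub_le`).
The term `H` costs another `2C`, so one application of `L` turns `K` into `2K + 3C`; starting from
`C` this gives `(2^(k+2) - 3) C`.

One step is compared on each atom of `Π̂_n`, at its value `π`. (1) Replacing all stopping times by
the grid costs `a Δ` (`abs_L_sub_grid_le`): every time before the last exit time has a grid point
within `Δ` with no exit time between them, and away from exit times the jump law has density at most
`C_λ`. Beyond the last exit time `J` is constant, which is the reason for the extra term `K̂` in the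
maximum. (2) At a grid point, `J(π, u)` is replaced by the conditional mean of `J(Π_n, u)`, then by
the realised reward, then by its quantized version (`abs_J_sub_cond_le`). The indicators of `S ≤ u`
and `Ŝ ≤ u` disagree only if `|S - Ŝ| > η` or `S` lies within `η` of `u`. Markov's inequality
handles the first event; the second has conditional probability at most `2 C_λ η`, provided `η < Δ`,
because grid points stay at distance `Δ` from exit times (`cond_disagree_le`). (3) Conditioning on
`Π̂_n` contracts `L^p`, and passing from `Π_n` to `Π̂_n` inside `v_n` costs `[v_n]`. The choice `η =
(2 C_λ)^(-1/2) ‖S - Ŝ‖^(1/2)` balances the two events, and its admissibility is the hypothesis on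
`Δ`.

The values at step `n + 1` are compared directly, so the term with `2 [v_{n+1}]` in the statement is
slack. Convergence follows by backward induction, and `V_0 - V̂_0` is constant because the initial
observation is deterministic. -/

namespace PODP

noncomputable section

/-! ### Lipschitz functions on the simplex and normalisation of weight vectors -/

section Simplex

variable {q : ℕ}

theorem l1_nonneg (π : Fin q → ℝ) : 0 ≤ l1 π := Finset.sum_nonneg fun _ _ => abs_nonneg _

theorem l1_eq_zero {π : Fin q → ℝ} (h : l1 π = 0) : π = 0 := by
  ext i
  have := (Finset.sum_eq_zero_iff_of_nonneg (fun i _ => abs_nonneg (π i))).1 h i (Finset.mem_univ i)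
  simpa using this

theorem measurable_l1 : Measurable (l1 : (Fin q → ℝ) → ℝ) := by
  unfold l1
  exact Finset.measurable_sum _ fun i _ => (measurable_pi_apply i).abs

theorem l1_sub_comm (π π' : Fin q → ℝ) : l1 (π - π') = l1 (π' - π) := by
  simp [l1, abs_sub_comm]

theorem l1_of_mem_stdSimplex {π : Fin q → ℝ} (h : π ∈ stdSimplex ℝ (Fin q)) : l1 π = 1 := by
  rw [← h.2]
  exact Finset.sum_congr rfl fun i _ => abs_of_nonneg (h.1 i)

theorem l1_sub_le_two {π π' : Fin q → ℝ} (h : π ∈ stdSimplex ℝ (Fin q))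
    (h' : π' ∈ stdSimplex ℝ (Fin q)) : l1 (π - π') ≤ 2 := by
  calc l1 (π - π') ≤ l1 π + l1 π' := by
        unfold l1
        rw [← Finset.sum_add_distrib]
        exact Finset.sum_le_sum fun i _ => abs_sub _ _
    _ = 2 := by rw [l1_of_mem_stdSimplex h, l1_of_mem_stdSimplex h']; norm_num

/-- `v` is `K`-Lipschitz on the standard simplex for the `ℓ¹` norm. -/
def LipOnSimplex (v : (Fin q → ℝ) → ℝ) (K : ℝ) : Prop :=
  ∀ π ∈ stdSimplex ℝ (Fin q), ∀ π' ∈ stdSimplex ℝ (Fin q), |v π - v π'| ≤ K * l1 (π - π')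

/-- `v` is bounded by `C` on the standard simplex. -/
def BddOnSimplex (v : (Fin q → ℝ) → ℝ) (C : ℝ) : Prop :=
  ∀ π ∈ stdSimplex ℝ (Fin q), |v π| ≤ C

theorem LipOnSimplex.quotient_le {v : (Fin q → ℝ) → ℝ} {K : ℝ} (h : LipOnSimplex v K) :
    ∀ r ∈ lipQuotients v, r ≤ K := by
  rintro r ⟨π, hπ, π', hπ', hne, rfl⟩
  have hpos : 0 < l1 (π - π') :=
    lt_of_le_of_ne (l1_nonneg _) fun h0 => hne (sub_eq_zero.1 (l1_eq_zero h0.symm))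
  rw [div_le_iff₀ hpos]
  exact h π hπ π' hπ'

theorem LipOnSimplex.bddAbove {v : (Fin q → ℝ) → ℝ} {K : ℝ} (h : LipOnSimplex v K) :
    BddAbove (lipQuotients v) := ⟨K, h.quotient_le⟩

theorem LipOnSimplex.lipConst_le {v : (Fin q → ℝ) → ℝ} {K : ℝ} (h : LipOnSimplex v K)
    (hK : 0 ≤ K) : lipConst v ≤ K := Real.sSup_le h.quotient_le hK

theorem lipConst_nonneg (v : (Fin q → ℝ) → ℝ) : 0 ≤ lipConst v := by
  apply Real.sSup_nonneg
  rintro r ⟨π, _, π', _, _, rfl⟩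
  exact div_nonneg (abs_nonneg _) (l1_nonneg _)

/-- Some bound `K` has to be known beforehand: the real supremum of an unbounded set is `0`, and
`lipConst v` would then carry no information. -/
theorem LipOnSimplex.lipConst {v : (Fin q → ℝ) → ℝ} {K : ℝ} (h : LipOnSimplex v K) :
    LipOnSimplex v (lipConst v) := by
  intro π hπ π' hπ'
  by_cases hne : π = π'
  · subst hne; simp [l1]
  have hpos : 0 < l1 (π - π') :=
    lt_of_le_of_ne (l1_nonneg _) fun h0 => hne (sub_eq_zero.1 (l1_eq_zero h0.symm))
  rw [← div_le_iff₀ hpos]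
  exact le_csSup h.bddAbove ⟨π, hπ, π', hπ', hne, rfl⟩

theorem LipOnSimplex.continuousOn {v : (Fin q → ℝ) → ℝ} {K : ℝ} (h : LipOnSimplex v K) :
    ContinuousOn v (stdSimplex ℝ (Fin q)) := by
  intro π hπ
  rw [ContinuousWithinAt, tendsto_iff_dist_tendsto_zero]
  have hc : Filter.Tendsto (fun π' : Fin q → ℝ => K * l1 (π' - π))
      (nhdsWithin π (stdSimplex ℝ (Fin q))) (nhds 0) := by
    have : Continuous fun π' : Fin q → ℝ => K * l1 (π' - π) := by
      unfold l1; fun_prop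
    have h0 := this.tendsto π
    simp only [sub_self] at h0
    simp only [l1, Pi.zero_apply, abs_zero, Finset.sum_const_zero, mul_zero] at h0
    exact h0.mono_left nhdsWithin_le_nhds
  refine squeeze_zero' (Filter.Eventually.of_forall fun _ => dist_nonneg) ?_ hc
  filter_upwards [self_mem_nhdsWithin] with π' hπ'
  rw [Real.dist_eq]
  exact h π' hπ' π hπ

theorem measurableSet_stdSimplex : MeasurableSet (stdSimplex ℝ (Fin q)) :=
  (isClosed_stdSimplex (𝕜 := ℝ) (ι := Fin q)).measurableSet

theorem abs_sum_sub_sum_le (w w' : Fin q → ℝ) : |∑ j, w j - ∑ j, w' j| ≤ l1 (w - w') := by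
  rw [← Finset.sum_sub_distrib]
  exact Finset.abs_sum_le_sum_abs _ _

variable [NeZero q]

open Classical in
/-- A retraction onto the standard simplex. -/
def toSimplex (x : Fin q → ℝ) : Fin q → ℝ :=
  if x ∈ stdSimplex ℝ (Fin q) then x else Pi.single 0 1

theorem toSimplex_mem (x : Fin q → ℝ) : toSimplex x ∈ stdSimplex ℝ (Fin q) := by
  unfold toSimplex
  split_ifs with h
  · exact h
  · exact single_mem_stdSimplex ℝ 0

theorem toSimplex_of_mem {x : Fin q → ℝ} (h : x ∈ stdSimplex ℝ (Fin q)) : toSimplex x = x :=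
  if_pos h

theorem measurable_toSimplex : Measurable (toSimplex : (Fin q → ℝ) → Fin q → ℝ) :=
  Measurable.ite measurableSet_stdSimplex measurable_id measurable_const

/-- Nothing is known about `v` off the simplex, so measurability is available only after the
retraction; on the closed simplex it comes from continuity. -/
theorem LipOnSimplex.measurable_comp_toSimplex {v : (Fin q → ℝ) → ℝ} {K : ℝ}
    (h : LipOnSimplex v K) : Measurable fun x => v (toSimplex x) := by
  classical
  have : (fun x => v (toSimplex x)) =
      (stdSimplex ℝ (Fin q)).piecewise v fun _ => v (Pi.single 0 1) := by
    ext x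
    by_cases hx : x ∈ stdSimplex ℝ (Fin q) <;> simp [toSimplex, hx]
  rw [this]
  exact h.continuousOn.measurable_piecewise continuousOn_const measurableSet_stdSimplex

theorem LipOnSimplex.measurable_comp {α : Type*} [MeasurableSpace α] {v : (Fin q → ℝ) → ℝ} {K : ℝ}
    (h : LipOnSimplex v K) {F : α → Fin q → ℝ} (hF : Measurable F)
    (hmem : ∀ a, F a ∈ stdSimplex ℝ (Fin q)) : Measurable fun a => v (F a) := by
  have : (fun a => v (F a)) = fun a => v (toSimplex (F a)) := by
    ext a; rw [toSimplex_of_mem (hmem a)]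
  rw [this]
  exact h.measurable_comp_toSimplex.comp hF

/-- The probability vector proportional to a vector of nonnegative weights. -/
def normalize (w : Fin q → ℝ) : Fin q → ℝ := toSimplex fun j => w j / ∑ k, w k

theorem normalize_mem (w : Fin q → ℝ) : normalize w ∈ stdSimplex ℝ (Fin q) := toSimplex_mem _

theorem measurable_normalize : Measurable (normalize : (Fin q → ℝ) → Fin q → ℝ) := by
  refine measurable_toSimplex.comp (measurable_pi_lambda _ fun j => ?_)
  exact (measurable_pi_apply j).div (Finset.measurable_sum _ fun i _ => measurable_pi_apply i)

/-- Zero total mass is allowed, because then all weights vanish. This makes the arbitrary vertex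
chosen by `toSimplex` harmless and avoids any discussion of null observations. -/
theorem sum_mul_normalize {w : Fin q → ℝ} (hw : ∀ j, 0 ≤ w j) (j : Fin q) :
    (∑ k, w k) * normalize w j = w j := by
  by_cases hs : ∑ k, w k = 0
  · have := (Finset.sum_eq_zero_iff_of_nonneg (fun i _ => hw i)).1 hs j (Finset.mem_univ j)
    rw [hs, this, zero_mul]
  · have hmem : (fun j => w j / ∑ k, w k) ∈ stdSimplex ℝ (Fin q) :=
      ⟨fun j => div_nonneg (hw j) (Finset.sum_nonneg fun i _ => hw i), by
        rw [← Finset.sum_div, div_self hs]⟩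
    rw [normalize, toSimplex_of_mem hmem]
    field_simp

/-- The `1`-homogeneous extension of a bounded Lipschitz function on the simplex is Lipschitz. -/
theorem abs_homogeneous_sub_le {v : (Fin q → ℝ) → ℝ} {K C : ℝ} (hv : LipOnSimplex v K)
    (hK : 0 ≤ K) (hb : BddOnSimplex v C) {w w' : Fin q → ℝ} (hw : ∀ j, 0 ≤ w j)
    (hw' : ∀ j, 0 ≤ w' j) :
    |(∑ j, w j) * v (normalize w) - (∑ j, w' j) * v (normalize w')|
      ≤ (2 * K + C) * l1 (w - w') := by
  set s := ∑ j, w j with hs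
  set s' := ∑ j, w' j with hs'
  have hs0 : 0 ≤ s := Finset.sum_nonneg fun i _ => hw i
  have h1 : |s - s'| ≤ l1 (w - w') := abs_sum_sub_sum_le w w'
  -- With `ν` the normalisation, `s (ν w - ν w') = (w - w') - (s - s') ν w'`. Both terms have norm
  -- at most `l1 (w - w')`, whence the factor `2` in front of `K`.
  have h2 : s * l1 (normalize w - normalize w') ≤ 2 * l1 (w - w') := by
    calc s * l1 (normalize w - normalize w')
        = ∑ j, |s * normalize w j - s * normalize w' j| := by
          rw [l1, Finset.mul_sum]
          refine Finset.sum_congr rfl fun j _ => ?_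
          rw [← mul_sub, abs_mul, abs_of_nonneg hs0, Pi.sub_apply]
      _ ≤ ∑ j, (|w j - w' j| + |s - s'| * normalize w' j) := by
          refine Finset.sum_le_sum fun j _ => ?_
          have hn := (normalize_mem w').1 j
          have e : s * normalize w j - s * normalize w' j
              = (w j - w' j) + (-((s - s') * normalize w' j)) := by
            have a1 := sum_mul_normalize hw j
            have a2 := sum_mul_normalize hw' j
            rw [← hs] at a1
            rw [← hs'] at a2
            linarith
          rw [e]
          refine (abs_add_le _ _).trans ?_
          rw [abs_neg, abs_mul, abs_of_nonneg hn]
      _ = l1 (w - w') + |s - s'| := by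
          rw [Finset.sum_add_distrib, ← Finset.mul_sum, (normalize_mem w').2, mul_one]
          rfl
      _ ≤ 2 * l1 (w - w') := by linarith
  have e : s * v (normalize w) - s' * v (normalize w')
      = s * (v (normalize w) - v (normalize w')) + (s - s') * v (normalize w') := by ring
  rw [e]
  refine (abs_add_le _ _).trans ?_
  rw [abs_mul, abs_mul, abs_of_nonneg hs0]
  have h3 := hv _ (normalize_mem w) _ (normalize_mem w')
  have h4 := hb _ (normalize_mem w')
  have h5 : s * |v (normalize w) - v (normalize w')| ≤ K * (2 * l1 (w - w')) :=
    calc _ ≤ s * (K * l1 (normalize w - normalize w')) := by gcongr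
      _ = K * (s * l1 (normalize w - normalize w')) := by ring
      _ ≤ _ := by gcongr
  have h6 : |s - s'| * |v (normalize w')| ≤ l1 (w - w') * C :=
    mul_le_mul h1 h4 (abs_nonneg _) (l1_nonneg _)
  linarith

end Simplex

end

end PODP

/-! ### Mixtures of laws and the Bayes filter -/

namespace PODP

noncomputable section

section Mixture

variable {q : ℕ} {O : Type*} [MeasurableSpace O] (κ : Fin q → Measure (Fin q × O))

/-- The mixture `∑ᵢ πⁱ κᵢ`. -/
def mixLaw (π : Fin q → ℝ) : Measure (Fin q × O) := ∑ i, ENNReal.ofReal (π i) • κ i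

/-- The second marginal of `κᵢ` on the event that the first coordinate is `j`. -/
def component (i j : Fin q) : Measure O := ((κ i).restrict {z | z.1 = j}).map Prod.snd

/-- A measure dominating all second marginals. -/
def obsRef : Measure O := ∑ i, (κ i).map Prod.snd

/-- The density of `component κ i j` with respect to `obsRef κ`. -/
def dens (i j : Fin q) (o : O) : ℝ := ((component κ i j).rnDeriv (obsRef κ) o).toReal

/-- The unnormalised filter. -/
def weight (π : Fin q → ℝ) (o : O) (j : Fin q) : ℝ := ∑ i, π i * dens κ i j o

theorem measurableSet_fst_eq (j : Fin q) : MeasurableSet {z : Fin q × O | z.1 = j} :=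
  measurable_fst (measurableSet_singleton j)

theorem measurable_dens (i j : Fin q) : Measurable (dens κ i j) :=
  (Measure.measurable_rnDeriv _ _).ennreal_toReal

theorem dens_nonneg (i j : Fin q) (o : O) : 0 ≤ dens κ i j o := ENNReal.toReal_nonneg

theorem weight_nonneg {π : Fin q → ℝ} (hπ : ∀ i, 0 ≤ π i) (o : O) (j : Fin q) :
    0 ≤ weight κ π o j :=
  Finset.sum_nonneg fun i _ => mul_nonneg (hπ i) (dens_nonneg κ i j o)

theorem measurable_weight : Measurable fun z : (Fin q → ℝ) × O => weight κ z.1 z.2 := by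
  refine measurable_pi_lambda _ fun j => Finset.measurable_sum _ fun i _ => ?_
  exact ((measurable_pi_apply i).comp measurable_fst).mul ((measurable_dens κ i j).comp measurable_snd)

theorem lintegral_eq_sum_component (i : Fin q) {f : Fin q × O → ENNReal} (hf : Measurable f) :
    ∫⁻ z, f z ∂(κ i) = ∑ j, ∫⁻ o, f (j, o) ∂(component κ i j) := by
  have h1 : ∀ z, f z = ∑ j, ({z : Fin q × O | z.1 = j}).indicator f z := by
    intro z
    rw [Finset.sum_eq_single z.1]
    · simp
    · intro j _ hj; simp [hj.symm]
    · simp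
  calc ∫⁻ z, f z ∂(κ i) = ∫⁻ z, ∑ j, ({z : Fin q × O | z.1 = j}).indicator f z ∂(κ i) := by
        simp_rw [← h1]
    _ = ∑ j, ∫⁻ z in {z : Fin q × O | z.1 = j}, f z ∂(κ i) := by
        rw [lintegral_finsetSum _ fun j _ => hf.indicator (measurableSet_fst_eq j)]
        exact Finset.sum_congr rfl fun j _ => lintegral_indicator (measurableSet_fst_eq j) _
    _ = _ := by
        refine Finset.sum_congr rfl fun j _ => ?_
        rw [component, lintegral_map (f := fun o => f (j, o)) (hf.comp measurable_prodMk_left)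
          measurable_snd]
        refine setLIntegral_congr_fun (measurableSet_fst_eq j) fun z hz => ?_
        have : z = (j, z.2) := Prod.ext hz rfl
        rw [this]

variable [∀ i, IsProbabilityMeasure (κ i)]

instance isFiniteMeasure_component (i j : Fin q) : IsFiniteMeasure (component κ i j) := by
  unfold component; infer_instance

instance isFiniteMeasure_obsRef : IsFiniteMeasure (obsRef κ) := by
  unfold obsRef; infer_instance

omit [∀ i, IsProbabilityMeasure (κ i)] in
theorem component_le (i j : Fin q) : component κ i j ≤ obsRef κ := by
  refine (Measure.map_mono Measure.restrict_le_self measurable_snd).trans ?_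
  refine Measure.le_iff.2 fun s _ => ?_
  simp only [obsRef, Measure.coe_finsetSum, Finset.sum_apply]
  exact Finset.single_le_sum (f := fun i => (κ i).map Prod.snd s) (fun _ _ => zero_le)
    (Finset.mem_univ i)

theorem lintegral_component (i j : Fin q) {f : O → ENNReal} (hf : Measurable f) :
    ∫⁻ o, f o ∂(component κ i j) = ∫⁻ o, f o * ENNReal.ofReal (dens κ i j o) ∂(obsRef κ) := by
  rw [← lintegral_rnDeriv_mul (Measure.absolutelyContinuous_of_le (component_le κ i j))
    hf.aemeasurable]
  refine lintegral_congr_ae ?_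
  filter_upwards [Measure.rnDeriv_lt_top (component κ i j) (obsRef κ)] with o ho
  rw [dens, ENNReal.ofReal_toReal ho.ne, mul_comm]

/-- All components have densities with respect to `obsRef κ`, which does not involve `π`. The
weights `π` therefore enter only through the linear expression `weight κ π`, and two mixtures can be
compared under one measure. -/
theorem lintegral_mixLaw {π : Fin q → ℝ} (hπ : ∀ i, 0 ≤ π i) {f : Fin q × O → ENNReal}
    (hf : Measurable f) :
    ∫⁻ z, f z ∂(mixLaw κ π)
      = ∫⁻ o, ∑ j, f (j, o) * ENNReal.ofReal (weight κ π o j) ∂(obsRef κ) := by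
  have hm : ∀ i j, Measurable fun o => f (j, o) * ENNReal.ofReal (dens κ i j o) := fun i j =>
    (hf.comp measurable_prodMk_left).mul (measurable_dens κ i j).ennreal_ofReal
  calc ∫⁻ z, f z ∂(mixLaw κ π)
      = ∑ i, ENNReal.ofReal (π i) * ∑ j, ∫⁻ o, f (j, o) * ENNReal.ofReal (dens κ i j o)
          ∂(obsRef κ) := by
        rw [mixLaw, lintegral_finsetSum_measure]
        refine Finset.sum_congr rfl fun i _ => ?_
        rw [lintegral_smul_measure, lintegral_eq_sum_component κ i hf, smul_eq_mul]
        congr 1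
        exact Finset.sum_congr rfl fun j _ => lintegral_component κ i j (hf.comp measurable_prodMk_left)
    _ = ∫⁻ o, ∑ i, ENNReal.ofReal (π i) * ∑ j, f (j, o) * ENNReal.ofReal (dens κ i j o)
          ∂(obsRef κ) := by
        rw [lintegral_finsetSum _ fun i _ =>
          (Finset.measurable_sum _ fun j _ => hm i j).const_mul _]
        refine Finset.sum_congr rfl fun i _ => ?_
        rw [lintegral_const_mul _ (Finset.measurable_sum _ fun j _ => hm i j),
          lintegral_finsetSum _ fun j _ => hm i j]
    _ = _ := by
        refine lintegral_congr fun o => ?_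
        simp_rw [Finset.mul_sum]
        rw [Finset.sum_comm]
        refine Finset.sum_congr rfl fun j _ => ?_
        rw [weight, ENNReal.ofReal_sum_of_nonneg
          fun i _ => mul_nonneg (hπ i) (dens_nonneg κ i j o), Finset.mul_sum]
        refine Finset.sum_congr rfl fun i _ => ?_
        rw [ENNReal.ofReal_mul (hπ i)]
        ring

theorem isProbabilityMeasure_mixLaw {π : Fin q → ℝ} (hπ : π ∈ stdSimplex ℝ (Fin q)) :
    IsProbabilityMeasure (mixLaw κ π) := ⟨by
  simp only [mixLaw, Measure.coe_finsetSum, Finset.sum_apply, Measure.smul_apply, measure_univ,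
    smul_eq_mul, mul_one]
  rw [← ENNReal.ofReal_sum_of_nonneg fun i _ => hπ.1 i, hπ.2, ENNReal.ofReal_one]⟩

omit [∀ i, IsProbabilityMeasure (κ i)] in
theorem measurable_mixLaw : Measurable (mixLaw κ) := by
  refine Measure.measurable_of_measurable_coe _ fun s _ => ?_
  simp only [mixLaw, Measure.coe_finsetSum, Finset.sum_apply, Measure.smul_apply, smul_eq_mul]
  exact Finset.measurable_sum _ fun i _ => (measurable_pi_apply i).ennreal_ofReal.mul_const _

/-- The mixture with weights depending measurably on a parameter. -/
def mixKernel {Θ : Type*} [MeasurableSpace Θ] {F : Θ → Fin q → ℝ} (hF : Measurable F) :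
    Kernel Θ (Fin q × O) := ⟨fun θ => mixLaw κ (F θ), (measurable_mixLaw κ).comp hF⟩

omit [∀ i, IsProbabilityMeasure (κ i)] in
theorem mixKernel_apply {Θ : Type*} [MeasurableSpace Θ] {F : Θ → Fin q → ℝ} (hF : Measurable F)
    (θ : Θ) : mixKernel κ hF θ = mixLaw κ (F θ) := rfl

theorem isMarkovKernel_mixKernel {Θ : Type*} [MeasurableSpace Θ] {F : Θ → Fin q → ℝ}
    (hF : Measurable F) (hmem : ∀ θ, F θ ∈ stdSimplex ℝ (Fin q)) :
    IsMarkovKernel (mixKernel κ hF) := ⟨fun θ => isProbabilityMeasure_mixLaw κ (hmem θ)⟩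

theorem integral_dens (i j : Fin q) :
    Integrable (dens κ i j) (obsRef κ) := Measure.integrable_toReal_rnDeriv

/-- The total mass of `κ i`. It ensures that integrating the distance of two weight vectors gives
back at most `l1 (π - π')`, without a further constant. -/
theorem sum_integral_dens (i : Fin q) : ∑ j, ∫ o, dens κ i j o ∂(obsRef κ) = 1 := by
  have h := lintegral_eq_sum_component κ i (f := fun _ => 1) measurable_const
  simp only [lintegral_one, measure_univ] at h
  have h2 : ∀ j, ∫ o, dens κ i j o ∂(obsRef κ) = (component κ i j univ).toReal := fun j => by
    have := Measure.integral_toReal_rnDeriv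
      (Measure.absolutelyContinuous_of_le (component_le κ i j))
    simpa [dens, Measure.real] using this
  simp_rw [h2]
  rw [← ENNReal.toReal_sum fun j _ => measure_ne_top _ _, ← h, ENNReal.toReal_one]

theorem integrable_weight (π : Fin q → ℝ) (j : Fin q) :
    Integrable (fun o => weight κ π o j) (obsRef κ) :=
  integrable_finsetSum _ fun i _ => (integral_dens κ i j).const_mul _

theorem integral_mixLaw_snd {π : Fin q → ℝ} (hπ : ∀ i, 0 ≤ π i) {f : O → ℝ} (hf : Measurable f) :
    ∫ z, f z.2 ∂(mixLaw κ π) = ∫ o, (∑ j, weight κ π o j) * f o ∂(obsRef κ) := by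
  have hw : Measurable fun o => ∑ j, weight κ π o j :=
    Finset.measurable_sum _ fun j _ => (measurable_pi_apply j).comp
      ((measurable_weight κ).comp measurable_prodMk_left)
  have hmap : (mixLaw κ π).map Prod.snd
      = (obsRef κ).withDensity fun o => ENNReal.ofReal (∑ j, weight κ π o j) := by
    refine Measure.ext_of_lintegral _ fun g hg => ?_
    rw [lintegral_map hg measurable_snd, lintegral_mixLaw κ hπ (f := fun z => g z.2) (hg.comp measurable_snd),
      lintegral_withDensity_eq_lintegral_mul _ hw.ennreal_ofReal hg]
    refine lintegral_congr fun o => ?_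
    rw [Pi.mul_apply, ENNReal.ofReal_sum_of_nonneg fun j _ => weight_nonneg κ hπ o j,
      Finset.sum_mul]
    exact Finset.sum_congr rfl fun j _ => mul_comm _ _
  rw [← integral_map (φ := Prod.snd) measurable_snd.aemeasurable hf.aestronglyMeasurable, hmap,
    integral_withDensity_eq_integral_toReal_smul hw.ennreal_ofReal (by simp)]
  refine integral_congr_ae (Filter.Eventually.of_forall fun o => ?_)
  simp only [smul_eq_mul]
  rw [ENNReal.toReal_ofReal (Finset.sum_nonneg fun j _ => weight_nonneg κ hπ o j)]

variable [NeZero q]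

/-- The Bayes filter: the conditional law of the first coordinate given the second one, under the
mixture with weights `π`. -/
def bayes (π : Fin q → ℝ) (o : O) : Fin q → ℝ := normalize (weight κ π o)

omit [∀ i, IsProbabilityMeasure (κ i)] in
theorem bayes_mem (π : Fin q → ℝ) (o : O) : bayes κ π o ∈ stdSimplex ℝ (Fin q) := normalize_mem _

omit [∀ i, IsProbabilityMeasure (κ i)] in
theorem measurable_bayes : Measurable fun z : (Fin q → ℝ) × O => bayes κ z.1 z.2 :=
  measurable_normalize.comp (measurable_weight κ)

/-- On `A` both integrands are the 1-homogeneous extension of `v` at the weight vectors of `π` and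
`π'`: the total weight is the density of the observation and the Bayes filter is the normalised
weight. So `abs_homogeneous_sub_le` applies pointwise, although the filter itself need not be
Lipschitz in `π`. -/
theorem abs_integral_bayes_sub_le {v : (Fin q → ℝ) → ℝ} {K C : ℝ} (hv : LipOnSimplex v K)
    (hK : 0 ≤ K) (hb : BddOnSimplex v C) {A : Set O} (hA : MeasurableSet A) {π π' : Fin q → ℝ}
    (hπ : ∀ i, 0 ≤ π i) (hπ' : ∀ i, 0 ≤ π' i) :
    |∫ z, A.indicator (fun o => v (bayes κ π o)) z.2 ∂(mixLaw κ π)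
        - ∫ z, A.indicator (fun o => v (bayes κ π' o)) z.2 ∂(mixLaw κ π')|
      ≤ (2 * K + C) * l1 (π - π') := by
  have hC : 0 ≤ C := (abs_nonneg _).trans (hb _ (normalize_mem 0))
  have hm : ∀ ρ : Fin q → ℝ, Measurable (A.indicator fun o => v (bayes κ ρ o)) := fun ρ =>
    (hv.measurable_comp ((measurable_bayes κ).comp measurable_prodMk_left)
      fun o => bayes_mem κ ρ o).indicator hA
  have hbd : ∀ (ρ : Fin q → ℝ) o, |A.indicator (fun o => v (bayes κ ρ o)) o| ≤ C := by
    intro ρ o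
    by_cases ho : o ∈ A
    · simpa [ho] using hb _ (bayes_mem κ ρ o)
    · simpa [ho] using hC
  have hint : ∀ ρ : Fin q → ℝ, Integrable
      (fun o => (∑ j, weight κ ρ o j) * A.indicator (fun o => v (bayes κ ρ o)) o) (obsRef κ) :=
    fun ρ => (integrable_finsetSum _ fun j _ => integrable_weight κ ρ j).mul_bdd (c := C)
      (hm ρ).aestronglyMeasurable (Filter.Eventually.of_forall fun o => hbd ρ o)
  rw [integral_mixLaw_snd κ hπ (hm π), integral_mixLaw_snd κ hπ' (hm π'),
    ← integral_sub (hint π) (hint π')]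
  have hR : Integrable (fun o => (2 * K + C) * ∑ j, ∑ i, |π i - π' i| * dens κ i j o) (obsRef κ) :=
    (integrable_finsetSum _ fun j _ => integrable_finsetSum _ fun i _ =>
      (integral_dens κ i j).const_mul _).const_mul _
  have hval : ∫ o, (2 * K + C) * ∑ j, ∑ i, |π i - π' i| * dens κ i j o ∂(obsRef κ)
      = (2 * K + C) * l1 (π - π') := by
    rw [integral_const_mul]
    congr 1
    rw [integral_finsetSum _ fun j _ => integrable_finsetSum _ fun i _ =>
      (integral_dens κ i j).const_mul _]
    simp_rw [integral_finsetSum _ fun i _ => (integral_dens κ i _).const_mul (|π i - π' i|),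
      integral_const_mul]
    rw [Finset.sum_comm]
    simp_rw [← Finset.mul_sum, sum_integral_dens, mul_one]
    rfl
  rw [← hval]
  refine (abs_integral_le_integral_abs).trans (integral_mono ((hint π).sub (hint π')).abs hR ?_)
  intro o
  have hl : l1 (weight κ π o - weight κ π' o) ≤ ∑ j, ∑ i, |π i - π' i| * dens κ i j o := by
    refine Finset.sum_le_sum fun j _ => ?_
    rw [Pi.sub_apply, weight, weight, ← Finset.sum_sub_distrib]
    refine (Finset.abs_sum_le_sum_abs _ _).trans (Finset.sum_le_sum fun i _ => ?_)
    rw [← sub_mul, abs_mul, abs_of_nonneg (dens_nonneg κ i j o)]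
  by_cases ho : o ∈ A
  · simp only [indicator_of_mem ho]
    refine (abs_homogeneous_sub_le hv hK hb (weight_nonneg κ hπ o)
      (weight_nonneg κ hπ' o)).trans ?_
    gcongr
  · simp only [indicator_of_notMem ho, mul_zero, sub_zero, abs_zero]
    exact mul_nonneg (by positivity) ((l1_nonneg _).trans hl)

set_option maxHeartbeats 1000000 in
/-- If, given `h`, the pair `(ζ, o)` has the mixture law with weights `F h`, then the conditional
law of `ζ` given `(h, o)` is given by the Bayes filter. -/
theorem bayes_ae_eq_condExp {Ω Θ : Type*} [mΩ : MeasurableSpace Ω] [MeasurableSpace Θ]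
    {P : Measure Ω} [IsProbabilityMeasure P] {h : Ω → Θ} {ζ : Ω → Fin q} {o : Ω → O}
    (hh : Measurable h) (hζ : Measurable ζ) (ho : Measurable o) {F : Θ → Fin q → ℝ}
    (hF : Measurable F) (hmem : ∀ θ, F θ ∈ stdSimplex ℝ (Fin q))
    (hlaw : P.map (fun ω => (h ω, ζ ω, o ω)) = P.map h ⊗ₘ mixKernel κ hF) (j : Fin q) :
    (fun ω => bayes κ (F (h ω)) (o ω) j)
      =ᵐ[P] P[({ω | ζ ω = j}).indicator (fun _ => (1 : ℝ)) |
        MeasurableSpace.comap (fun ω => (h ω, o ω)) inferInstance] := by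
  have hho : Measurable fun ω => (h ω, o ω) := hh.prodMk ho
  have := isMarkovKernel_mixKernel κ hF hmem
  have hset : MeasurableSet {ω | ζ ω = j} := hζ (measurableSet_singleton j)
  have hB : Measurable fun z : Θ × O => bayes κ (F z.1) z.2 j :=
    (measurable_pi_apply j).comp ((measurable_bayes κ).comp
      ((hF.comp measurable_fst).prodMk measurable_snd))
  have hBω : Measurable fun ω => bayes κ (F (h ω)) (o ω) j := hB.comp hho
  have hb0 : ∀ z : Θ × O, 0 ≤ bayes κ (F z.1) z.2 j := fun z => (bayes_mem κ _ _).1 j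
  have hb1 : ∀ z : Θ × O, bayes κ (F z.1) z.2 j ≤ 1 := fun z => by
    rw [← (bayes_mem κ (F z.1) z.2).2]
    exact Finset.single_le_sum (fun i _ => (bayes_mem κ (F z.1) z.2).1 i) (Finset.mem_univ j)
  have hintB : Integrable (fun ω => bayes κ (F (h ω)) (o ω) j) P :=
    Integrable.of_bound hBω.aestronglyMeasurable 1 (Filter.Eventually.of_forall fun ω => by
      rw [Real.norm_of_nonneg (hb0 (h ω, o ω))]; exact hb1 (h ω, o ω))
  -- The assumption on the joint law, written with densities; both sides of the defining identity of
  -- the conditional expectation are computed from it.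
  have key : ∀ ψ : Θ × Fin q × O → ENNReal, Measurable ψ →
      ∫⁻ ω, ψ (h ω, ζ ω, o ω) ∂P = ∫⁻ θ, ∫⁻ y, ∑ k, ψ (θ, k, y) *
        ENNReal.ofReal (weight κ (F θ) y k) ∂(obsRef κ) ∂(P.map h) := by
    intro ψ hψ
    rw [← lintegral_map (f := ψ) hψ (hh.prodMk (hζ.prodMk ho)), hlaw,
      Measure.lintegral_compProd hψ]
    refine lintegral_congr fun θ => ?_
    rw [mixKernel_apply, lintegral_mixLaw κ (hmem θ).1 (f := fun z => ψ (θ, z))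
      (hψ.comp measurable_prodMk_left)]
  refine ae_eq_condExp_of_forall_setIntegral_eq hho.comap_le ?_ ?_ ?_ ?_
  · exact (integrable_const (1 : ℝ)).indicator hset
  · exact fun s _ _ => hintB.integrableOn
  · rintro s ⟨C, hC, rfl⟩ -
    have hCm : MeasurableSet ((fun ω => (h ω, o ω)) ⁻¹' C) := hho hC
    have e1 : ∫ ω in (fun ω => (h ω, o ω)) ⁻¹' C, bayes κ (F (h ω)) (o ω) j ∂P
        = (∫⁻ ω, C.indicator (fun z => ENNReal.ofReal (bayes κ (F z.1) z.2 j)) (h ω, o ω)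
            ∂P).toReal := by
      rw [integral_eq_lintegral_of_nonneg_ae (Filter.Eventually.of_forall fun ω => hb0 (h ω, o ω))
        hBω.aestronglyMeasurable, ← lintegral_indicator hCm]
      rfl
    have e2 : ∫ ω in (fun ω => (h ω, o ω)) ⁻¹' C,
          ({ω | ζ ω = j}).indicator (fun _ => (1 : ℝ)) ω ∂P
        = (∫⁻ ω, C.indicator (fun _ => ({k : Fin q | k = j}).indicator (fun _ => (1 : ENNReal)) (ζ ω)) (h ω, o ω)
            ∂P).toReal := by
      rw [setIntegral_indicator hset, setIntegral_one_eq_measureReal, Measure.real,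
        ← lintegral_indicator_one (hCm.inter hset)]
      congr 1
      refine lintegral_congr fun ω => ?_
      by_cases h1 : (h ω, o ω) ∈ C <;> by_cases h2 : ζ ω = j <;> simp [h1, h2]
    rw [e1, e2]
    congr 1
    have m1 : Measurable fun z : Θ × Fin q × O =>
        C.indicator (fun z => ENNReal.ofReal (bayes κ (F z.1) z.2 j)) (z.1, z.2.2) :=
      (hB.ennreal_ofReal.indicator hC).comp
        (measurable_fst.prodMk (measurable_snd.comp measurable_snd))
    have m2 : Measurable fun z : Θ × Fin q × O =>
        C.indicator (fun _ => ({k : Fin q | k = j}).indicator (fun _ => (1 : ENNReal)) z.2.1) (z.1, z.2.2) := by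
      have : (fun z : Θ × Fin q × O => C.indicator
          (fun _ => ({k : Fin q | k = j}).indicator (fun _ => (1 : ENNReal)) z.2.1) (z.1, z.2.2))
          = ((fun z : Θ × Fin q × O => (z.1, z.2.2)) ⁻¹' C ∩ {z | z.2.1 = j}).indicator
            fun _ => 1 := by
        ext z
        by_cases h1 : (z.1, z.2.2) ∈ C <;> by_cases h2 : z.2.1 = j <;> simp [h1, h2]
      rw [this]
      refine measurable_const.indicator (MeasurableSet.inter
        ((measurable_fst.prodMk (measurable_snd.comp measurable_snd)) hC) ?_)
      exact (measurable_fst.comp measurable_snd) (measurableSet_singleton j)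
    rw [key _ m1, key _ m2]
    refine lintegral_congr fun θ => lintegral_congr fun y => ?_
    by_cases hy : (θ, y) ∈ C
    · simp only [indicator_of_mem hy]
      -- Bayes' formula: the total weight times the normalised weight of `j` is the weight of `j`.
      rw [← Finset.mul_sum, ← ENNReal.ofReal_sum_of_nonneg
        fun k _ => weight_nonneg κ (hmem θ).1 y k, ← ENNReal.ofReal_mul (hb0 (θ, y)), mul_comm,
        bayes, sum_mul_normalize (weight_nonneg κ (hmem θ).1 y) j, Finset.sum_eq_single j]
      · simp
      · intro k _ hk; simp [hk]
      · simp
    · simp [indicator_of_notMem hy]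
  · exact (hB.comp (comap_measurable _)).stronglyMeasurable.aestronglyMeasurable

end Mixture

end

end PODP

/-! ### The flow, the jump times and the one-step transition law -/

namespace PODP

noncomputable section

namespace LocalCharacteristics

variable {d : ℕ} (D : LocalCharacteristics d)

/-- The semigroup law makes the map at time `0` idempotent, and an injective idempotent map is the
identity. -/
theorem flow_zero (x : Vec d) : D.flow x 0 = x := by
  have h := D.flow_add x 0 0 le_rfl le_rfl
  rw [add_zero] at h
  exact ((D.isHomeomorph_flow 0 le_rfl).injective h).symm

theorem continuousOn_flow_time (x : Vec d) : ContinuousOn (D.flow x) (Ici 0) :=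
  D.continuousOn_flow.comp (f := fun t : ℝ => (x, t)) (by fun_prop) fun t ht => ⟨mem_univ _, ht⟩

theorem continuous_flow_max (x : Vec d) : Continuous fun t : ℝ => D.flow x (max t 0) :=
  (D.continuousOn_flow_time x).comp_continuous (by fun_prop) fun t => le_max_right t 0

/-- A connected path that starts in the open set `E` and avoids its frontier is covered by the
disjoint open sets `E` and the complement of the closure of `E`, so it cannot meet the second one.
-/
theorem flow_mem_of_lt_exitTime {x : Vec d} (hx : x ∈ D.E) {t : ℝ} (ht : 0 ≤ t)
    (htx : ENNReal.ofReal t < D.exitTime x) : D.flow x t ∈ D.E := by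
  by_contra hcon
  have hpre : IsPreconnected (D.flow x '' Icc 0 t) :=
    isPreconnected_Icc.image _ ((D.continuousOn_flow_time x).mono fun s hs => hs.1)
  have h0 : (D.flow x '' Icc 0 t ∩ D.E).Nonempty :=
    ⟨x, ⟨0, ⟨le_rfl, ht⟩, D.flow_zero x⟩, hx⟩
  have hfr : ∀ s ∈ Icc 0 t, D.flow x s ∉ frontier D.E := by
    intro s hs hy
    have hs0 : 0 < s := by
      -- The exit time ranges over positive times only; time `0` is excluded separately because `x`
      -- lies in the open set `E`, hence not on its frontier.
      refine lt_of_le_of_ne hs.1 fun h => ?_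
      rw [← h, D.flow_zero, D.isOpen_E.frontier_eq] at hy
      exact hy.2 hx
    have : D.exitTime x ≤ ENNReal.ofReal s := sInf_le ⟨s, ⟨hs0, hy⟩, rfl⟩
    exact absurd (this.trans (ENNReal.ofReal_le_ofReal hs.2)) (not_le.2 htx)
  have hcl : ∀ s ∈ Icc 0 t, D.flow x s ∉ D.E → D.flow x s ∉ closure D.E := fun s hs hE hc =>
    hfr s hs (by rw [D.isOpen_E.frontier_eq]; exact ⟨hc, hE⟩)
  obtain ⟨y, -, hy1, hy2⟩ := hpre D.E (closure D.E)ᶜ D.isOpen_E isClosed_closure.isOpen_compl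
    (by
      rintro _ ⟨s, hs, rfl⟩
      by_cases hE : D.flow x s ∈ D.E
      · exact Or.inl hE
      · exact Or.inr (hcl s hs hE))
    h0 ⟨_, ⟨t, ⟨ht, le_rfl⟩, rfl⟩, hcl t ⟨ht, le_rfl⟩ hcon⟩
  exact hy2 (subset_closure hy1)

open Classical in
/-- The rate along the flow, extended measurably to all times. -/
def rateAlong (x : Vec d) (t : ℝ) : ℝ := (closure D.E).indicator D.rate (D.flow x (max t 0))

/-- The integral of the extended rate along the flow. -/
def cumRateExt (x : Vec d) (t : ℝ) : ℝ := ∫ s in (0 : ℝ)..t, D.rateAlong x s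

theorem measurable_rateAlong (x : Vec d) : Measurable (D.rateAlong x) := by
  have hcl : MeasurableSet (closure D.E) := isClosed_closure.measurableSet
  have h : Measurable ((closure D.E).indicator D.rate) := by
    refine measurable_of_restrict_of_restrict_compl hcl ?_ ?_
    · convert D.measurable_rate using 1
      ext y
      simp [domRestrict]
    · convert measurable_const (a := (0 : ℝ)) using 1
      ext y
      simp only [domRestrict_apply]
      exact indicator_of_notMem y.2 _
  exact h.comp (D.continuous_flow_max x).measurable

theorem rateAlong_nonneg (x : Vec d) (t : ℝ) : 0 ≤ D.rateAlong x t :=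
  indicator_nonneg (fun y hy => D.rate_nonneg y hy) _

theorem rateAlong_le {Clam : ℝ} (hC : 0 ≤ Clam) (hrate : ∀ y ∈ closure D.E, D.rate y ≤ Clam)
    (x : Vec d) (t : ℝ) : D.rateAlong x t ≤ Clam :=
  indicator_apply_le' (fun hy => hrate _ hy) fun _ => hC

theorem cumRateExt_zero (x : Vec d) : D.cumRateExt x 0 = 0 := intervalIntegral.integral_same

theorem cumRateExt_sub {Clam : ℝ} (hC : 0 ≤ Clam) (hrate : ∀ y ∈ closure D.E, D.rate y ≤ Clam)
    (x : Vec d) {a b : ℝ} (hab : a ≤ b) :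
    0 ≤ D.cumRateExt x b - D.cumRateExt x a ∧
      D.cumRateExt x b - D.cumRateExt x a ≤ Clam * (b - a) := by
  have hint : ∀ a b : ℝ, IntervalIntegrable (D.rateAlong x) volume a b := fun a b => by
    rw [intervalIntegrable_iff]
    refine Measure.integrableOn_of_bounded (M := Clam) (by simp)
      (D.measurable_rateAlong x).aestronglyMeasurable (Filter.Eventually.of_forall fun t => ?_)
    rw [Real.norm_of_nonneg (D.rateAlong_nonneg x t)]
    exact D.rateAlong_le hC hrate x t
  have e : D.cumRateExt x b - D.cumRateExt x a = ∫ s in a..b, D.rateAlong x s := by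
    rw [cumRateExt, cumRateExt, sub_eq_iff_eq_add, add_comm,
      intervalIntegral.integral_add_adjacent_intervals (hint 0 a) (hint a b)]
  rw [e]
  refine ⟨intervalIntegral.integral_nonneg hab fun t _ => D.rateAlong_nonneg x t, ?_⟩
  calc ∫ s in a..b, D.rateAlong x s ≤ ∫ _ in a..b, Clam :=
        intervalIntegral.integral_mono_on hab (hint a b) (by simp)
          fun t _ => D.rateAlong_le hC hrate x t
    _ = Clam * (b - a) := by rw [intervalIntegral.integral_const, smul_eq_mul, mul_comm]

theorem continuous_cumRateExt {Clam : ℝ} (hC : 0 ≤ Clam)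
    (hrate : ∀ y ∈ closure D.E, D.rate y ≤ Clam) (x : Vec d) : Continuous (D.cumRateExt x) := by
  refine (LipschitzWith.of_dist_le_mul (K := ⟨Clam, hC⟩) fun a b => ?_).continuous
  rw [Real.dist_eq, Real.dist_eq]
  change _ ≤ Clam * _
  rcases le_total a b with h | h
  · have := D.cumRateExt_sub hC hrate x h
    rw [abs_sub_comm, abs_of_nonneg this.1, abs_sub_comm, abs_of_nonneg (sub_nonneg.2 h)]
    exact this.2
  · have := D.cumRateExt_sub hC hrate x h
    rw [abs_of_nonneg this.1, abs_of_nonneg (sub_nonneg.2 h)]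
    exact this.2

end LocalCharacteristics

/-- The generalized inverse of an antitone right-continuous function satisfies a Galois
connection. -/
theorem sInf_le_iff_of_antitone {S : ℝ → ℝ} {u T t : ℝ} (hanti : AntitoneOn S (Ici 0)) (hT : 0 ≤ T)
    (hTu : S T ≤ u) (hright : ∀ t, 0 ≤ t → u < S t → ∃ t' > t, u < S t') (ht : 0 ≤ t) :
    sInf {t : ℝ | 0 ≤ t ∧ S t ≤ u} ≤ t ↔ S t ≤ u := by
  constructor
  · intro h
    by_contra hcon
    obtain ⟨t', htt', hut'⟩ := hright t ht (not_le.1 hcon)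
    have : t' ≤ sInf {t : ℝ | 0 ≤ t ∧ S t ≤ u} := by
      refine le_csInf ⟨T, hT, hTu⟩ fun s hs => ?_
      by_contra hlt
      exact absurd (hanti hs.1 (ht.trans htt'.le) (not_le.1 hlt).le)
        (not_le.2 (hs.2.trans_lt hut'))
    linarith
  · intro h
    exact csInf_le ⟨0, fun s hs => hs.1⟩ ⟨ht, h⟩

namespace ObservedModel

variable {d q : ℕ} (M : ObservedModel d q)

theorem ofReal_exit (i : Fin q) : ENNReal.ofReal (M.exit i) = M.exitTime (M.x i) := by
  simp only [exit, tStar, Fin.cons_succ]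
  exact ENNReal.ofReal_toReal (M.exitTime_lt_top i).ne

theorem exit_pos (i : Fin q) : 0 < M.exit i := by
  have := M.exitTime_pos i
  rw [← ofReal_exit] at this
  exact ENNReal.ofReal_pos.1 this

theorem ofReal_lt_exitTime {i : Fin q} {t : ℝ} :
    ENNReal.ofReal t < M.exitTime (M.x i) ↔ t < M.exit i := by
  rw [← ofReal_exit, ENNReal.ofReal_lt_ofReal_iff (M.exit_pos i)]

theorem flow_mem {i : Fin q} {t : ℝ} (ht : 0 ≤ t) (hti : t < M.exit i) :
    M.flow (M.x i) t ∈ M.E :=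
  M.flow_mem_of_lt_exitTime (M.x_mem i) ht (M.ofReal_lt_exitTime.2 hti)

theorem flow_mem_closure {i : Fin q} {t : ℝ} (ht : t ∈ Icc 0 (M.exit i)) :
    M.flow (M.x i) t ∈ closure M.E := by
  have hcont : ContinuousWithinAt (M.flow (M.x i)) (Ico 0 (M.exit i)) t :=
    ((M.continuousOn_flow_time (M.x i)) t ht.1).mono Ico_subset_Ici_self
  refine hcont.mem_closure ?_ fun s hs => M.flow_mem hs.1 hs.2
  rw [closure_Ico (M.exit_pos i).ne]
  exact ht

theorem cumRate_eq {i : Fin q} {t : ℝ} (ht : t ∈ Icc 0 (M.exit i)) :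
    M.cumRate (M.x i) t = M.cumRateExt (M.x i) t := by
  refine intervalIntegral.integral_congr fun s hs => ?_
  rw [uIcc_of_le ht.1] at hs
  simp only [LocalCharacteristics.rateAlong]
  rw [max_eq_left hs.1, indicator_of_mem (M.flow_mem_closure ⟨hs.1, hs.2.trans ht.2⟩)]

theorem survival_of_lt {i : Fin q} {t : ℝ} (ht : 0 ≤ t) (hti : t < M.exit i) :
    M.survival (M.x i) t = Real.exp (-M.cumRateExt (M.x i) t) := by
  rw [LocalCharacteristics.survival, if_neg (not_lt.2 ht), if_pos (M.ofReal_lt_exitTime.2 hti),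
    M.cumRate_eq ⟨ht, hti.le⟩]

theorem survival_of_le {i : Fin q} {t : ℝ} (hti : M.exit i ≤ t) :
    M.survival (M.x i) t = 0 := by
  rw [LocalCharacteristics.survival, if_neg (not_lt.2 ((M.exit_pos i).le.trans hti)),
    if_neg (M.ofReal_lt_exitTime.not.2 (not_lt.2 hti))]

section Rate

variable {M} {Clam : ℝ} (hC : 0 ≤ Clam) (hrate : ∀ y ∈ closure M.E, M.rate y ≤ Clam)
include hC hrate

theorem antitoneOn_survival (i : Fin q) : AntitoneOn (M.survival (M.x i)) (Ici 0) := by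
  intro a ha b hb hab
  rcases lt_or_ge b (M.exit i) with h | h
  · rw [M.survival_of_lt hb h, M.survival_of_lt ha (hab.trans_lt h)]
    have := (M.cumRateExt_sub hC hrate (M.x i) hab).1
    exact Real.exp_le_exp.2 (by linarith)
  · rw [M.survival_of_le h]
    rcases lt_or_ge a (M.exit i) with h' | h'
    · rw [M.survival_of_lt ha h']; exact (Real.exp_pos _).le
    · rw [M.survival_of_le h']

/-- Right continuity in the form used by `sInf_le_iff_of_antitone`. At nonnegative times the only
possible discontinuity is the drop to `0` at the exit time, where the function already takes its
right-hand value. -/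
theorem survival_right (i : Fin q) {u : ℝ} (hu : 0 ≤ u) {t : ℝ} (ht : 0 ≤ t)
    (hut : u < M.survival (M.x i) t) : ∃ t' > t, u < M.survival (M.x i) t' := by
  have hti : t < M.exit i := by
    by_contra h
    rw [M.survival_of_le (not_lt.1 h)] at hut
    exact absurd hut (not_lt.2 hu)
  rw [M.survival_of_lt ht hti] at hut
  have hcont : Continuous fun t => Real.exp (-M.cumRateExt (M.x i) t) :=
    Real.continuous_exp.comp (M.continuous_cumRateExt hC hrate (M.x i)).neg
  have h1 : ∀ᶠ s in nhdsWithin t (Ioi t), u < Real.exp (-M.cumRateExt (M.x i) s) :=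
    (hcont.continuousAt.tendsto.eventually (lt_mem_nhds hut)).filter_mono nhdsWithin_le_nhds
  have h2 : ∀ᶠ s in nhdsWithin t (Ioi t), s ∈ Ioo t (M.exit i) := Ioo_mem_nhdsGT hti
  obtain ⟨s, hs1, hs2⟩ := (h1.and h2).exists
  exact ⟨s, hs2.1, by rwa [M.survival_of_lt (ht.trans hs2.1.le) hs2.2]⟩

theorem survivalInv_le_iff (i : Fin q) {u : ℝ} (hu : 0 ≤ u) {t : ℝ} (ht : 0 ≤ t) :
    M.survivalInv (M.x i) u ≤ t ↔ M.survival (M.x i) t ≤ u :=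
  sInf_le_iff_of_antitone (antitoneOn_survival hC hrate i) (M.exit_pos i).le
    (by rw [M.survival_of_le le_rfl]; exact hu)
    (fun _ ht hut => survival_right hC hrate i hu ht hut) ht

omit hC hrate in
theorem survivalInv_nonneg (i : Fin q) (u : ℝ) : 0 ≤ M.survivalInv (M.x i) u :=
  Real.sInf_nonneg fun _ h => h.1

theorem aemeasurable_survivalInv (i : Fin q) :
    AEMeasurable (M.survivalInv (M.x i)) ((volume : Measure ℝ).restrict (Ioo 0 1)) := by
  refine aemeasurable_restrict_of_antitoneOn measurableSet_Ioo fun u hu u' hu' huu' => ?_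
  rw [survivalInv_le_iff hC hrate i hu'.1.le (survivalInv_nonneg i u)]
  exact ((survivalInv_le_iff hC hrate i hu.1.le (survivalInv_nonneg i u)).1 le_rfl).trans huu'

theorem isProbabilityMeasure_jumpTimeLaw (i : Fin q) :
    IsProbabilityMeasure (M.jumpTimeLaw (M.x i)) := by
  have : IsProbabilityMeasure ((volume : Measure ℝ).restrict (Ioo 0 1)) := ⟨by simp⟩
  exact Measure.isProbabilityMeasure_map (aemeasurable_survivalInv hC hrate i)

theorem jumpTimeLaw_ae_mem (i : Fin q) :
    ∀ᵐ s ∂(M.jumpTimeLaw (M.x i)), s ∈ Icc 0 (M.exit i) := by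
  rw [LocalCharacteristics.jumpTimeLaw, ae_map_iff (p := fun s => s ∈ Icc 0 (M.exit i))
    (aemeasurable_survivalInv hC hrate i) measurableSet_Icc, ae_restrict_iff' measurableSet_Ioo]
  refine Filter.Eventually.of_forall fun u hu => ⟨survivalInv_nonneg i u, ?_⟩
  rw [survivalInv_le_iff hC hrate i hu.1.le (M.exit_pos i).le, M.survival_of_le le_rfl]
  exact hu.1.le

/-- The drop at the exit time is the only obstruction to being `Clam`-Lipschitz, and excluding the
exit time from `Ioc a b` puts both ends on the same side of it. -/
theorem survival_sub_le (i : Fin q) {a b : ℝ} (ha : 0 ≤ a) (hab : a ≤ b)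
    (hi : M.exit i ∉ Ioc a b) :
    M.survival (M.x i) a - M.survival (M.x i) b ≤ Clam * (b - a) := by
  rcases lt_or_ge a (M.exit i) with h | h
  · have hb : b < M.exit i := by
      by_contra hb
      exact hi ⟨h, not_lt.1 hb⟩
    rw [M.survival_of_lt ha h, M.survival_of_lt (ha.trans hab) hb]
    have h0 := (M.cumRateExt_sub hC hrate (M.x i) ha).1
    rw [M.cumRateExt_zero, sub_zero] at h0
    have h1 := M.cumRateExt_sub hC hrate (M.x i) hab
    set A := M.cumRateExt (M.x i) a
    set B := M.cumRateExt (M.x i) b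
    -- Factoring out `exp (-A) ≤ 1` leaves `1 - exp (-(B - A)) ≤ B - A`.
    have e : Real.exp (-B) = Real.exp (-A) * Real.exp (-(B - A)) := by
      rw [← Real.exp_add]; ring_nf
    have e1 : Real.exp (-A) ≤ 1 := Real.exp_le_one_iff.2 (by linarith)
    have e2 := Real.add_one_le_exp (-(B - A))
    have e3 := (Real.exp_pos (-A)).le
    have : Real.exp (-A) - Real.exp (-B) ≤ B - A := by rw [e]; nlinarith
    linarith [h1.2]
  · rw [M.survival_of_le h, M.survival_of_le (h.trans hab), sub_zero]
    exact mul_nonneg hC (sub_nonneg.2 hab)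

/-- By the Galois connection, the uniform variables sent into `Ioc a b` lie between the values of
the survival function at `b` and `a`. -/
theorem jumpTimeLaw_Ioc_le (i : Fin q) {a b : ℝ} (ha : 0 ≤ a) (hab : a ≤ b)
    (hi : M.exit i ∉ Ioc a b) :
    M.jumpTimeLaw (M.x i) (Ioc a b) ≤ ENNReal.ofReal (Clam * (b - a)) := by
  rw [LocalCharacteristics.jumpTimeLaw,
    Measure.map_apply_of_aemeasurable (aemeasurable_survivalInv hC hrate i) measurableSet_Ioc,
    Measure.restrict_apply₀' measurableSet_Ioo.nullMeasurableSet]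
  calc volume (M.survivalInv (M.x i) ⁻¹' Ioc a b ∩ Ioo 0 1)
      ≤ volume (Ico (M.survival (M.x i) b) (M.survival (M.x i) a)) := by
        refine measure_mono fun u hu => ⟨?_, ?_⟩
        · exact (survivalInv_le_iff hC hrate i hu.2.1.le (ha.trans hab)).1 hu.1.2
        · rw [← not_le, ← survivalInv_le_iff hC hrate i hu.2.1.le ha, not_le]
          exact hu.1.1
    _ ≤ _ := by
        rw [Real.volume_Ico]
        exact ENNReal.ofReal_le_ofReal (survival_sub_le hC hrate i ha hab hi)

theorem sum_Q_ae (i : Fin q) : ∀ᵐ s ∂(M.jumpTimeLaw (M.x i)),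
    ∑ j, M.Q (M.flow (M.x i) s) {M.x j} = 1 := by
  filter_upwards [jumpTimeLaw_ae_mem hC hrate i] with s hs
  rw [← M.Q_support _ (M.flow_mem_closure hs), ← iUnion_singleton_eq_range,
    measure_iUnion (fun j k hjk => by simpa using M.x_injective.ne hjk)
      fun j => measurableSet_singleton _, tsum_fintype]

theorem aemeasurable_Q (i j : Fin q) :
    AEMeasurable (fun s => M.Q (M.flow (M.x i) s) {M.x j}) (M.jumpTimeLaw (M.x i)) := by
  refine ⟨fun s => M.Q (M.flow (M.x i) (max s 0)) {M.x j},
    (M.Q.measurable_coe (measurableSet_singleton _)).comp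
      (M.continuous_flow_max (M.x i)).measurable, ?_⟩
  filter_upwards [jumpTimeLaw_ae_mem hC hrate i] with s hs
  rw [max_eq_left hs.1]

theorem map_snd_stepLaw (i : Fin q) : (M.stepLaw i).map Prod.snd = M.jumpTimeLaw (M.x i) := by
  ext A hA
  rw [Measure.map_apply measurable_snd hA, stepLaw, Measure.coe_finsetSum, Finset.sum_apply]
  have : ∀ j, (((M.jumpTimeLaw (M.x i)).withDensity
      fun s => M.Q (M.flow (M.x i) s) {M.x j}).map fun s => (j, s)) (Prod.snd ⁻¹' A)
      = ∫⁻ s in A, M.Q (M.flow (M.x i) s) {M.x j} ∂(M.jumpTimeLaw (M.x i)) := fun j => by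
    rw [Measure.map_apply measurable_prodMk_left (measurable_snd hA), ← withDensity_apply _ hA]
    rfl
  simp_rw [this]
  rw [← lintegral_finsetSum' _ fun j _ => (aemeasurable_Q hC hrate i j).restrict,
    lintegral_congr_ae (ae_restrict_of_ae (sum_Q_ae hC hrate i))]
  simp

theorem isProbabilityMeasure_stepLaw (i : Fin q) : IsProbabilityMeasure (M.stepLaw i) := by
  have := isProbabilityMeasure_jumpTimeLaw hC hrate i
  rw [← map_snd_stepLaw hC hrate i] at this
  exact Measure.isProbabilityMeasure_of_map Prod.snd

end Rate

theorem isProbabilityMeasure_noiseLaw : IsProbabilityMeasure M.noiseLaw :=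
  ⟨by rw [noiseLaw, withDensity_apply _ MeasurableSet.univ, Measure.restrict_univ,
    M.noiseDensity_mass]⟩

/-- The law of `(Z_1, (Y_1, S_1))` when `Z_0 = x_i`. -/
def transLaw (i : Fin q) : Measure (Fin q × Vec d × ℝ) :=
  ((M.stepLaw i).prod M.noiseLaw).map (fun o => (o.1.1, M.obs o.1.1 + o.2, o.1.2))

theorem oneStepLaw_eq_mixLaw (π : Fin q → ℝ) : M.oneStepLaw π = mixLaw M.transLaw π := rfl

theorem measurable_emission :
    Measurable fun o : (Fin q × ℝ) × Vec d => (o.1.1, M.obs o.1.1 + o.2, o.1.2) := by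
  have : Measurable M.obs := measurable_of_finite _
  fun_prop

section Rate

variable {M} {Clam : ℝ} (hC : 0 ≤ Clam) (hrate : ∀ y ∈ closure M.E, M.rate y ≤ Clam)
include hC hrate

theorem isProbabilityMeasure_transLaw (i : Fin q) : IsProbabilityMeasure (M.transLaw i) := by
  have := isProbabilityMeasure_stepLaw hC hrate i
  have := M.isProbabilityMeasure_noiseLaw
  exact Measure.isProbabilityMeasure_map M.measurable_emission.aemeasurable

theorem transLaw_time (i : Fin q) {A : Set ℝ} (hA : MeasurableSet A) :
    M.transLaw i {z | z.2.2 ∈ A} = M.jumpTimeLaw (M.x i) A := by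
  have := isProbabilityMeasure_stepLaw hC hrate i
  have := M.isProbabilityMeasure_noiseLaw
  have hset : MeasurableSet {z : Fin q × Vec d × ℝ | z.2.2 ∈ A} :=
    (measurable_snd.comp measurable_snd) hA
  rw [transLaw, Measure.map_apply M.measurable_emission hset, ← map_snd_stepLaw hC hrate i,
    Measure.map_apply measurable_snd hA]
  have : ((fun o : (Fin q × ℝ) × Vec d => (o.1.1, M.obs o.1.1 + o.2, o.1.2)) ⁻¹'
      {z | z.2.2 ∈ A}) = (Prod.snd ⁻¹' A) ×ˢ univ := by ext; simp
  rw [this, Measure.prod_prod, measure_univ, mul_one]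

end Rate

end ObservedModel

end

end PODP

/-! ### Bounds and Lipschitz estimates for the dynamic programming operator -/

namespace PODP

noncomputable section

theorem comap_eq_comap_of_comp {Ω α β : Type*} [mα : MeasurableSpace α] [mβ : MeasurableSpace β]
    {f : Ω → α} {g : Ω → β} {a : β → α} {b : α → β} (ha : Measurable a) (hb : Measurable b)
    (hf : ∀ ω, f ω = a (g ω)) (hg : ∀ ω, g ω = b (f ω)) :
    MeasurableSpace.comap f mα = MeasurableSpace.comap g mβ := by
  have hf' : f = a ∘ g := funext hf
  have hg' : g = b ∘ f := funext hg
  refine le_antisymm ?_ ?_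
  · rw [hf', ← MeasurableSpace.comap_comp]
    exact MeasurableSpace.comap_mono ha.comap_le
  · rw [hg', ← MeasurableSpace.comap_comp]
    exact MeasurableSpace.comap_mono hb.comap_le

/-- A supremum of uniformly Lipschitz bounded functions is Lipschitz. -/
theorem abs_sSup_image_sub_le {ι : Type*} {s : Set ι} (hs : s.Nonempty) {f f' : ι → ℝ} {r : ℝ}
    (hb : BddAbove (f '' s)) (hb' : BddAbove (f' '' s)) (h : ∀ i ∈ s, |f i - f' i| ≤ r) :
    |sSup (f '' s) - sSup (f' '' s)| ≤ r := by
  rw [abs_sub_le_iff]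
  constructor
  · rw [sub_le_iff_le_add]
    refine csSup_le (hs.image f) ?_
    rintro _ ⟨i, hi, rfl⟩
    have h1 := le_csSup hb' (mem_image_of_mem f' hi)
    have h2 := (abs_sub_le_iff.1 (h i hi)).1
    linarith
  · rw [sub_le_iff_le_add]
    refine csSup_le (hs.image f') ?_
    rintro _ ⟨i, hi, rfl⟩
    have h1 := le_csSup hb (mem_image_of_mem f hi)
    have h2 := (abs_sub_le_iff.1 (h i hi)).2
    linarith

namespace ObservedModel

variable {d q : ℕ} {M : ObservedModel d q}

theorem measurableSet_time {A : Set ℝ} (hA : MeasurableSet A) :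
    MeasurableSet {z : Fin q × Vec d × ℝ | z.2.2 ∈ A} :=
  (measurable_snd.comp measurable_snd) hA

theorem measurableSet_obs_time {A : Set ℝ} (hA : MeasurableSet A) :
    MeasurableSet {o : Vec d × ℝ | o.2 ∈ A} := measurable_snd hA

section FlowReward

variable {g : Vec d → ℝ} {Cg : ℝ} (hg : ∀ y ∈ closure M.E, |g y| ≤ Cg)
include hg

theorem bound_nonneg : 0 ≤ Cg :=
  (abs_nonneg _).trans (hg _ (subset_closure (M.x_mem M.start)))

theorem abs_flowReward_sub_le (π π' : Fin q → ℝ) {u : ℝ} (hu : 0 ≤ u) :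
    |M.flowReward g π u - M.flowReward g π' u| ≤ Cg * l1 (π - π') := by
  rw [flowReward, flowReward, ← Finset.sum_sub_distrib, l1, Finset.mul_sum]
  refine (Finset.abs_sum_le_sum_abs _ _).trans (Finset.sum_le_sum fun i _ => ?_)
  split_ifs with h
  · rw [← mul_sub, abs_mul]
    exact mul_le_mul_of_nonneg_right (hg _ (M.flow_mem_closure ⟨hu, h.le⟩)) (abs_nonneg _)
  · rw [sub_zero, abs_zero]
    exact mul_nonneg (bound_nonneg hg) (abs_nonneg _)

theorem abs_flowReward_le {π : Fin q → ℝ} (hπ : π ∈ stdSimplex ℝ (Fin q)) {u : ℝ} (hu : 0 ≤ u) :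
    |M.flowReward g π u| ≤ Cg := by
  have h := abs_flowReward_sub_le hg π 0 hu
  have h0 : M.flowReward g 0 u = 0 := by simp [flowReward]
  rwa [h0, sub_zero, sub_zero, l1_of_mem_stdSimplex hπ, mul_one] at h

omit hg in
-- Without exit times in `Ioc a b` the indicators of `u < t*_i` agree at `a` and `b`, so only the
-- variation of `g` along the flow remains.
theorem abs_flowReward_sub_time_le {g2 : ℝ} (hg2 : 0 ≤ g2)
    (hg_lip : ∀ i, ∀ t ∈ Set.Icc 0 (M.exit i), ∀ u ∈ Set.Icc 0 (M.exit i),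
      |g (M.flow (M.x i) t) - g (M.flow (M.x i) u)| ≤ g2 * |t - u|)
    {π : Fin q → ℝ} (hπ : π ∈ stdSimplex ℝ (Fin q)) {a b : ℝ} (ha : 0 ≤ a) (hab : a ≤ b)
    (hi : ∀ i, M.exit i ∉ Ioc a b) :
    |M.flowReward g π a - M.flowReward g π b| ≤ g2 * (b - a) := by
  have hba := sub_nonneg.2 hab
  calc |M.flowReward g π a - M.flowReward g π b| ≤ ∑ i, g2 * (b - a) * π i := by
        rw [flowReward, flowReward, ← Finset.sum_sub_distrib]
        refine (Finset.abs_sum_le_sum_abs _ _).trans (Finset.sum_le_sum fun i _ => ?_)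
        have hπi := hπ.1 i
        by_cases h : a < M.exit i
        · have hb : b < M.exit i := by
            by_contra hb
            exact hi i ⟨h, not_lt.1 hb⟩
          rw [if_pos h, if_pos hb, ← sub_mul, abs_mul, abs_of_nonneg hπi]
          refine mul_le_mul_of_nonneg_right ?_ hπi
          refine (hg_lip i a ⟨ha, h.le⟩ b ⟨ha.trans hab, hb.le⟩).trans_eq ?_
          rw [abs_sub_comm, abs_of_nonneg hba]
        · rw [if_neg h, if_neg fun hb => h (hab.trans_lt hb), sub_zero, abs_zero]
          positivity
    _ = g2 * (b - a) := by rw [← Finset.mul_sum, hπ.2, mul_one]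

end FlowReward

section Rate

variable {Clam : ℝ} (hC : 0 ≤ Clam) (hrate : ∀ y ∈ closure M.E, M.rate y ≤ Clam)
include hC hrate

theorem oneStepLaw_time_le {π : Fin q → ℝ} (hπ : π ∈ stdSimplex ℝ (Fin q)) {a b : ℝ}
    (ha : 0 ≤ a) (hab : a ≤ b) (hi : ∀ i, M.exit i ∉ Ioc a b) :
    (M.oneStepLaw π).real {z | z.2.2 ∈ Ioc a b} ≤ Clam * (b - a) := by
  refine ENNReal.toReal_le_of_le_ofReal (mul_nonneg hC (sub_nonneg.2 hab)) ?_
  rw [oneStepLaw_eq_mixLaw]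
  simp only [mixLaw, Measure.coe_finsetSum, Finset.sum_apply, Measure.smul_apply, smul_eq_mul]
  calc ∑ i, ENNReal.ofReal (π i) * M.transLaw i {z | z.2.2 ∈ Ioc a b}
      ≤ ∑ i, ENNReal.ofReal (π i) * ENNReal.ofReal (Clam * (b - a)) := by
        refine Finset.sum_le_sum fun i _ => ?_
        gcongr
        rw [transLaw_time hC hrate i measurableSet_Ioc]
        exact jumpTimeLaw_Ioc_le hC hrate i ha hab (hi i)
    _ = ENNReal.ofReal (Clam * (b - a)) := by
        rw [← Finset.sum_mul, ← ENNReal.ofReal_sum_of_nonneg fun i _ => hπ.1 i, hπ.2,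
          ENNReal.ofReal_one, one_mul]

theorem isProbabilityMeasure_oneStepLaw {π : Fin q → ℝ} (hπ : π ∈ stdSimplex ℝ (Fin q)) :
    IsProbabilityMeasure (M.oneStepLaw π) := by
  have := isProbabilityMeasure_transLaw hC hrate
  exact isProbabilityMeasure_mixLaw M.transLaw hπ

theorem oneStepLaw_time_mem (π : Fin q → ℝ) :
    ∀ᵐ z ∂(M.oneStepLaw π), ∃ i, z.2.2 ∈ Icc 0 (M.exit i) := by
  rw [oneStepLaw_eq_mixLaw, ae_iff]
  simp only [mixLaw, Measure.coe_finsetSum, Finset.sum_apply, Measure.smul_apply, smul_eq_mul]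
  refine Finset.sum_eq_zero fun i _ => ?_
  have h : M.transLaw i {z | z.2.2 ∈ (Icc 0 (M.exit i))ᶜ} = 0 := by
    rw [transLaw_time hC hrate i measurableSet_Icc.compl]
    exact jumpTimeLaw_ae_mem hC hrate i
  have h' : M.transLaw i {z | ¬∃ i, z.2.2 ∈ Icc 0 (M.exit i)} = 0 :=
    measure_mono_null (fun z (hz : ¬∃ i, z.2.2 ∈ Icc 0 (M.exit i)) hz' => hz ⟨i, hz'⟩) h
  rw [h', mul_zero]

variable [NeZero q]

/-- The case of a trivial history (a one-point parameter space) in `bayes_ae_eq_condExp`. It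
replaces an abstract conditional expectation by a formula that can be compared for different `π`. -/
theorem oneStepFilter_ae_eq {π : Fin q → ℝ} (hπ : π ∈ stdSimplex ℝ (Fin q)) :
    ∀ᵐ o ∂(M.oneStepLaw π), M.oneStepFilter π o = bayes M.transLaw π o.2 := by
  have := isProbabilityMeasure_transLaw hC hrate
  have := isProbabilityMeasure_oneStepLaw hC hrate hπ
  have hF : Measurable fun _ : Unit => π := measurable_const
  have := isMarkovKernel_mixKernel M.transLaw hF fun _ => hπ
  have hlaw : (M.oneStepLaw π).map (fun o => ((), o.1, o.2))
      = (M.oneStepLaw π).map (fun _ => ()) ⊗ₘ mixKernel M.transLaw hF := by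
    refine Measure.ext_of_lintegral _ fun f hf => ?_
    rw [Measure.lintegral_compProd hf, lintegral_map hf (by fun_prop), lintegral_map' _ (by fun_prop)]
    · simp only [lintegral_const, measure_univ, mul_one]
      rfl
    · exact (measurable_of_finite _).aemeasurable
  have hσ : MeasurableSpace.comap (fun o : Fin q × Vec d × ℝ => ((), o.2)) inferInstance
      = MeasurableSpace.comap (fun o : Fin q × Vec d × ℝ => o.2) inferInstance :=
    comap_eq_comap_of_comp (a := fun o : Vec d × ℝ => ((), o)) (b := Prod.snd)
      (by fun_prop) (by fun_prop) (fun _ => rfl) fun _ => rfl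
  have h := fun j => bayes_ae_eq_condExp M.transLaw (P := M.oneStepLaw π) (h := fun _ => ())
    (ζ := fun o => o.1) (o := fun o => o.2) measurable_const measurable_fst measurable_snd hF
    (fun _ => hπ) hlaw j
  rw [hσ] at h
  filter_upwards [ae_all_iff.2 h] with o ho
  ext j
  exact (ho j).symm

theorem G_eq {π : Fin q → ℝ} (hπ : π ∈ stdSimplex ℝ (Fin q)) (v : (Fin q → ℝ) → ℝ) (u : ℝ) :
    M.G v π u = ∫ z, ({o : Vec d × ℝ | o.2 ∈ Iic u}).indicator
      (fun o => v (bayes M.transLaw π o)) z.2 ∂(mixLaw M.transLaw π) := by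
  refine integral_congr_ae ?_
  filter_upwards [oneStepFilter_ae_eq hC hrate hπ] with z hz
  by_cases h : z.2.2 ≤ u <;> simp [h, hz]

omit hC hrate [NeZero q] in
theorem H_eq (h : Vec d → ℝ) (π : Fin q → ℝ) (u : ℝ) :
    M.H h π u = M.flowReward h π u * (M.oneStepLaw π).real {z | z.2.2 ∈ Ioi u} := by
  have hm : MeasurableSet {o : Fin q × Vec d × ℝ | u < o.2.2} :=
    measurableSet_time (measurableSet_Ioi (a := u))
  rw [H, integral_indicator hm, setIntegral_const, smul_eq_mul, mul_comm]
  rfl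

section Value

variable {v : (Fin q → ℝ) → ℝ} {K C : ℝ} (hv : LipOnSimplex v K) (hK : 0 ≤ K)
  (hb : BddOnSimplex v C)
include hv hK hb

theorem abs_G_sub_le {π π' : Fin q → ℝ} (hπ : π ∈ stdSimplex ℝ (Fin q))
    (hπ' : π' ∈ stdSimplex ℝ (Fin q)) (u : ℝ) :
    |M.G v π u - M.G v π' u| ≤ (2 * K + C) * l1 (π - π') := by
  have := isProbabilityMeasure_transLaw hC hrate
  rw [G_eq hC hrate hπ, G_eq hC hrate hπ']
  exact abs_integral_bayes_sub_le M.transLaw hv hK hb (measurableSet_obs_time measurableSet_Iic)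
    hπ.1 hπ'.1

omit hK in
theorem integrable_bayes_indicator {π : Fin q → ℝ} (hπ : π ∈ stdSimplex ℝ (Fin q))
    {A : Set ℝ} (hA : MeasurableSet A) :
    Integrable (fun z : Fin q × Vec d × ℝ => ({o : Vec d × ℝ | o.2 ∈ A}).indicator
      (fun o => v (bayes M.transLaw π o)) z.2) (mixLaw M.transLaw π) := by
  have := isProbabilityMeasure_transLaw hC hrate
  have := isProbabilityMeasure_mixLaw M.transLaw hπ
  have hC0 : 0 ≤ C := (abs_nonneg _).trans (hb _ hπ)
  refine Integrable.of_bound (((hv.measurable_comp ((measurable_bayes M.transLaw).comp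
    measurable_prodMk_left) fun o => bayes_mem M.transLaw π o).indicator
    (measurableSet_obs_time hA)).comp measurable_snd).aestronglyMeasurable C
    (Filter.Eventually.of_forall fun z => ?_)
  by_cases h : z.2.2 ∈ A
  · simpa [h] using hb _ (bayes_mem M.transLaw π z.2)
  · simpa [h] using hC0

omit hK in
theorem abs_integral_bayes_indicator_le {π : Fin q → ℝ} (hπ : π ∈ stdSimplex ℝ (Fin q))
    {A : Set ℝ} (hA : MeasurableSet A) :
    |∫ z, ({o : Vec d × ℝ | o.2 ∈ A}).indicator
      (fun o => v (bayes M.transLaw π o)) z.2 ∂(mixLaw M.transLaw π)|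
      ≤ C * (M.oneStepLaw π).real {z | z.2.2 ∈ A} := by
  have := isProbabilityMeasure_oneStepLaw hC hrate hπ
  have : IsProbabilityMeasure (mixLaw M.transLaw π) := this
  have hC0 : 0 ≤ C := (abs_nonneg _).trans (hb _ hπ)
  have e : C * (M.oneStepLaw π).real {z | z.2.2 ∈ A}
      = ∫ z, ({z : Fin q × Vec d × ℝ | z.2.2 ∈ A}).indicator (fun _ => C) z
          ∂(M.oneStepLaw π) := by
    rw [integral_indicator (measurableSet_time hA), setIntegral_const, smul_eq_mul, mul_comm]
  rw [e]
  refine abs_integral_le_integral_abs.trans (integral_mono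
    (integrable_bayes_indicator hC hrate hv hb hπ hA).abs
    ((integrable_const C).indicator (measurableSet_time hA)) fun z => ?_)
  change |_| ≤ _
  by_cases h : z.2.2 ∈ A
  · simpa [h] using hb _ (bayes_mem M.transLaw π z.2)
  · simp [h]

omit hK in
theorem abs_J_le {g : Vec d → ℝ} (hg : ∀ y ∈ closure M.E, |g y| ≤ C)
    {π : Fin q → ℝ} (hπ : π ∈ stdSimplex ℝ (Fin q)) {u : ℝ} (hu : 0 ≤ u) :
    |M.J v g π u| ≤ C := by
  have := isProbabilityMeasure_oneStepLaw hC hrate hπ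
  have h1 := abs_integral_bayes_indicator_le hC hrate hv hb hπ (measurableSet_Iic (a := u))
  have h2 : (M.oneStepLaw π).real {z | z.2.2 ∈ Ioi u}
      = 1 - (M.oneStepLaw π).real {z | z.2.2 ∈ Iic u} := by
    rw [← probReal_compl_eq_one_sub (measurableSet_time measurableSet_Iic)]
    congr 1
    ext z; simp
  have h3 : |M.H g π u| ≤ C * (M.oneStepLaw π).real {z | z.2.2 ∈ Ioi u} := by
    rw [H_eq, abs_mul, abs_of_nonneg measureReal_nonneg]
    exact mul_le_mul_of_nonneg_right (abs_flowReward_le hg hπ hu) measureReal_nonneg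
  rw [← G_eq hC hrate hπ] at h1
  rw [J]
  refine (abs_add_le _ _).trans ?_
  rw [h2] at h3
  linarith

/-- The constant is `2 * K + C` from `G`, plus `C` for the reward and `C` for the survival
probability in the product `H`. -/
theorem abs_J_sub_le {g : Vec d → ℝ} (hg : ∀ y ∈ closure M.E, |g y| ≤ C)
    {π π' : Fin q → ℝ} (hπ : π ∈ stdSimplex ℝ (Fin q)) (hπ' : π' ∈ stdSimplex ℝ (Fin q))
    {u : ℝ} (hu : 0 ≤ u) :
    |M.J v g π u - M.J v g π' u| ≤ (2 * K + 3 * C) * l1 (π - π') := by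
  have := isProbabilityMeasure_transLaw hC hrate
  have := isProbabilityMeasure_oneStepLaw hC hrate hπ
  have := isProbabilityMeasure_oneStepLaw hC hrate hπ'
  have hC0 : 0 ≤ C := (abs_nonneg _).trans (hb _ hπ)
  have hG := abs_G_sub_le hC hrate hv hK hb hπ hπ' u
  have hT : |(M.oneStepLaw π).real {z | z.2.2 ∈ Ioi u}
      - (M.oneStepLaw π').real {z | z.2.2 ∈ Ioi u}| ≤ l1 (π - π') := by
    -- The survival probability is the integral of the constant function `1` over the event, so the
    -- general estimate with `K = 0`, `C = 1` shows it is `1`-Lipschitz in `π`.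
    have h := abs_integral_bayes_sub_le M.transLaw (v := fun _ => 1) (K := 0) (C := 1)
      (fun _ _ _ _ => by simp) le_rfl (fun _ _ => by simp)
      (measurableSet_obs_time (d := d) (measurableSet_Ioi (a := u))) hπ.1 hπ'.1
    have e : ∀ ρ : Fin q → ℝ, (M.oneStepLaw ρ).real {z | z.2.2 ∈ Ioi u}
        = ∫ z, ({o : Vec d × ℝ | o.2 ∈ Ioi u}).indicator (fun _ => (1 : ℝ)) z.2
          ∂(mixLaw M.transLaw ρ) := fun ρ => by
      rw [← integral_indicator_one (measurableSet_time measurableSet_Ioi)]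
      rfl
    rw [e, e]
    linarith
  have hF := abs_flowReward_sub_le hg π π' hu
  have hF' := abs_flowReward_le hg hπ' hu
  have hH : |M.H g π u - M.H g π' u| ≤ 2 * C * l1 (π - π') := by
    rw [H_eq, H_eq]
    set a := M.flowReward g π u
    set a' := M.flowReward g π' u
    set t := (M.oneStepLaw π).real {z | z.2.2 ∈ Ioi u}
    set t' := (M.oneStepLaw π').real {z | z.2.2 ∈ Ioi u}
    have ht0 : 0 ≤ t := measureReal_nonneg
    have ht1 : t ≤ 1 := measureReal_le_one
    have e : a * t - a' * t' = (a - a') * t + a' * (t - t') := by ring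
    rw [e]
    refine (abs_add_le _ _).trans ?_
    rw [abs_mul, abs_mul, abs_of_nonneg ht0]
    have h1 : |a - a'| * t ≤ C * l1 (π - π') * 1 :=
      mul_le_mul hF ht1 ht0 (mul_nonneg hC0 (l1_nonneg _))
    have h2 : |a'| * |t - t'| ≤ C * l1 (π - π') := mul_le_mul hF' hT (abs_nonneg _) hC0
    linarith
  have e : M.J v g π u - M.J v g π' u
      = (M.H g π u - M.H g π' u) + (M.G v π u - M.G v π' u) := by rw [J, J]; ring
  rw [e]
  refine (abs_add_le _ _).trans ?_
  linarith

omit hK in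
theorem bddAbove_J {g : Vec d → ℝ} (hg : ∀ y ∈ closure M.E, |g y| ≤ C)
    {π : Fin q → ℝ} (hπ : π ∈ stdSimplex ℝ (Fin q)) : BddAbove (M.J v g π '' Ici (0 : ℝ)) := by
  refine ⟨C, ?_⟩
  rintro _ ⟨u, hu, rfl⟩
  exact (le_abs_self _).trans (abs_J_le hC hrate hv hb hg hπ hu)

omit hK in
theorem bddOnSimplex_L {g : Vec d → ℝ} (hg : ∀ y ∈ closure M.E, |g y| ≤ C) :
    BddOnSimplex (M.L v g) C := by
  intro π hπ
  rw [abs_le]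
  constructor
  · exact (abs_le.1 (abs_J_le hC hrate hv hb hg hπ le_rfl)).1.trans
      (le_csSup (bddAbove_J hC hrate hv hb hg hπ) ⟨0, mem_Ici.2 le_rfl, rfl⟩)
  · refine csSup_le ⟨_, 0, mem_Ici.2 le_rfl, rfl⟩ ?_
    rintro _ ⟨u, hu, rfl⟩
    exact (le_abs_self _).trans (abs_J_le hC hrate hv hb hg hπ hu)

theorem lipOnSimplex_L {g : Vec d → ℝ} (hg : ∀ y ∈ closure M.E, |g y| ≤ C) :
    LipOnSimplex (M.L v g) (2 * K + 3 * C) := fun _ hπ _ hπ' =>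
  abs_sSup_image_sub_le ⟨0, mem_Ici.2 le_rfl⟩ (bddAbove_J hC hrate hv hb hg hπ)
    (bddAbove_J hC hrate hv hb hg hπ') fun _ hu =>
      abs_J_sub_le hC hrate hv hK hb hg hπ hπ' hu

omit hK in
-- `g2` pays for the motion of the reward along the flow, and `C * Clam` is paid twice, in `H` and
-- in `G`, for a jump falling between `a` and `b`.
theorem abs_J_sub_time_le {g : Vec d → ℝ} (hg : ∀ y ∈ closure M.E, |g y| ≤ C)
    {g2 : ℝ} (hg2 : 0 ≤ g2)
    (hg_lip : ∀ i, ∀ t ∈ Set.Icc 0 (M.exit i), ∀ u ∈ Set.Icc 0 (M.exit i),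
      |g (M.flow (M.x i) t) - g (M.flow (M.x i) u)| ≤ g2 * |t - u|)
    {π : Fin q → ℝ} (hπ : π ∈ stdSimplex ℝ (Fin q)) {a b : ℝ} (ha : 0 ≤ a) (hab : a ≤ b)
    (hi : ∀ i, M.exit i ∉ Ioc a b) :
    |M.J v g π a - M.J v g π b| ≤ (g2 + 2 * C * Clam) * (b - a) := by
  have := isProbabilityMeasure_oneStepLaw hC hrate hπ
  have hC0 : 0 ≤ C := (abs_nonneg _).trans (hb _ hπ)
  have hT := oneStepLaw_time_le hC hrate hπ ha hab hi
  have hG : |M.G v π a - M.G v π b| ≤ C * (Clam * (b - a)) := by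
    rw [G_eq hC hrate hπ, G_eq hC hrate hπ, abs_sub_comm, ← integral_sub
      (integrable_bayes_indicator hC hrate hv hb hπ measurableSet_Iic)
      (integrable_bayes_indicator hC hrate hv hb hπ measurableSet_Iic)]
    have := abs_integral_bayes_indicator_le hC hrate hv hb hπ (measurableSet_Ioc (a := a) (b := b))
    refine le_trans (le_of_eq ?_) (this.trans (mul_le_mul_of_nonneg_left hT hC0))
    congr 1
    refine integral_congr_ae (Filter.Eventually.of_forall fun z => ?_)
    by_cases h1 : z.2.2 ≤ a
    · simp [h1, h1.trans hab]
    · by_cases h2 : z.2.2 ≤ b <;> simp [h1, h2, not_le.1 h1]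
  have hF := abs_flowReward_sub_time_le hg2 hg_lip hπ ha hab hi
  have hF' := abs_flowReward_le hg hπ (ha.trans hab)
  have hH : |M.H g π a - M.H g π b| ≤ g2 * (b - a) + C * (Clam * (b - a)) := by
    rw [H_eq, H_eq]
    have hT2 : (M.oneStepLaw π).real {z | z.2.2 ∈ Ioi a}
        - (M.oneStepLaw π).real {z | z.2.2 ∈ Ioi b}
        = (M.oneStepLaw π).real {z | z.2.2 ∈ Ioc a b} := by
      have hsub : {z : Fin q × Vec d × ℝ | z.2.2 ∈ Ioi b} ⊆ {z | z.2.2 ∈ Ioi a} :=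
        fun z hz => Ioi_subset_Ioi hab hz
      rw [← measureReal_sdiff hsub (measurableSet_time measurableSet_Ioi)]
      congr 1
      ext z; simp
    set f := M.flowReward g π a
    set f' := M.flowReward g π b
    set t := (M.oneStepLaw π).real {z | z.2.2 ∈ Ioi a}
    set t' := (M.oneStepLaw π).real {z | z.2.2 ∈ Ioi b}
    have ht0 : 0 ≤ t := measureReal_nonneg
    have ht1 : t ≤ 1 := measureReal_le_one
    have e : f * t - f' * t' = (f - f') * t + f' * (t - t') := by ring
    rw [e]
    refine (abs_add_le _ _).trans ?_
    rw [abs_mul, abs_mul, abs_of_nonneg ht0, hT2, abs_of_nonneg measureReal_nonneg]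
    have h1 : |f - f'| * t ≤ g2 * (b - a) * 1 :=
      mul_le_mul hF ht1 ht0 (mul_nonneg hg2 (sub_nonneg.2 hab))
    have h2 := mul_le_mul hF' hT measureReal_nonneg hC0
    linarith
  have e : M.J v g π a - M.J v g π b
      = (M.H g π a - M.H g π b) + (M.G v π a - M.G v π b) := by rw [J, J]; ring
  rw [e]
  refine (abs_add_le _ _).trans ?_
  linarith

end Value

omit [NeZero q] in
/-- After all the exit times, stopping has no effect. -/
theorem J_eq_of_exit_le (v : (Fin q → ℝ) → ℝ) (g : Vec d → ℝ) (π : Fin q → ℝ) {u u' : ℝ}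
    (hu : ∀ i, M.exit i ≤ u) (hu' : ∀ i, M.exit i ≤ u') : M.J v g π u = M.J v g π u' := by
  have hF : ∀ w, (∀ i, M.exit i ≤ w) → M.H g π w = 0 := fun w hw => by
    rw [H_eq]
    have : M.flowReward g π w = 0 :=
      Finset.sum_eq_zero fun i _ => if_neg (not_lt.2 (hw i))
    rw [this, zero_mul]
  rw [J, J, hF u hu, hF u' hu', G, G]
  congr 1
  refine integral_congr_ae ?_
  filter_upwards [oneStepLaw_time_mem hC hrate π] with z ⟨i, hz⟩
  have h1 : z.2.2 ≤ u := hz.2.trans (hu i)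
  have h2 : z.2.2 ≤ u' := hz.2.trans (hu' i)
  simp [h1, h2]

/-- The recursion `K ↦ 2 * K + 3 * Cg` doubles `K + 3 * Cg`, which equals `4 * Cg` at the start. -/
theorem valueRev_bdd_lip {g : Vec d → ℝ} {Cg : ℝ} (hg : ∀ y ∈ closure M.E, |g y| ≤ Cg) (k : ℕ) :
    BddOnSimplex (M.valueRev g k) Cg ∧ LipOnSimplex (M.valueRev g k) ((2 ^ (k + 2) - 3) * Cg) := by
  have hCg := bound_nonneg hg
  induction k with
  | zero =>
    have hlip : ∀ π π' : Fin q → ℝ,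
        |M.valueRev g 0 π - M.valueRev g 0 π'| ≤ Cg * l1 (π - π') := by
      intro π π'
      simp only [valueRev]
      rw [← Finset.sum_sub_distrib, l1, Finset.mul_sum]
      refine (Finset.abs_sum_le_sum_abs _ _).trans (Finset.sum_le_sum fun i _ => ?_)
      rw [← mul_sub, abs_mul]
      exact mul_le_mul_of_nonneg_right (hg _ (subset_closure (M.x_mem i))) (abs_nonneg _)
    refine ⟨fun π hπ => ?_, fun π _ π' _ => ?_⟩
    · have h := hlip π 0
      have h0 : M.valueRev g 0 0 = 0 := by simp [valueRev]
      rwa [h0, sub_zero, sub_zero, l1_of_mem_stdSimplex hπ, mul_one] at h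
    · refine (hlip π π').trans_eq ?_
      norm_num
  | succ k ih =>
    have h4 : (4 : ℝ) ≤ 2 ^ (k + 2) := by
      rw [pow_add]; have := one_le_pow₀ (a := (2 : ℝ)) (by norm_num) (n := k); linarith
    have hK : 0 ≤ ((2 : ℝ) ^ (k + 2) - 3) * Cg := mul_nonneg (by linarith) hCg
    refine ⟨bddOnSimplex_L hC hrate ih.2 ih.1 hg, ?_⟩
    have h := lipOnSimplex_L hC hrate ih.2 hK ih.1 hg
    have e : 2 * (((2 : ℝ) ^ (k + 2) - 3) * Cg) + 3 * Cg = (2 ^ (k + 1 + 2) - 3) * Cg := by ring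
    rw [e] at h
    exact h

end Rate

end ObservedModel

end

end PODP

/-! ### Conditional law of the next observation and the filter recursion -/

namespace PODP

noncomputable section

namespace ObservedProcess

variable {d q : ℕ} {M : ObservedModel d q} {Ω : Type*} [MeasurableSpace Ω] {P : Measure Ω}
  (X : ObservedProcess M P)

/-- The history of the embedded chain. -/
def chainHist (n : ℕ) (ω : Ω) (k : Fin (n + 1)) : Fin q × ℝ := (X.Z k ω, X.S k ω)

/-- The noises of the first `n` observations. -/
def noiseHist (n : ℕ) (ω : Ω) (k : Fin n) : Vec d := X.W k ω

/-- The history of the observations. -/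
def obsHist (n : ℕ) (ω : Ω) (k : Fin (n + 1)) : Vec d × ℝ := (X.Y k ω, X.S k ω)

/-- The observations as a function of the embedded chain and the noises. -/
def obsOfHist (M : ObservedModel d q) (n : ℕ)
    (z : (Fin (n + 1) → Fin q × ℝ) × (Fin n → Vec d)) (k : Fin (n + 1)) : Vec d × ℝ :=
  (Fin.cases (motive := fun _ => Vec d) (M.x M.start)
    (fun j : Fin n => M.obs (z.1 j.succ).1 + z.2 j) k, (z.1 k).2)

theorem measurable_chainHist (n : ℕ) : Measurable (X.chainHist n) :=
  measurable_pi_lambda _ fun k => (X.measurable_Z k).prodMk (X.measurable_S k)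

theorem measurable_noiseHist (n : ℕ) : Measurable (X.noiseHist n) :=
  measurable_pi_lambda _ fun k => X.measurable_W k

theorem measurable_Y (n : ℕ) : Measurable (X.Y n) := by
  cases n with
  | zero => exact measurable_const
  | succ n =>
    exact ((measurable_of_finite M.obs).comp (X.measurable_Z (n + 1))).add (X.measurable_W n)

theorem measurable_obsHist (n : ℕ) : Measurable (X.obsHist n) :=
  measurable_pi_lambda _ fun k => (X.measurable_Y k).prodMk (X.measurable_S k)

theorem observed_le (n : ℕ) : X.observed n ≤ ‹MeasurableSpace Ω› := (X.measurable_obsHist n).comap_le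

theorem measurable_obsOfHist (M : ObservedModel d q) (n : ℕ) : Measurable (obsOfHist M n) := by
  refine measurable_pi_lambda _ fun k => Measurable.prodMk ?_ (by fun_prop)
  have hobs : Measurable M.obs := measurable_of_finite _
  refine Fin.cases ?_ (fun j => ?_) k
  · exact measurable_const
  · simp only [Fin.cases_succ]
    fun_prop

theorem obsHist_eq (n : ℕ) (ω : Ω) :
    X.obsHist n ω = obsOfHist M n (X.chainHist n ω, X.noiseHist n ω) := by
  ext1 k
  refine Fin.cases ?_ (fun j => ?_) k
  · rfl
  · rfl

variable [IsProbabilityMeasure P]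

section Rate

variable {Clam : ℝ} (hC : 0 ≤ Clam) (hrate : ∀ y ∈ closure M.E, M.rate y ≤ Clam)
include hC hrate

/-- The Markov property is assumed as a conditional expectation for each event; here it becomes an
identity of joint laws, usable for functions of the past and the next step together. -/
theorem lintegral_chain (n : ℕ) {ψ : (Fin (n + 1) → Fin q × ℝ) × Fin q × ℝ → ENNReal}
    (hψ : Measurable ψ) :
    ∫⁻ ω, ψ (X.chainHist n ω, X.Z (n + 1) ω, X.S (n + 1) ω) ∂P
      = ∫⁻ ω, ∫⁻ x, ψ (X.chainHist n ω, x) ∂(M.stepLaw (X.Z n ω)) ∂P := by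
  have hstep := ObservedModel.isProbabilityMeasure_stepLaw hC hrate
  let κ : Kernel (Fin (n + 1) → Fin q × ℝ) (Fin q × ℝ) :=
    (Kernel.ofFunOfCountable M.stepLaw).comap (fun h => (h (Fin.last n)).1) (by fun_prop)
  have hκ : ∀ h, κ h = M.stepLaw (h (Fin.last n)).1 := fun h => rfl
  have : IsMarkovKernel κ := ⟨fun h => by rw [hκ]; infer_instance⟩
  have hnext : Measurable fun ω => (X.Z (n + 1) ω, X.S (n + 1) ω) :=
    (X.measurable_Z _).prodMk (X.measurable_S _)
  have hpair := (X.measurable_chainHist n).prodMk hnext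
  have hlaw : P.map (fun ω => (X.chainHist n ω, X.Z (n + 1) ω, X.S (n + 1) ω))
      = P.map (X.chainHist n) ⊗ₘ κ := by
    have : IsProbabilityMeasure
      (P.map (fun ω => (X.chainHist n ω, X.Z (n + 1) ω, X.S (n + 1) ω))) :=
      Measure.isProbabilityMeasure_map hpair.aemeasurable
    -- On a rectangle `A ×ˢ B` the identity is the definition of the conditional expectation, tested
    -- on the event that the past lies in `A`.
    refine Measure.ext_prod fun {A B} hA hB => ?_
    rw [Measure.map_apply hpair (hA.prod hB), Measure.compProd_apply_prod hA hB,
      setLIntegral_map hA (κ.measurable_coe hB) (X.measurable_chainHist n)]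
    have hAm := X.measurable_chainHist n hA
    have hBm : MeasurableSet {ω | (X.Z (n + 1) ω, X.S (n + 1) ω) ∈ B} := hnext hB
    have hle : MeasurableSpace.comap (fun ω (k : Fin (n + 1)) => (X.Z k ω, X.S k ω)) inferInstance
      ≤ ‹MeasurableSpace Ω› := (X.measurable_chainHist n).comap_le
    have h := setIntegral_condExp (μ := P) hle (s := X.chainHist n ⁻¹' A) (f := ({ω | (X.Z (n + 1) ω, X.S (n + 1) ω) ∈ B}).indicator fun _ => (1 : ℝ))
      ((integrable_const (1 : ℝ)).indicator hBm) ⟨A, hA, rfl⟩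
    rw [setIntegral_congr_ae hAm ((X.markov n B hB).mono fun ω hω _ => hω),
      setIntegral_indicator hBm, setIntegral_one_eq_measureReal] at h
    have e : ∫⁻ ω in X.chainHist n ⁻¹' A, κ (X.chainHist n ω) B ∂P
        = ENNReal.ofReal (∫ ω in X.chainHist n ⁻¹' A, (M.stepLaw (X.Z n ω)).real B ∂P) := by
      rw [ofReal_integral_eq_lintegral_ofReal]
      · refine lintegral_congr fun ω => ?_
        rw [hκ, Measure.real, ENNReal.ofReal_toReal (measure_ne_top _ _)]
        rfl
      · refine Integrable.of_bound (Measurable.aestronglyMeasurable ?_) 1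
          (Filter.Eventually.of_forall fun ω => ?_)
        · exact (measurable_of_finite fun i => (M.stepLaw i).real B).comp (X.measurable_Z n)
        · rw [Real.norm_of_nonneg measureReal_nonneg]
          exact measureReal_le_one
      · exact Filter.Eventually.of_forall fun ω => measureReal_nonneg
    rw [e, h, Measure.real, ENNReal.ofReal_toReal (measure_ne_top _ _)]
    rfl
  rw [← lintegral_map (f := ψ) hψ hpair, hlaw, Measure.lintegral_compProd hψ,
    lintegral_map _ (X.measurable_chainHist n)]
  · rfl
  · exact hψ.lintegral_kernel_prod_right'

/-- `W n` perturbs the observation at step `n + 1`, so the past observations involve only `W k` with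
`k < n`. These are independent of `W n`, and all noises are independent of the chain; the rest is
Fubini's theorem. -/
theorem lintegral_history (n : ℕ)
    {ψ : ((Fin (n + 1) → Fin q × ℝ) × (Fin n → Vec d)) × (Fin q × ℝ) × Vec d → ENNReal}
    (hψ : Measurable ψ) :
    ∫⁻ ω, ψ ((X.chainHist n ω, X.noiseHist n ω), (X.Z (n + 1) ω, X.S (n + 1) ω), X.W n ω) ∂P
      = ∫⁻ ω, ∫⁻ x, ψ ((X.chainHist n ω, X.noiseHist n ω), x)
          ∂((M.stepLaw (X.Z n ω)).prod M.noiseLaw) ∂P := by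
  have hstep := ObservedModel.isProbabilityMeasure_stepLaw hC hrate
  have := M.isProbabilityMeasure_noiseLaw
  have hnext : Measurable fun ω => (X.Z (n + 1) ω, X.S (n + 1) ω) :=
    (X.measurable_Z _).prodMk (X.measurable_S _)
  have hch := X.measurable_chainHist n
  have hno := X.measurable_noiseHist n
  have hpair := hch.prodMk hnext
  have hW : P.map (fun ω => (X.noiseHist n ω, X.W n ω))
      = (P.map (X.noiseHist n)).prod M.noiseLaw := by
    have hI := X.iIndepFun_W.indepFun_finset (Finset.range n) {n} (by simp) X.measurable_W
    have hI2 : IndepFun (X.noiseHist n) (X.W n) P :=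
      hI.comp (φ := fun (w : Finset.range n → Vec d) (k : Fin n) => w ⟨k, Finset.mem_range.2 k.2⟩)
        (ψ := fun w : ({n} : Finset ℕ) → Vec d => w ⟨n, Finset.mem_singleton_self n⟩) (by fun_prop) (by fun_prop)
    rw [hI2.map_prod_eq_prod_map_map hno.aemeasurable (X.measurable_W n).aemeasurable, X.law_W]
  have hind : P.map (fun ω => ((X.chainHist n ω, X.Z (n + 1) ω, X.S (n + 1) ω),
        (X.noiseHist n ω, X.W n ω)))
      = (P.map (fun ω => (X.chainHist n ω, X.Z (n + 1) ω, X.S (n + 1) ω))).prod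
        ((P.map (X.noiseHist n)).prod M.noiseLaw) := by
    have hI : IndepFun (fun ω => (X.chainHist n ω, X.Z (n + 1) ω, X.S (n + 1) ω))
        (fun ω => (X.noiseHist n ω, X.W n ω)) P :=
      X.indepFun_W.comp
        (φ := fun z : ℕ → Fin q × ℝ => ((fun k : Fin (n + 1) => z k), z (n + 1)))
        (ψ := fun w : ℕ → Vec d => ((fun k : Fin n => w k), w n)) (by fun_prop) (by fun_prop)
    rw [hI.map_prod_eq_prod_map_map hpair.aemeasurable (hno.prodMk (X.measurable_W n)).aemeasurable,
      hW]
  have hind2 : P.map (fun ω => (X.chainHist n ω, X.noiseHist n ω))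
      = (P.map (X.chainHist n)).prod (P.map (X.noiseHist n)) := by
    have hI : IndepFun (X.chainHist n) (X.noiseHist n) P :=
      X.indepFun_W.comp (φ := fun z : ℕ → Fin q × ℝ => fun k : Fin (n + 1) => z k)
        (ψ := fun w : ℕ → Vec d => fun k : Fin n => w k) (by fun_prop) (by fun_prop)
    rw [hI.map_prod_eq_prod_map_map hch.aemeasurable hno.aemeasurable]
  have p1 : IsProbabilityMeasure (P.map (X.noiseHist n)) :=
    Measure.isProbabilityMeasure_map hno.aemeasurable
  have p2 : IsProbabilityMeasure (P.map (X.chainHist n)) :=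
    Measure.isProbabilityMeasure_map hch.aemeasurable
  let Ψ : ((Fin (n + 1) → Fin q × ℝ) × Fin q × ℝ) × (Fin n → Vec d) × Vec d → ENNReal :=
    fun z => ψ ((z.1.1, z.2.1), z.1.2, z.2.2)
  have hΨ : Measurable Ψ := hψ.comp (by fun_prop)
  have m1 : Measurable fun z : (Fin (n + 1) → Fin q × ℝ) × Fin q × ℝ =>
      ∫⁻ w, Ψ (z, w) ∂((P.map (X.noiseHist n)).prod M.noiseLaw) := hΨ.lintegral_prod_right'
  have lhs : ∫⁻ ω, ψ ((X.chainHist n ω, X.noiseHist n ω), (X.Z (n + 1) ω, X.S (n + 1) ω), X.W n ω) ∂P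
      = ∫⁻ ω, ∫⁻ x, ∫⁻ w, Ψ ((X.chainHist n ω, x), w)
        ∂((P.map (X.noiseHist n)).prod M.noiseLaw) ∂(M.stepLaw (X.Z n ω)) ∂P := by
    rw [← X.lintegral_chain hC hrate n m1]
    have := lintegral_map (μ := P) hΨ (hpair.prodMk (hno.prodMk (X.measurable_W n)))
    rw [hind, lintegral_prod _ hΨ.aemeasurable, lintegral_map m1 hpair] at this
    exact this.symm
  rw [lhs]
  let κ : Kernel ((Fin (n + 1) → Fin q × ℝ) × (Fin n → Vec d)) ((Fin q × ℝ) × Vec d) :=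
    (Kernel.ofFunOfCountable fun i => (M.stepLaw i).prod M.noiseLaw).comap
      (fun h => (h.1 (Fin.last n)).1) (by fun_prop)
  have hκ : ∀ h, κ h = (M.stepLaw (h.1 (Fin.last n)).1).prod M.noiseLaw := fun h => rfl
  have : IsMarkovKernel κ := ⟨fun h => by rw [hκ]; infer_instance⟩
  have m2 : Measurable fun z : (Fin (n + 1) → Fin q × ℝ) × (Fin n → Vec d) =>
      ∫⁻ x, ψ (z, x) ∂(κ z) := hψ.lintegral_kernel_prod_right'
  have rhs : ∫⁻ ω, ∫⁻ x, ψ ((X.chainHist n ω, X.noiseHist n ω), x)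
          ∂((M.stepLaw (X.Z n ω)).prod M.noiseLaw) ∂P
      = ∫⁻ ω, ∫⁻ w, ∫⁻ x, ψ ((X.chainHist n ω, w), x)
          ∂((M.stepLaw (X.Z n ω)).prod M.noiseLaw) ∂(P.map (X.noiseHist n)) ∂P := by
    have := lintegral_map (μ := P) m2 (hch.prodMk hno)
    rw [hind2, lintegral_prod _ m2.aemeasurable, lintegral_map m2.lintegral_prod_right' hch] at this
    exact this.symm
  rw [rhs]
  refine lintegral_congr fun ω => ?_
  have m3 : Measurable fun z : (Fin q × ℝ) × (Fin n → Vec d) × Vec d =>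
      Ψ ((X.chainHist n ω, z.1), z.2) := hΨ.comp (by fun_prop)
  have e1 : ∀ w, ∫⁻ x, ψ ((X.chainHist n ω, w), x) ∂((M.stepLaw (X.Z n ω)).prod M.noiseLaw)
      = ∫⁻ x, ∫⁻ y, Ψ ((X.chainHist n ω, x), (w, y)) ∂M.noiseLaw ∂(M.stepLaw (X.Z n ω)) :=
    fun w => lintegral_prod _ (hψ.comp measurable_prodMk_left).aemeasurable
  have e2 : ∀ x, ∫⁻ w, Ψ ((X.chainHist n ω, x), w) ∂((P.map (X.noiseHist n)).prod M.noiseLaw)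
      = ∫⁻ w, ∫⁻ y, Ψ ((X.chainHist n ω, x), (w, y)) ∂M.noiseLaw ∂(P.map (X.noiseHist n)) :=
    fun x => lintegral_prod _ (hΨ.comp measurable_prodMk_left).aemeasurable
  simp_rw [e1, e2]
  refine lintegral_lintegral_swap (Measurable.aemeasurable ?_)
  have m4 : Measurable fun z : ((Fin q × ℝ) × (Fin n → Vec d)) × Vec d =>
      Ψ ((X.chainHist n ω, z.1.1), (z.1.2, z.2)) := hΨ.comp (by fun_prop)
  exact m4.lintegral_prod_right'

/-- The conditional law of `(Z_{n+1}, Y_{n+1}, S_{n+1})` given the past is `transLaw Z_n`. -/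
theorem lintegral_obsHist (n : ℕ)
    {ψ : (Fin (n + 1) → Vec d × ℝ) × Fin q × Vec d × ℝ → ENNReal} (hψ : Measurable ψ) :
    ∫⁻ ω, ψ (X.obsHist n ω, X.Z (n + 1) ω, X.Y (n + 1) ω, X.S (n + 1) ω) ∂P
      = ∫⁻ ω, ∫⁻ z, ψ (X.obsHist n ω, z) ∂(M.transLaw (X.Z n ω)) ∂P := by
  have h := X.lintegral_history hC hrate n
    (ψ := fun z => ψ (obsOfHist M n z.1, z.2.1.1, M.obs z.2.1.1 + z.2.2, z.2.1.2))
    (hψ.comp (((measurable_obsOfHist M n).comp measurable_fst).prodMk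
      (M.measurable_emission.comp measurable_snd)))
  simp only [← X.obsHist_eq] at h
  refine Eq.trans h (lintegral_congr fun ω => ?_)
  rw [ObservedModel.transLaw, lintegral_map (f := fun z => ψ (X.obsHist n ω, z))
    (hψ.comp measurable_prodMk_left) M.measurable_emission]

end Rate

theorem filter_ae_mem (n : ℕ) : ∀ᵐ ω ∂P, X.filter n ω ∈ stdSimplex ℝ (Fin q) := by
  have hle := X.observed_le n
  have hm : ∀ i, MeasurableSet {ω | X.Z n ω = i} := fun i =>
    X.measurable_Z n (measurableSet_singleton i)
  have hint : ∀ i, Integrable (({ω | X.Z n ω = i}).indicator fun _ => (1 : ℝ)) P := fun i =>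
    (integrable_const (1 : ℝ)).indicator (hm i)
  have h0 : ∀ i, 0 ≤ᵐ[P] P[({ω | X.Z n ω = i}).indicator (fun _ => (1 : ℝ)) | X.observed n] :=
    fun i => condExp_nonneg (Filter.Eventually.of_forall fun ω =>
      indicator_nonneg (fun _ _ => zero_le_one) ω)
  have hsum := condExp_finsetSum (m := X.observed n) (μ := P) (s := Finset.univ)
    (f := fun i => ({ω | X.Z n ω = i}).indicator fun _ => (1 : ℝ)) fun i _ => hint i
  have hone : (∑ i, ({ω | X.Z n ω = i}).indicator fun _ => (1 : ℝ)) = fun _ => (1 : ℝ) := by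
    ext ω
    rw [Finset.sum_apply, Finset.sum_eq_single (X.Z n ω)]
    · simp
    · intro j _ hj; simp [hj.symm]
    · simp
  rw [hone, condExp_const hle] at hsum
  filter_upwards [ae_all_iff.2 h0, hsum] with ω hω hs
  refine ⟨hω, ?_⟩
  rw [Finset.sum_apply] at hs
  exact hs.symm

variable [NeZero q]

/-- The filter is a measurable function of the observations, with values in the simplex. -/
theorem exists_filter_eq (n : ℕ) : ∃ F : (Fin (n + 1) → Vec d × ℝ) → Fin q → ℝ,
    Measurable F ∧ (∀ θ, F θ ∈ stdSimplex ℝ (Fin q)) ∧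
      ∀ᵐ ω ∂P, X.filter n ω = F (X.obsHist n ω) := by
  have hmeas : Measurable[X.observed n] (X.filter n) :=
    @measurable_pi_lambda _ _ _ (X.observed n) _ _ fun i => stronglyMeasurable_condExp.measurable
  obtain ⟨F₀, hF₀, hF⟩ := hmeas.exists_eq_measurable_comp
  -- The conditional probabilities form a probability vector only almost surely. The retraction
  -- gives a version that does so everywhere, as a Markov kernel built from it requires.
  refine ⟨fun θ => toSimplex (F₀ θ), measurable_toSimplex.comp hF₀, fun θ => toSimplex_mem _, ?_⟩
  filter_upwards [X.filter_ae_mem n] with ω hω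
  have e : X.filter n ω = F₀ (X.obsHist n ω) := congrFun hF ω
  rw [e] at hω ⊢
  exact (toSimplex_of_mem hω).symm

omit [NeZero q] in
-- The defining property of the filter, extended from observed events to nonnegative functions of
-- the observations through an equality of measures.
theorem lintegral_indicator_filter (n : ℕ) {F : (Fin (n + 1) → Vec d × ℝ) → Fin q → ℝ}
    (hF : Measurable F) (hmem : ∀ θ, F θ ∈ stdSimplex ℝ (Fin q))
    (hFX : ∀ᵐ ω ∂P, X.filter n ω = F (X.obsHist n ω)) (i : Fin q)
    {f : (Fin (n + 1) → Vec d × ℝ) → ENNReal} (hf : Measurable f) :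
    ∫⁻ ω in {ω | X.Z n ω = i}, f (X.obsHist n ω) ∂P
      = ∫⁻ ω, ENNReal.ofReal (F (X.obsHist n ω) i) * f (X.obsHist n ω) ∂P := by
  have hθ := X.measurable_obsHist n
  have hm : MeasurableSet {ω | X.Z n ω = i} := X.measurable_Z n (measurableSet_singleton i)
  have hFi : Measurable fun θ => F θ i := (measurable_pi_apply i).comp hF
  have hlaw : (P.restrict {ω | X.Z n ω = i}).map (X.obsHist n)
      = (P.map (X.obsHist n)).withDensity fun θ => ENNReal.ofReal (F θ i) := by
    ext A hA
    rw [Measure.map_apply hθ hA, withDensity_apply _ hA, setLIntegral_map hA hFi.ennreal_ofReal hθ,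
      Measure.restrict_apply (hθ hA)]
    have h := setIntegral_condExp (μ := P) (X.observed_le n)
      (f := ({ω | X.Z n ω = i}).indicator fun _ => (1 : ℝ))
      ((integrable_const (1 : ℝ)).indicator hm) (s := X.obsHist n ⁻¹' A) ⟨A, hA, rfl⟩
    rw [setIntegral_congr_ae (f := P[({ω | X.Z n ω = i}).indicator (fun _ => (1 : ℝ)) | X.observed n])
      (g := fun ω => F (X.obsHist n ω) i) (hθ hA)
      (hFX.mono fun ω hω _ => congrFun hω i), setIntegral_indicator hm,
      setIntegral_one_eq_measureReal] at h
    rw [← ofReal_integral_eq_lintegral_ofReal, h, Measure.real,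
      ENNReal.ofReal_toReal (measure_ne_top _ _)]
    · refine Integrable.of_bound (hFi.comp hθ).aestronglyMeasurable 1
        (Filter.Eventually.of_forall fun ω => ?_)
      rw [Real.norm_of_nonneg ((hmem _).1 i), ← (hmem (X.obsHist n ω)).2]
      exact Finset.single_le_sum (fun i _ => (hmem (X.obsHist n ω)).1 i) (Finset.mem_univ i)
    · exact Filter.Eventually.of_forall fun ω => (hmem _).1 i
  rw [← lintegral_map (f := f) hf hθ, hlaw,
    lintegral_withDensity_eq_lintegral_mul _ hFi.ennreal_ofReal hf,
    lintegral_map (hFi.ennreal_ofReal.mul hf) hθ]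
  rfl

section Rate

variable {Clam : ℝ} (hC : 0 ≤ Clam) (hrate : ∀ y ∈ closure M.E, M.rate y ≤ Clam)
include hC hrate

omit [NeZero q] in
/-- The conditional law of `(Z_{n+1}, Y_{n+1}, S_{n+1})` given the observations. -/
theorem map_obsHist_next (n : ℕ) {F : (Fin (n + 1) → Vec d × ℝ) → Fin q → ℝ}
    (hF : Measurable F) (hmem : ∀ θ, F θ ∈ stdSimplex ℝ (Fin q))
    (hFX : ∀ᵐ ω ∂P, X.filter n ω = F (X.obsHist n ω)) :
    P.map (fun ω => (X.obsHist n ω, X.Z (n + 1) ω, X.Y (n + 1) ω, X.S (n + 1) ω))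
      = P.map (X.obsHist n) ⊗ₘ mixKernel M.transLaw hF := by
  have := ObservedModel.isProbabilityMeasure_transLaw hC hrate
  have := isMarkovKernel_mixKernel M.transLaw hF hmem
  have hθ := X.measurable_obsHist n
  have hjoint : Measurable fun ω => (X.obsHist n ω, X.Z (n + 1) ω, X.Y (n + 1) ω, X.S (n + 1) ω) :=
    hθ.prodMk ((X.measurable_Z _).prodMk ((X.measurable_Y _).prodMk (X.measurable_S _)))
  refine Measure.ext_of_lintegral _ fun ψ hψ => ?_
  have hφ : ∀ i, Measurable fun θ => ∫⁻ z, ψ (θ, z) ∂(M.transLaw i) := fun i =>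
    hψ.lintegral_prod_right'
  have hφθ : ∀ i, Measurable fun ω => ∫⁻ z, ψ (X.obsHist n ω, z) ∂(M.transLaw i) := fun i =>
    (hφ i).comp hθ
  have hFθ : ∀ i, Measurable fun ω => ENNReal.ofReal (F (X.obsHist n ω) i) := fun i =>
    ((measurable_pi_apply i).comp (hF.comp hθ)).ennreal_ofReal
  rw [lintegral_map hψ hjoint, X.lintegral_obsHist hC hrate n hψ, Measure.lintegral_compProd hψ,
    lintegral_map hψ.lintegral_kernel_prod_right' hθ]
  have hm : ∀ i, MeasurableSet {ω | X.Z n ω = i} := fun i =>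
    X.measurable_Z n (measurableSet_singleton i)
  -- The hidden state is split into its `q` values, and each indicator is exchanged for the
  -- corresponding filter weight; the sum is then the mixture law.
  calc ∫⁻ ω, ∫⁻ z, ψ (X.obsHist n ω, z) ∂(M.transLaw (X.Z n ω)) ∂P
      = ∫⁻ ω, ∑ i, ({ω | X.Z n ω = i}).indicator
          (fun ω => ∫⁻ z, ψ (X.obsHist n ω, z) ∂(M.transLaw i)) ω ∂P := by
        refine lintegral_congr fun ω => ?_
        rw [Finset.sum_eq_single (X.Z n ω)]
        · simp
        · intro j _ hj; simp [hj.symm]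
        · simp
    _ = ∑ i, ∫⁻ ω, ENNReal.ofReal (F (X.obsHist n ω) i) *
          ∫⁻ z, ψ (X.obsHist n ω, z) ∂(M.transLaw i) ∂P := by
        rw [lintegral_finsetSum _ fun i _ => (hφθ i).indicator (hm i)]
        refine Finset.sum_congr rfl fun i _ => ?_
        rw [lintegral_indicator (hm i)]
        exact X.lintegral_indicator_filter n hF hmem hFX i (hφ i)
    _ = _ := by
        rw [← lintegral_finsetSum (f := fun i ω => ENNReal.ofReal (F (X.obsHist n ω) i) *
          ∫⁻ z, ψ (X.obsHist n ω, z) ∂(M.transLaw i)) _ fun i _ => (hFθ i).mul (hφθ i)]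
        refine lintegral_congr fun ω => ?_
        rw [mixKernel_apply, mixLaw, lintegral_finsetSum_measure]
        refine Finset.sum_congr rfl fun i _ => ?_
        rw [lintegral_smul_measure, smul_eq_mul]

/-- The filter recursion. -/
theorem filter_succ_ae_eq (n : ℕ) {F : (Fin (n + 1) → Vec d × ℝ) → Fin q → ℝ}
    (hF : Measurable F) (hmem : ∀ θ, F θ ∈ stdSimplex ℝ (Fin q))
    (hFX : ∀ᵐ ω ∂P, X.filter n ω = F (X.obsHist n ω)) :
    ∀ᵐ ω ∂P, X.filter (n + 1) ω
      = bayes M.transLaw (F (X.obsHist n ω)) (X.Y (n + 1) ω, X.S (n + 1) ω) := by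
  have := ObservedModel.isProbabilityMeasure_transLaw hC hrate
  have h := fun j => bayes_ae_eq_condExp M.transLaw (X.measurable_obsHist n)
    (X.measurable_Z (n + 1)) ((X.measurable_Y (n + 1)).prodMk (X.measurable_S (n + 1))) hF hmem
    (X.map_obsHist_next hC hrate n hF hmem hFX) j
  -- The old history together with the new observation generates the next σ-algebra: `Fin.snoc` and
  -- restriction are inverse measurable maps.
  have hσ : MeasurableSpace.comap
      (fun ω => (X.obsHist n ω, X.Y (n + 1) ω, X.S (n + 1) ω)) inferInstance
      = X.observed (n + 1) := by
    refine comap_eq_comap_of_comp (g := X.obsHist (n + 1))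
      (a := fun θ : Fin (n + 1 + 1) → Vec d × ℝ =>
        ((fun k : Fin (n + 1) => θ k.castSucc), θ (Fin.last (n + 1))))
      (b := fun z : (Fin (n + 1) → Vec d × ℝ) × Vec d × ℝ =>
        (Fin.snoc (α := fun _ => Vec d × ℝ) z.1 z.2)) (by fun_prop) ?_ (fun ω => rfl) ?_
    · refine measurable_pi_lambda _ fun k => ?_
      refine Fin.lastCases ?_ (fun j => ?_) k
      · simp only [Fin.snoc_last]; fun_prop
      · simp only [Fin.snoc_castSucc]; fun_prop
    · intro ω
      ext1 k
      refine Fin.lastCases ?_ (fun j => ?_) k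
      · rw [Fin.snoc_last]; rfl
      · rw [Fin.snoc_castSucc]; rfl
  rw [hσ] at h
  filter_upwards [ae_all_iff.2 h] with ω hω
  ext j
  exact (hω j).symm

end Rate

end ObservedProcess

end

end PODP

/-! ### The time grid and the discretization of stopping times -/

namespace PODP

noncomputable section

namespace ObservedModel

variable {d q : ℕ} {M : ObservedModel d q}

section Grid

theorem tStar_zero : M.tStar 0 = 0 := by simp [tStar]

theorem tStar_mono : Monotone M.tStar := by
  intro i j hij
  refine Fin.cases (fun hi => ?_) (fun i' => ?_) i hij
  · rw [tStar_zero]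
    refine Fin.cases ?_ (fun j' => ?_) j
    · rw [tStar_zero]
    · exact (M.exit_pos j').le
  · refine Fin.cases (fun h => absurd h (by simp)) (fun j' h => ?_) j
    change M.exit i' ≤ M.exit j'
    simp only [exit, tStar, Fin.cons_succ]
    exact ENNReal.toReal_mono (M.exitTime_lt_top j').ne (M.exitTime_mono (Fin.succ_le_succ_iff.1 h))

theorem exit_notMem (m : Fin q) {a b : ℝ} (ha : M.tStar m.castSucc ≤ a) (hb : b < M.tStar m.succ)
    (i : Fin q) : M.exit i ∉ Ioc a b := by
  rintro ⟨h1, h2⟩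
  rcases le_or_gt i.succ m.castSucc with h | h
  · exact absurd ((tStar_mono (M := M) h).trans ha) (not_le.2 h1)
  · have h' : m.succ ≤ i.succ := Fin.castSucc_lt_iff_succ_le.1 h
    exact absurd ((tStar_mono (M := M) h').trans h2) (not_le.2 hb)

variable {Δ : ℝ} (hΔ : M.IsStep Δ)
include hΔ

/-- The factor `1 / 2` in `IsStep` leaves room for a margin `Δ` at both ends of each interval. -/
theorem two_step_lt {m : Fin q} (hm : M.tStar m.castSucc < M.tStar m.succ) :
    M.tStar m.castSucc + 2 * Δ < M.tStar m.succ := by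
  have h := hΔ.2 m.succ m.castSucc hm.ne'
  rw [abs_of_pos (sub_pos.2 hm)] at h
  linarith

omit hΔ in
theorem mem_grid_iff {u : ℝ} : u ∈ M.grid Δ ↔
    ∃ m : Fin q, M.tStar m.castSucc < M.tStar m.succ ∧ u ∈ M.gridPart m Δ := by
  simp [grid]

/-- This margin around the exit times allows windows of radius `η < Δ` around grid points in
`cond_disagree_le`. -/
theorem grid_between {u : ℝ} (hu : u ∈ M.grid Δ) : ∃ m : Fin q,
    M.tStar m.castSucc + Δ ≤ u ∧ u ≤ M.tStar m.succ - Δ := by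
  obtain ⟨m, hm, hu⟩ := mem_grid_iff.1 hu
  refine ⟨m, ?_⟩
  rcases hu with ⟨i, hi1, hi2, rfl⟩ | hu
  · have h1 : (1 : ℝ) ≤ i := by exact_mod_cast hi1
    have := hΔ.1
    exact ⟨by nlinarith, hi2⟩
  · rw [mem_singleton_iff] at hu
    have := two_step_lt hΔ hm
    exact ⟨by linarith, hu.le⟩

theorem grid_pos {u : ℝ} (hu : u ∈ M.grid Δ) : Δ ≤ u := by
  obtain ⟨m, h1, -⟩ := grid_between hΔ hu
  have : 0 ≤ M.tStar m.castSucc := by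
    rw [← tStar_zero (M := M)]; exact tStar_mono (Fin.zero_le _)
  linarith

theorem exit_notMem_of_mem_grid {u η : ℝ} (hu : u ∈ M.grid Δ) (hη : η < Δ) (i : Fin q) :
    M.exit i ∉ Ioc (u - η) (u + η) := by
  obtain ⟨m, h1, h2⟩ := grid_between hΔ hu
  exact exit_notMem m (by linarith) (by linarith) i

omit hΔ in
theorem exists_tStar_between {u : ℝ} (hu : 0 ≤ u) {i : Fin q} (hi : u < M.exit i) :
    ∃ m : Fin q, M.tStar m.castSucc ≤ u ∧ u < M.tStar m.succ := by
  by_contra! hcon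
  have : ∀ j : Fin (q + 1), M.tStar j ≤ u := fun j =>
    Fin.induction (motive := fun j => M.tStar j ≤ u) (by rwa [tStar_zero]) hcon j
  exact absurd (this i.succ) (not_le.2 hi)

omit hΔ in
theorem grid_nonempty : (M.grid Δ).Nonempty := by
  obtain ⟨m, h1, h2⟩ := exists_tStar_between (M := M) le_rfl (M.exit_pos M.start)
  exact ⟨M.tStar m.succ - Δ, mem_grid_iff.2 ⟨m, h1.trans_lt h2, Or.inr rfl⟩⟩

/-- Every time before the last exit time is close to a point of the grid, without an exit time in
between. -/
theorem exists_grid_near {u : ℝ} (hu : 0 ≤ u) {i : Fin q} (hi : u < M.exit i) :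
    ∃ u' ∈ M.grid Δ, |u - u'| ≤ Δ ∧ ∀ i, M.exit i ∉ Ioc (min u u') (max u u') := by
  obtain ⟨m, h1, h2⟩ := exists_tStar_between hu hi
  have hm := h1.trans_lt h2
  have hgap := two_step_lt hΔ hm
  have hΔ0 := hΔ.1
  have hlast : M.tStar m.succ - Δ ∈ M.grid Δ := mem_grid_iff.2 ⟨m, hm, Or.inr rfl⟩
  rcases le_or_gt u (M.tStar m.succ - Δ) with h | h
  · have hx : 0 ≤ (u - M.tStar m.castSucc) / Δ := div_nonneg (sub_nonneg.2 h1) hΔ0.le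
    set k := ⌊(u - M.tStar m.castSucc) / Δ⌋₊ with hk
    have hk1 : (k : ℝ) * Δ ≤ u - M.tStar m.castSucc := by
      rw [← le_div_iff₀ hΔ0]; exact Nat.floor_le hx
    have hk2 : u - M.tStar m.castSucc < (k + 1) * Δ := by
      rw [← div_lt_iff₀ hΔ0]; exact Nat.lt_floor_add_one _
    -- The index is rounded up, since `k = 0` would give the exit time itself, which is not one of
    -- the regular points. If the rounded point overshoots, the last point of the part is still
    -- within `Δ`.
    rcases le_or_gt (M.tStar m.castSucc + ((k + 1 : ℕ) : ℝ) * Δ) (M.tStar m.succ - Δ) with h' | h'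
    · refine ⟨M.tStar m.castSucc + ((k + 1 : ℕ) : ℝ) * Δ, mem_grid_iff.2
        ⟨m, hm, Or.inl ⟨k + 1, by omega, h', rfl⟩⟩, ?_, ?_⟩
      · push_cast
        rw [abs_le]
        constructor <;> linarith
      · push_cast at h' ⊢
        have : u ≤ M.tStar m.castSucc + (k + 1) * Δ := by linarith
        rw [min_eq_left this, max_eq_right this]
        exact exit_notMem m h1 (by linarith)
    · push_cast at h'
      refine ⟨_, hlast, ?_, ?_⟩
      · rw [abs_le]
        constructor <;> linarith
      · rw [min_eq_left h, max_eq_right h]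
        exact exit_notMem m h1 (by linarith)
  -- In the final stretch of length `Δ` the approximation goes to the left, so as not to cross the
  -- next exit time.
  · refine ⟨_, hlast, ?_, ?_⟩
    · rw [abs_le]
      constructor <;> linarith
    · rw [min_eq_right h.le, max_eq_left h.le]
      exact exit_notMem m (by linarith) h2

end Grid

/-- The last exit time. -/
def lastExit (M : ObservedModel d q) : ℝ := M.tStar (Fin.last q)

theorem exit_le_lastExit (i : Fin q) : M.exit i ≤ M.lastExit := tStar_mono (Fin.le_last _)

theorem lastExit_nonneg : 0 ≤ M.lastExit := by
  rw [← tStar_zero (M := M)]; exact tStar_mono (Fin.zero_le _)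

section Rate

variable {Clam : ℝ} (hC : 0 ≤ Clam) (hrate : ∀ y ∈ closure M.E, M.rate y ≤ Clam)
include hC hrate

variable [NeZero q] {v : (Fin q → ℝ) → ℝ} {K C : ℝ} (hv : LipOnSimplex v K)
  (hb : BddOnSimplex v C)
include hv hb

/-- The error due to the discretization of the stopping times. -/
theorem abs_L_sub_grid_le {g : Vec d → ℝ} (hg : ∀ y ∈ closure M.E, |g y| ≤ C)
    {g2 : ℝ} (hg2 : 0 ≤ g2)
    (hg_lip : ∀ i, ∀ t ∈ Set.Icc 0 (M.exit i), ∀ u ∈ Set.Icc 0 (M.exit i),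
      |g (M.flow (M.x i) t) - g (M.flow (M.x i) u)| ≤ g2 * |t - u|)
    {Δ : ℝ} (hΔ : M.IsStep Δ) {π : Fin q → ℝ} (hπ : π ∈ stdSimplex ℝ (Fin q)) :
    |M.L v g π - max (sSup (M.J v g π '' M.grid Δ)) (M.J v g π M.lastExit)|
      ≤ (g2 + 2 * C * Clam) * Δ := by
  have hC0 : 0 ≤ C := (abs_nonneg _).trans (hb _ hπ)
  have ha : 0 ≤ g2 + 2 * C * Clam := by positivity
  have hbdd := bddAbove_J hC hrate hv hb hg hπ
  have hsub : M.J v g π '' M.grid Δ ⊆ M.J v g π '' Ici 0 := image_mono fun u hu =>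
    hΔ.1.le.trans (grid_pos hΔ hu)
  have hbdd' : BddAbove (M.J v g π '' M.grid Δ) := hbdd.mono hsub
  have hmax : max (sSup (M.J v g π '' M.grid Δ)) (M.J v g π M.lastExit) ≤ M.L v g π :=
    max_le (csSup_le_csSup hbdd ((grid_nonempty (M := M) (Δ := Δ)).image _) hsub)
      (le_csSup hbdd ⟨_, lastExit_nonneg, rfl⟩)
  rw [abs_of_nonneg (sub_nonneg.2 hmax), sub_le_iff_le_add]
  refine csSup_le ⟨_, 0, mem_Ici.2 le_rfl, rfl⟩ ?_
  rintro _ ⟨u, hu, rfl⟩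
  -- Times past every exit time need no approximation: there `J` equals its value at `lastExit`, the
  -- second term of the maximum.
  by_cases h : ∃ i, u < M.exit i
  · obtain ⟨i, hi⟩ := h
    obtain ⟨u', hu', hd, hex⟩ := exists_grid_near hΔ hu hi
    have h1 : |M.J v g π u - M.J v g π u'| ≤ (g2 + 2 * C * Clam) * Δ := by
      have hu'0 : 0 ≤ u' := hΔ.1.le.trans (grid_pos hΔ hu')
      rcases le_total u u' with hle | hle
      · rw [min_eq_left hle, max_eq_right hle] at hex
        refine (abs_J_sub_time_le hC hrate hv hb hg hg2 hg_lip hπ hu hle hex).trans ?_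
        rw [abs_sub_comm, abs_of_nonneg (sub_nonneg.2 hle)] at hd
        exact mul_le_mul_of_nonneg_left hd ha
      · rw [min_eq_right hle, max_eq_left hle] at hex
        rw [abs_sub_comm]
        refine (abs_J_sub_time_le hC hrate hv hb hg hg2 hg_lip hπ hu'0 hle hex).trans ?_
        rw [abs_of_nonneg (sub_nonneg.2 hle)] at hd
        exact mul_le_mul_of_nonneg_left hd ha
    have h2 : M.J v g π u' ≤ sSup (M.J v g π '' M.grid Δ) := le_csSup hbdd' ⟨u', hu', rfl⟩
    have h3 := le_max_left (sSup (M.J v g π '' M.grid Δ)) (M.J v g π M.lastExit)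
    linarith [(abs_le.1 h1).2]
  · push Not at h
    rw [J_eq_of_exit_le hC hrate v g π h exit_le_lastExit]
    have h3 := le_max_right (sSup (M.J v g π '' M.grid Δ)) (M.J v g π M.lastExit)
    have := mul_nonneg ha hΔ.1.le
    linarith

end Rate

end ObservedModel

end

end PODP

/-! ### Dynamic programming along the observed process -/

namespace PODP

noncomputable section

namespace ObservedProcess

variable {d q : ℕ} {M : ObservedModel d q} {Ω : Type*} [MeasurableSpace Ω] {P : Measure Ω}
  (X : ObservedProcess M P) [IsProbabilityMeasure P]

section Rate

variable {Clam : ℝ} (hC : 0 ≤ Clam) (hrate : ∀ y ∈ closure M.E, M.rate y ≤ Clam)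
include hC hrate

theorem integral_obsHist_next (n : ℕ) {F : (Fin (n + 1) → Vec d × ℝ) → Fin q → ℝ}
    (hF : Measurable F) (hmem : ∀ θ, F θ ∈ stdSimplex ℝ (Fin q))
    (hFX : ∀ᵐ ω ∂P, X.filter n ω = F (X.obsHist n ω))
    {f : (Fin (n + 1) → Vec d × ℝ) × Vec d × ℝ → ℝ} (hf : Measurable f) {B : ℝ}
    (hB : ∀ z, |f z| ≤ B) :
    ∫ ω, f (X.obsHist n ω, X.Y (n + 1) ω, X.S (n + 1) ω) ∂P
      = ∫ ω, ∫ z, f (X.obsHist n ω, z.2) ∂(M.oneStepLaw (F (X.obsHist n ω))) ∂P := by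
  have := ObservedModel.isProbabilityMeasure_transLaw hC hrate
  have := isMarkovKernel_mixKernel M.transLaw hF hmem
  have hθ := X.measurable_obsHist n
  have : IsProbabilityMeasure (P.map (X.obsHist n)) :=
    Measure.isProbabilityMeasure_map hθ.aemeasurable
  have hjoint : Measurable fun ω => (X.obsHist n ω, X.Z (n + 1) ω, X.Y (n + 1) ω, X.S (n + 1) ω) :=
    hθ.prodMk ((X.measurable_Z _).prodMk ((X.measurable_Y _).prodMk (X.measurable_S _)))
  let f' : (Fin (n + 1) → Vec d × ℝ) × Fin q × Vec d × ℝ → ℝ := fun z => f (z.1, z.2.2)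
  have hf' : Measurable f' := hf.comp (by fun_prop)
  have h1 := integral_map (μ := P) hjoint.aemeasurable hf'.aestronglyMeasurable
  rw [X.map_obsHist_next hC hrate n hF hmem hFX, Measure.integral_compProd
    (Integrable.of_bound hf'.aestronglyMeasurable B (Filter.Eventually.of_forall fun z => hB _)),
    integral_map hθ.aemeasurable] at h1
  · exact h1.symm
  · exact (hf'.stronglyMeasurable.integral_kernel_prod_right'
      (κ := mixKernel M.transLaw hF)).aestronglyMeasurable

/-- A jump is forced at the exit time of the current state, whichever state it is. This makes the
jump times bounded, hence in every `L^p`. -/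
theorem time_mem_ae (n : ℕ) : ∀ᵐ ω ∂P, X.S (n + 1) ω ∈ Icc 0 M.lastExit := by
  have hset : MeasurableSet {z : (Fin (n + 1) → Vec d × ℝ) × Fin q × Vec d × ℝ |
      z.2.2.2 ∈ (Icc 0 M.lastExit)ᶜ} := by
    have : Measurable fun z : (Fin (n + 1) → Vec d × ℝ) × Fin q × Vec d × ℝ => z.2.2.2 := by
      fun_prop
    exact this measurableSet_Icc.compl
  have h := X.lintegral_obsHist hC hrate n (measurable_one.indicator hset)
  have h0 : ∀ i, ∀ θ : Fin (n + 1) → Vec d × ℝ, ∫⁻ z, ({z : (Fin (n + 1) → Vec d × ℝ) ×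
      Fin q × Vec d × ℝ | z.2.2.2 ∈ (Icc 0 M.lastExit)ᶜ}).indicator 1 (θ, z) ∂(M.transLaw i)
        = 0 := by
    intro i θ
    have e : (fun z => ({z : (Fin (n + 1) → Vec d × ℝ) × Fin q × Vec d × ℝ |
        z.2.2.2 ∈ (Icc 0 M.lastExit)ᶜ}).indicator (1 : (Fin (n + 1) → Vec d × ℝ) × Fin q × Vec d × ℝ → ENNReal) (θ, z))
        = ({z : Fin q × Vec d × ℝ | z.2.2 ∈ (Icc 0 M.lastExit)ᶜ}).indicator 1 := rfl
    rw [e, lintegral_indicator_one (ObservedModel.measurableSet_time measurableSet_Icc.compl),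
      ObservedModel.transLaw_time hC hrate i measurableSet_Icc.compl]
    refine measure_mono_null (t := {s | ¬s ∈ Icc 0 (M.exit i)}) (fun s hs hs' => hs ?_)
      (ObservedModel.jumpTimeLaw_ae_mem hC hrate i)
    exact ⟨hs'.1, hs'.2.trans (ObservedModel.exit_le_lastExit i)⟩
  simp_rw [h0, lintegral_zero] at h
  have hm : MeasurableSet {ω | X.S (n + 1) ω ∈ (Icc 0 M.lastExit)ᶜ} :=
    X.measurable_S (n + 1) measurableSet_Icc.compl
  have e : (fun ω => ({z : (Fin (n + 1) → Vec d × ℝ) × Fin q × Vec d × ℝ |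
      z.2.2.2 ∈ (Icc 0 M.lastExit)ᶜ}).indicator (1 : (Fin (n + 1) → Vec d × ℝ) × Fin q × Vec d × ℝ → ENNReal)
        (X.obsHist n ω, X.Z (n + 1) ω, X.Y (n + 1) ω, X.S (n + 1) ω))
      = ({ω | X.S (n + 1) ω ∈ (Icc 0 M.lastExit)ᶜ}).indicator 1 := rfl
  rw [e, lintegral_indicator_one hm] at h
  exact h

variable [NeZero q]

/-- Given an observed event, the next jump time falls in an interval free of exit times with
probability at most the length of the interval times the bound on the rate. -/
theorem measureReal_time_le (n : ℕ) {B : Set Ω} (hB : MeasurableSet[X.observed n] B) {a b : ℝ}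
    (ha : 0 ≤ a) (hab : a ≤ b) (hi : ∀ i, M.exit i ∉ Ioc a b) :
    P.real (B ∩ {ω | X.S (n + 1) ω ∈ Ioc a b}) ≤ Clam * (b - a) * P.real B := by
  obtain ⟨F, hF, hmem, hFX⟩ := X.exists_filter_eq n
  obtain ⟨B', hB', rfl⟩ := hB
  have hθ := X.measurable_obsHist n
  have hBm : MeasurableSet (X.obsHist n ⁻¹' B') := hθ hB'
  have hset : MeasurableSet {z : (Fin (n + 1) → Vec d × ℝ) × Vec d × ℝ |
      z.1 ∈ B' ∧ z.2.2 ∈ Ioc a b} :=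
    (measurable_fst hB').inter ((measurable_snd.comp measurable_snd) measurableSet_Ioc)
  have hev : MeasurableSet (X.obsHist n ⁻¹' B' ∩ {ω | X.S (n + 1) ω ∈ Ioc a b}) :=
    hBm.inter (X.measurable_S _ measurableSet_Ioc)
  have h := X.integral_obsHist_next hC hrate n hF hmem hFX
    (f := ({z | z.1 ∈ B' ∧ z.2.2 ∈ Ioc a b}).indicator 1) (measurable_one.indicator hset) (B := 1)
    (fun z => by
      classical
      rw [indicator_apply]
      split_ifs <;> simp)
  have e1 : (fun ω => ({z : (Fin (n + 1) → Vec d × ℝ) × Vec d × ℝ |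
      z.1 ∈ B' ∧ z.2.2 ∈ Ioc a b}).indicator (1 : (Fin (n + 1) → Vec d × ℝ) × Vec d × ℝ → ℝ)
        (X.obsHist n ω, X.Y (n + 1) ω, X.S (n + 1) ω))
      = (X.obsHist n ⁻¹' B' ∩ {ω | X.S (n + 1) ω ∈ Ioc a b}).indicator 1 := rfl
  rw [e1, integral_indicator_one hev] at h
  change P.real (X.obsHist n ⁻¹' B' ∩ _) ≤ Clam * (b - a) * P.real (X.obsHist n ⁻¹' B')
  rw [h, ← integral_indicator_one hBm, ← integral_const_mul]
  refine integral_mono_of_nonneg (Filter.Eventually.of_forall fun ω => integral_nonneg fun z =>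
    indicator_nonneg (fun _ _ => zero_le_one) _) (((integrable_const (1 : ℝ)).indicator
      hBm).const_mul _) (Filter.Eventually.of_forall fun ω => ?_)
  dsimp only
  by_cases hω : X.obsHist n ω ∈ B'
  · have e2 : (fun z : Fin q × Vec d × ℝ => ({z : (Fin (n + 1) → Vec d × ℝ) × Vec d × ℝ |
        z.1 ∈ B' ∧ z.2.2 ∈ Ioc a b}).indicator (1 : (Fin (n + 1) → Vec d × ℝ) × Vec d × ℝ → ℝ) (X.obsHist n ω, z.2))
        = ({z | z.2.2 ∈ Ioc a b}).indicator 1 := by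
      classical
      ext z
      simp [indicator_apply, hω]
    rw [e2, integral_indicator_one (ObservedModel.measurableSet_time measurableSet_Ioc)]
    have := ObservedModel.oneStepLaw_time_le hC hrate (hmem (X.obsHist n ω)) ha hab hi
    simpa [hω] using this
  · simp [hω]

/-- The dynamic programming identity: given an observed event, the expectation of `J(v, g)(Π_n, u)`
is that of `∑_i g(Φ(x_i, u)) Π_n^i 1_{u < t*_i} 1_{S_{n+1} > u} + v(Π_{n+1}) 1_{S_{n+1} ≤ u}`. -/
theorem setIntegral_J {v : (Fin q → ℝ) → ℝ} {K C : ℝ} (hv : LipOnSimplex v K)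
    (hb : BddOnSimplex v C) {g : Vec d → ℝ} (hg : ∀ y ∈ closure M.E, |g y| ≤ C)
    (n : ℕ) {B : Set Ω} (hB : MeasurableSet[X.observed n] B) {u : ℝ} (hu : 0 ≤ u) :
    ∫ ω in B, M.J v g (X.filter n ω) u ∂P
      = ∫ ω in B, (if X.S (n + 1) ω ≤ u then v (X.filter (n + 1) ω)
          else M.flowReward g (X.filter n ω) u) ∂P := by
  obtain ⟨F, hF, hmem, hFX⟩ := X.exists_filter_eq n
  have hrec := X.filter_succ_ae_eq hC hrate n hF hmem hFX
  have := ObservedModel.isProbabilityMeasure_transLaw hC hrate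
  obtain ⟨B', hB', rfl⟩ := hB
  have hθ := X.measurable_obsHist n
  have hBm : MeasurableSet (X.obsHist n ⁻¹' B') := hθ hB'
  have hC0 : 0 ≤ C := ObservedModel.bound_nonneg hg
  -- The realised reward as a function of the history and the next observation only, with both
  -- filters replaced by their explicit versions.
  let f : (Fin (n + 1) → Vec d × ℝ) × Vec d × ℝ → ℝ := fun z =>
    (Prod.fst ⁻¹' B').indicator (fun z : (Fin (n + 1) → Vec d × ℝ) × Vec d × ℝ =>
      if z.2.2 ≤ u then v (bayes M.transLaw (F z.1) z.2) else M.flowReward g (F z.1) u) z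
  have hflow : Measurable fun π : Fin q → ℝ => M.flowReward g π u := by
    refine Finset.measurable_sum _ fun i _ => ?_
    split_ifs
    · exact (measurable_pi_apply i).const_mul _
    · exact measurable_const
  have hf : Measurable f := by
    refine Measurable.indicator ?_ (measurable_fst hB')
    refine Measurable.ite ((measurable_snd.comp measurable_snd) measurableSet_Iic) ?_ ?_
    · exact hv.measurable_comp ((measurable_bayes M.transLaw).comp
        ((hF.comp measurable_fst).prodMk measurable_snd)) fun z => bayes_mem _ _ _
    · exact hflow.comp (hF.comp measurable_fst)
  have hfb : ∀ z, |f z| ≤ C := by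
    intro z
    by_cases hz : z.1 ∈ B'
    · simp only [f, indicator_of_mem (show z ∈ Prod.fst ⁻¹' B' from hz)]
      split_ifs
      · exact hb _ (bayes_mem _ _ _)
      · exact ObservedModel.abs_flowReward_le hg (hmem _) hu
    · simp only [f, indicator_of_notMem (show z ∉ Prod.fst ⁻¹' B' from hz), abs_zero]
      exact hC0
  have h := X.integral_obsHist_next hC hrate n hF hmem hFX hf hfb
  have lhs : ∫ ω, f (X.obsHist n ω, X.Y (n + 1) ω, X.S (n + 1) ω) ∂P
      = ∫ ω in X.obsHist n ⁻¹' B', (if X.S (n + 1) ω ≤ u then v (X.filter (n + 1) ω)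
          else M.flowReward g (X.filter n ω) u) ∂P := by
    rw [← integral_indicator hBm]
    refine integral_congr_ae ?_
    filter_upwards [hFX, hrec] with ω h1 h2
    by_cases hω : X.obsHist n ω ∈ B'
    · simp [f, hω, h1, h2]
    · simp [f, hω]
  have rhs : ∫ ω, ∫ z, f (X.obsHist n ω, z.2) ∂(M.oneStepLaw (F (X.obsHist n ω))) ∂P
      = ∫ ω in X.obsHist n ⁻¹' B', M.J v g (X.filter n ω) u ∂P := by
    rw [← integral_indicator hBm]
    refine integral_congr_ae ?_
    filter_upwards [hFX] with ω h1
    by_cases hω : X.obsHist n ω ∈ B'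
    · rw [indicator_of_mem (show ω ∈ X.obsHist n ⁻¹' B' from hω), h1]
      set π := F (X.obsHist n ω)
      have hπ : π ∈ stdSimplex ℝ (Fin q) := hmem _
      have := ObservedModel.isProbabilityMeasure_oneStepLaw hC hrate hπ
      have e : (fun z : Fin q × Vec d × ℝ => f (X.obsHist n ω, z.2))
          = fun z => ({z : Fin q × Vec d × ℝ | u < z.2.2}).indicator
              (fun _ => M.flowReward g π u) z
            + ({o : Vec d × ℝ | o.2 ∈ Iic u}).indicator
              (fun o => v (bayes M.transLaw π o)) z.2 := by
        ext z
        by_cases hz : z.2.2 ≤ u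
        · simp [f, hω, hz, π, not_lt.2 hz]
        · simp [f, hω, hz, π, not_le.1 hz]
      rw [e, ObservedModel.J, ObservedModel.H, ObservedModel.G_eq hC hrate hπ]
      refine integral_add ?_ ?_
      · exact (integrable_const _).indicator
          (ObservedModel.measurableSet_time (measurableSet_Ioi (a := u)))
      · exact ObservedModel.integrable_bayes_indicator hC hrate hv hb hπ measurableSet_Iic
    · simp [f, hω]
  exact rhs.symm.trans (h.symm.trans lhs)

end Rate

end ObservedProcess

end

end PODP

/-! ### Conditioning on the quantized filter -/

namespace PODP

noncomputable section

namespace ObservedProcess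

variable {d q : ℕ} {M : ObservedModel d q} {Ω : Type*} [MeasurableSpace Ω] {P : Measure Ω}
  (X : ObservedProcess M P)

section Quantizer

variable {nrm : (Fin q → ℝ) × ℝ → ℝ} (K : Quantizer q nrm)

theorem measurable_filter_observed (n : ℕ) : Measurable[X.observed n] (X.filter n) :=
  @measurable_pi_lambda _ _ _ (X.observed n) _ _ fun _ => stronglyMeasurable_condExp.measurable

theorem measurable_S_observed (n : ℕ) : Measurable[X.observed n] (X.S n) :=
  Measurable.comp (g := fun θ : Fin (n + 1) → Vec d × ℝ => (θ (Fin.last n)).2) (by fun_prop)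
    (comap_measurable (fun ω (k : Fin (n + 1)) => (X.Y k ω, X.S k ω)))

theorem measurable_proj_observed (n : ℕ) :
    Measurable[X.observed n] fun ω => K.proj n (X.filter n ω, X.S n ω) :=
  (K.measurable_proj n).comp
    (Measurable.prodMk (X.measurable_filter_observed n) (X.measurable_S_observed n))

/-- Measurability with respect to the observations makes each event fixing the value of `Π̂_n` an
observed event, to which `setIntegral_J` applies. -/
theorem measurable_filterHat_observed (n : ℕ) : Measurable[X.observed n] (X.filterHat K n) :=
  measurable_fst.comp (X.measurable_proj_observed K n)

theorem measurable_filter (n : ℕ) : Measurable (X.filter n) :=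
  (X.measurable_filter_observed n).mono (X.observed_le n) le_rfl

theorem measurable_filterHat (n : ℕ) : Measurable (X.filterHat K n) :=
  (X.measurable_filterHat_observed K n).mono (X.observed_le n) le_rfl

theorem measurable_SHat (n : ℕ) : Measurable (X.SHat K n) :=
  (measurable_snd.comp (X.measurable_proj_observed K n)).mono (X.observed_le n) le_rfl

theorem filterHat_mem (n : ℕ) (ω : Ω) : X.filterHat K n ω ∈ stdSimplex ℝ (Fin q) :=
  (K.Γ_subset n (K.proj_mem n _)).1

/-- The finite set of values of the quantized filter. -/
def filterGrid (n : ℕ) : Finset (Fin q → ℝ) := by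
  classical exact (K.Γ n).image Prod.fst

theorem filterHat_mem_grid (n : ℕ) (ω : Ω) : X.filterHat K n ω ∈ filterGrid K n := by
  classical
  exact Finset.mem_image_of_mem Prod.fst (K.proj_mem n _)

theorem measurableSet_filterHat_eq (n : ℕ) (π : Fin q → ℝ) :
    MeasurableSet {ω | X.filterHat K n ω = π} :=
  X.measurable_filterHat K n (measurableSet_singleton π)

theorem comp_filterHat_eq_sum (n : ℕ) (v : (Fin q → ℝ) → ℝ) (ω : Ω) :
    v (X.filterHat K n ω)
      = ∑ π ∈ filterGrid K n, ({ω | X.filterHat K n ω = π}).indicator (fun _ => v π) ω := by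
  classical
  rw [Finset.sum_eq_single (X.filterHat K n ω)]
  · simp
  · intro π _ hπ
    exact indicator_of_notMem (fun h => hπ h.symm) _
  · exact fun h => absurd (X.filterHat_mem_grid K n ω) h

/-- Since `Π̂_n` takes finitely many values, `v` may be arbitrary. Thus no regularity of the
functions `v̂_n` ever has to be shown. -/
theorem measurable_comp_filterHat (n : ℕ) (v : (Fin q → ℝ) → ℝ) :
    Measurable fun ω => v (X.filterHat K n ω) := by
  simp_rw [X.comp_filterHat_eq_sum K n v]
  exact Finset.measurable_sum _ fun π _ =>
    measurable_const.indicator (X.measurableSet_filterHat_eq K n π)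

theorem exists_bound_comp_filterHat (n : ℕ) (v : (Fin q → ℝ) → ℝ) :
    ∃ C, ∀ ω, |v (X.filterHat K n ω)| ≤ C :=
  ⟨∑ π ∈ filterGrid K n, |v π|, fun ω =>
    Finset.single_le_sum (f := fun π => |v π|) (fun _ _ => abs_nonneg _)
      (X.filterHat_mem_grid K n ω)⟩

theorem exists_bound_SHat (n : ℕ) : ∃ C, ∀ ω, |X.SHat K n ω| ≤ C :=
  ⟨∑ γ ∈ K.Γ n, |γ.2|, fun _ =>
    Finset.single_le_sum (f := fun γ : (Fin q → ℝ) × ℝ => |γ.2|) (fun _ _ => abs_nonneg _)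
      (K.proj_mem n _)⟩

end Quantizer

theorem integral_cond_eq (B : Set Ω) (f : Ω → ℝ) :
    ∫ ω, f ω ∂(ProbabilityTheory.cond P B) = (P.real B)⁻¹ * ∫ ω in B, f ω ∂P := by
  rw [ProbabilityTheory.cond, integral_smul_measure, ENNReal.toReal_inv, smul_eq_mul]
  rfl

variable [IsProbabilityMeasure P] [NeZero q]

theorem aestronglyMeasurable_comp_filter {v : (Fin q → ℝ) → ℝ} {K : ℝ} (hv : LipOnSimplex v K)
    (n : ℕ) : AEStronglyMeasurable (fun ω => v (X.filter n ω)) P := by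
  refine ⟨fun ω => v (toSimplex (X.filter n ω)),
    (hv.measurable_comp_toSimplex.comp (X.measurable_filter n)).stronglyMeasurable, ?_⟩
  filter_upwards [X.filter_ae_mem n] with ω hω
  rw [toSimplex_of_mem hω]

section Rate

variable {Clam : ℝ} (hC : 0 ≤ Clam) (hrate : ∀ y ∈ closure M.E, M.rate y ≤ Clam)
include hC hrate

variable {nrm : (Fin q → ℝ) × ℝ → ℝ} (Qz : Quantizer q nrm)

/-- Comparison of `J(v, g)` with its counterpart in which the next filter and the next jump time
are replaced by approximations, conditionally on the quantized filter. -/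
theorem abs_J_sub_cond_le {v : (Fin q → ℝ) → ℝ} {K C : ℝ} (hv : LipOnSimplex v K) (hK : 0 ≤ K)
    (hb : BddOnSimplex v C) {g : Vec d → ℝ} (hg : ∀ y ∈ closure M.E, |g y| ≤ C)
    (n : ℕ) {π : Fin q → ℝ} (hπ : π ∈ stdSimplex ℝ (Fin q))
    (hP : P {ω | X.filterHat Qz n ω = π} ≠ 0) {u : ℝ} (hu : 0 ≤ u)
    {w : Ω → ℝ} (hw : Measurable w) {Cw : ℝ} (hwb : ∀ ω, |w ω| ≤ Cw)
    {s : Ω → ℝ} (hs : Measurable s) :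
    |M.J v g π u - (M.flowReward g π u * X.condHat Qz n π ({ω | u < s ω}.indicator fun _ => 1)
        + X.condHat Qz n π ({ω | s ω ≤ u}.indicator w))|
      ≤ X.condHat Qz n π fun ω => (4 * C + 2 * K) * l1 (X.filter n ω - X.filterHat Qz n ω)
        + |v (X.filter (n + 1) ω) - w ω|
        + 2 * C * |({ω | X.S (n + 1) ω ≤ u}).indicator (fun _ => (1 : ℝ)) ω
          - ({ω | s ω ≤ u}).indicator (fun _ => (1 : ℝ)) ω| := by
  classical
  have hC0 : 0 ≤ C := ObservedModel.bound_nonneg hg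
  set B := {ω | X.filterHat Qz n ω = π} with hBdef
  have hBo : MeasurableSet[X.observed n] B :=
    X.measurable_filterHat_observed Qz n (measurableSet_singleton π)
  have hB : MeasurableSet B := X.observed_le n _ hBo
  set μ := ProbabilityTheory.cond P B with hμ
  have hμP : IsProbabilityMeasure μ := cond_isProbabilityMeasure hP
  have hac : μ ≪ P := cond_absolutelyContinuous
  have hmemB : ∀ᵐ ω ∂μ, X.filterHat Qz n ω = π := ae_cond_mem hB
  have hmem := hac.ae_le (X.filter_ae_mem n)
  have hmem' := hac.ae_le (X.filter_ae_mem (n + 1))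
  -- The coefficient `4 * C + 2 * K` is this constant plus the `C` needed to move the filter inside
  -- `flowReward`.
  have hJlip : LipOnSimplex (fun ρ => M.J v g ρ u) (2 * K + 3 * C) := fun ρ hρ ρ' hρ' =>
    ObservedModel.abs_J_sub_le hC hrate hv hK hb hg hρ hρ' hu
  have hFlip : LipOnSimplex (fun ρ => M.flowReward g ρ u) C := fun ρ _ ρ' _ =>
    ObservedModel.abs_flowReward_sub_le hg ρ ρ' hu
  have mJ := (X.aestronglyMeasurable_comp_filter hJlip n).mono_ac hac
  have mF := (X.aestronglyMeasurable_comp_filter hFlip n).mono_ac hac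
  have mV := (X.aestronglyMeasurable_comp_filter hv (n + 1)).mono_ac hac
  have hSm : MeasurableSet {ω | X.S (n + 1) ω ≤ u} := X.measurable_S (n + 1) measurableSet_Iic
  have hsm : MeasurableSet {ω | s ω ≤ u} := hs measurableSet_Iic
  have iJ : Integrable (fun ω => M.J v g (X.filter n ω) u) μ := by
    refine Integrable.of_bound mJ C ?_
    filter_upwards [hmem] with ω h
    exact ObservedModel.abs_J_le hC hrate hv hb hg h hu
  have iA : Integrable (fun ω => if X.S (n + 1) ω ≤ u then v (X.filter (n + 1) ω)
      else M.flowReward g (X.filter n ω) u) μ := by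
    refine Integrable.of_bound (AEStronglyMeasurable.piecewise hSm mV.restrict mF.restrict) C ?_
    filter_upwards [hmem, hmem'] with ω h h'
    rw [Real.norm_eq_abs]
    split_ifs
    · exact hb _ h'
    · exact ObservedModel.abs_flowReward_le hg h hu
  have iw : Integrable w μ := Integrable.of_bound hw.aestronglyMeasurable Cw
    (Filter.Eventually.of_forall hwb)
  have iB : Integrable (fun ω => if s ω ≤ u then w ω else M.flowReward g π u) μ := by
    refine Integrable.of_bound (Measurable.ite hsm hw measurable_const).aestronglyMeasurable
      (max Cw C) (Filter.Eventually.of_forall fun ω => ?_)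
    rw [Real.norm_eq_abs]
    split_ifs
    · exact (hwb ω).trans (le_max_left _ _)
    · exact (ObservedModel.abs_flowReward_le hg hπ hu).trans (le_max_right _ _)
  have e1 : M.flowReward g π u * X.condHat Qz n π ({ω | u < s ω}.indicator fun _ => 1)
        + X.condHat Qz n π ({ω | s ω ≤ u}.indicator w)
      = ∫ ω, (if s ω ≤ u then w ω else M.flowReward g π u) ∂μ := by
    rw [condHat, condHat, ← integral_const_mul, ← integral_add]
    · refine integral_congr_ae (Filter.Eventually.of_forall fun ω => ?_)
      by_cases h : s ω ≤ u
      · simp [h, not_lt.2 h]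
      · simp [h, not_le.1 h]
    · exact ((integrable_const (1 : ℝ)).indicator (hs measurableSet_Ioi)).const_mul _
    · exact iw.indicator hsm
  -- The dynamic programming identity on the atom holds for `Π_n`, not for `π`; therefore `J` is
  -- first moved from `π` to `Π_n`.
  have e2 : ∫ ω, M.J v g (X.filter n ω) u ∂μ
      = ∫ ω, (if X.S (n + 1) ω ≤ u then v (X.filter (n + 1) ω)
          else M.flowReward g (X.filter n ω) u) ∂μ := by
    rw [hμ, integral_cond_eq, integral_cond_eq, X.setIntegral_J hC hrate hv hb hg n hBo hu]
  have e3 : M.J v g π u = ∫ _, M.J v g π u ∂μ := by simp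
  have e4 : M.J v g π u - ∫ ω, (if s ω ≤ u then w ω else M.flowReward g π u) ∂μ
      = ∫ ω, (M.J v g π u - M.J v g (X.filter n ω) u)
        + ((if X.S (n + 1) ω ≤ u then v (X.filter (n + 1) ω)
          else M.flowReward g (X.filter n ω) u)
        - (if s ω ≤ u then w ω else M.flowReward g π u)) ∂μ := by
    have i1 : Integrable (fun ω => M.J v g π u - M.J v g (X.filter n ω) u) μ :=
      (integrable_const _).sub iJ
    have i2 : Integrable (fun ω => (if X.S (n + 1) ω ≤ u then v (X.filter (n + 1) ω)
        else M.flowReward g (X.filter n ω) u)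
        - (if s ω ≤ u then w ω else M.flowReward g π u)) μ := iA.sub iB
    rw [integral_add i1 i2, integral_sub (integrable_const _) iJ,
      integral_sub iA iB, ← e3, e2]
    ring
  rw [e1, e4]
  have il : Integrable (fun ω => l1 (X.filter n ω - X.filterHat Qz n ω)) μ := by
    refine Integrable.of_bound (measurable_l1.comp ((X.measurable_filter n).sub
      (X.measurable_filterHat Qz n))).aestronglyMeasurable 2 ?_
    filter_upwards [hmem] with ω h
    rw [Real.norm_of_nonneg (l1_nonneg _)]
    exact l1_sub_le_two h (X.filterHat_mem Qz n ω)
  have iV : Integrable (fun ω => v (X.filter (n + 1) ω)) μ := by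
    refine Integrable.of_bound mV C ?_
    filter_upwards [hmem'] with ω h
    exact hb _ h
  have id : Integrable (fun ω => ({ω | X.S (n + 1) ω ≤ u}).indicator (fun _ => (1 : ℝ)) ω
      - ({ω | s ω ≤ u}).indicator (fun _ => (1 : ℝ)) ω) μ :=
    ((integrable_const (1 : ℝ)).indicator hSm).sub ((integrable_const (1 : ℝ)).indicator hsm)
  refine abs_integral_le_integral_abs.trans (integral_mono_ae
    (((integrable_const _).sub iJ).add (iA.sub iB)).abs
    (((il.const_mul _).add (iV.sub iw).abs).add (id.abs.const_mul _)) ?_)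
  filter_upwards [hmem, hmem', hmemB] with ω h h' hω
  have h1 := hJlip π hπ _ h
  rw [l1_sub_comm] at h1
  have h2 := hFlip _ h π hπ
  have h3 := hb _ h'
  have h4 := ObservedModel.abs_flowReward_le hg h hu
  have h5 := ObservedModel.abs_flowReward_le hg hπ hu
  have hl := l1_nonneg (X.filter n ω - π)
  have hCl := mul_nonneg hC0 hl
  have hvw := abs_nonneg (v (X.filter (n + 1) ω) - w ω)
  rw [hω]
  refine (abs_add_le _ _).trans ?_
  -- If the indicators disagree, a value of `v` is compared with a flow reward; both are bounded by
  -- `C`, which explains the factor `2 * C`.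
  by_cases c1 : X.S (n + 1) ω ≤ u <;> by_cases c2 : s ω ≤ u
  · simp only [c1, c2, if_true, mem_ofPred_eq, indicator_of_mem, sub_self, abs_zero]
    linarith
  · simp only [c1, c2, if_true, if_false, mem_ofPred_eq, indicator_of_mem, indicator_of_notMem,
      not_false_eq_true, sub_zero, abs_one]
    have := abs_sub (v (X.filter (n + 1) ω)) (M.flowReward g π u)
    linarith
  · simp only [c1, c2, if_true, if_false, mem_ofPred_eq, indicator_of_mem, indicator_of_notMem,
      not_false_eq_true, zero_sub, abs_neg, abs_one]
    have e : M.flowReward g (X.filter n ω) u - w ω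
      = (M.flowReward g (X.filter n ω) u - v (X.filter (n + 1) ω))
        + (v (X.filter (n + 1) ω) - w ω) := by ring
    have := abs_sub (M.flowReward g (X.filter n ω) u) (v (X.filter (n + 1) ω))
    have := abs_add_le (M.flowReward g (X.filter n ω) u - v (X.filter (n + 1) ω))
      (v (X.filter (n + 1) ω) - w ω)
    rw [e]
    linarith
  · simp only [c1, c2, if_false, mem_ofPred_eq, indicator_of_notMem,
      not_false_eq_true, sub_self, abs_zero]
    linarith

/-- The probability that the jump time and its quantization are on different sides of a point of
the time grid. -/
theorem cond_disagree_le (n : ℕ) {π : Fin q → ℝ} (hP : P {ω | X.filterHat Qz n ω = π} ≠ 0)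
    {Δ : ℝ} (hΔ : M.IsStep Δ) {u η : ℝ} (hu : u ∈ M.grid Δ) (hη : 0 < η) (hηΔ : η < Δ) :
    X.condHat Qz n π (fun ω => |({ω | X.S (n + 1) ω ≤ u}).indicator (fun _ => (1 : ℝ)) ω
          - ({ω | X.SHat Qz (n + 1) ω ≤ u}).indicator (fun _ => (1 : ℝ)) ω|)
      ≤ X.condHat Qz n π (fun ω => |X.S (n + 1) ω - X.SHat Qz (n + 1) ω| / η + 2 * Clam * η) := by
  classical
  set B := {ω | X.filterHat Qz n ω = π} with hBdef
  have hBo : MeasurableSet[X.observed n] B :=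
    X.measurable_filterHat_observed Qz n (measurableSet_singleton π)
  set μ := ProbabilityTheory.cond P B with hμ
  have hμP : IsProbabilityMeasure μ := cond_isProbabilityMeasure hP
  have hac : μ ≪ P := cond_absolutelyContinuous
  have hPB : 0 < P.real B := by
    rw [Measure.real, ENNReal.toReal_pos_iff]
    exact ⟨pos_iff_ne_zero.2 hP, measure_lt_top _ _⟩
  have hSm : MeasurableSet {ω | X.S (n + 1) ω ≤ u} := X.measurable_S (n + 1) measurableSet_Iic
  have hsm : MeasurableSet {ω | X.SHat Qz (n + 1) ω ≤ u} :=
    X.measurable_SHat Qz (n + 1) measurableSet_Iic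
  have hA : MeasurableSet {ω | X.S (n + 1) ω ∈ Ioc (u - η) (u + η)} :=
    X.measurable_S (n + 1) measurableSet_Ioc
  have hμA : μ.real {ω | X.S (n + 1) ω ∈ Ioc (u - η) (u + η)} ≤ 2 * Clam * η := by
    have h := X.measureReal_time_le hC hrate n hBo (a := u - η) (b := u + η)
      (by have := ObservedModel.grid_pos hΔ hu; linarith) (by linarith)
      (ObservedModel.exit_notMem_of_mem_grid hΔ hu hηΔ)
    rw [hμ, Measure.real, cond_apply (X.observed_le n _ hBo), ENNReal.toReal_mul,
      ENNReal.toReal_inv]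
    change (P.real B)⁻¹ * P.real (B ∩ _) ≤ _
    rw [inv_mul_le_iff₀ hPB]
    linarith
  obtain ⟨Ch, hCh⟩ := X.exists_bound_SHat Qz (n + 1)
  have iS : Integrable (fun ω => X.S (n + 1) ω - X.SHat Qz (n + 1) ω) μ := by
    refine Integrable.of_bound ((X.measurable_S _).sub
      (X.measurable_SHat Qz _)).aestronglyMeasurable (M.lastExit + Ch) ?_
    filter_upwards [hac.ae_le (X.time_mem_ae hC hrate n)] with ω h
    refine (norm_sub_le _ _).trans (add_le_add ?_ (hCh ω))
    rw [Real.norm_of_nonneg h.1]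
    exact h.2
  have iA : Integrable (({ω | X.S (n + 1) ω ∈ Ioc (u - η) (u + η)}).indicator
      fun _ => (1 : ℝ)) μ := (integrable_const _).indicator hA
  have iD : Integrable (fun ω => |X.S (n + 1) ω - X.SHat Qz (n + 1) ω| / η) μ :=
    iS.abs.div_const η
  calc _ ≤ ∫ ω, |X.S (n + 1) ω - X.SHat Qz (n + 1) ω| / η
          + ({ω | X.S (n + 1) ω ∈ Ioc (u - η) (u + η)}).indicator (fun _ => (1 : ℝ)) ω ∂μ := by
        refine integral_mono ((((integrable_const (1 : ℝ)).indicator hSm).sub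
          ((integrable_const (1 : ℝ)).indicator hsm)).abs) (iD.add iA) fun ω => ?_
        change |_| ≤ _
        have h0 : 0 ≤ |X.S (n + 1) ω - X.SHat Qz (n + 1) ω| / η :=
          div_nonneg (abs_nonneg _) hη.le
        have h1 : (0 : ℝ) ≤ ({ω | X.S (n + 1) ω ∈ Ioc (u - η) (u + η)}).indicator
          (fun _ => (1 : ℝ)) ω := indicator_nonneg (fun _ _ => zero_le_one) ω
        -- A large time error makes its quotient by `η` at least `1`. With a small one, a
        -- disagreement forces the jump time into the window around `u`.
        by_cases hc : η < |X.S (n + 1) ω - X.SHat Qz (n + 1) ω|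
        · have h2 : 1 ≤ |X.S (n + 1) ω - X.SHat Qz (n + 1) ω| / η := by
            rw [le_div_iff₀ hη]; linarith
          have h3 : |({ω | X.S (n + 1) ω ≤ u}).indicator (fun _ => (1 : ℝ)) ω
              - ({ω | X.SHat Qz (n + 1) ω ≤ u}).indicator (fun _ => (1 : ℝ)) ω| ≤ 1 := by
            by_cases c1 : X.S (n + 1) ω ≤ u <;> by_cases c2 : X.SHat Qz (n + 1) ω ≤ u <;>
              simp [c1, c2]
          linarith
        · have hc' := abs_le.1 (not_lt.1 hc)
          by_cases c1 : X.S (n + 1) ω ≤ u <;> by_cases c2 : X.SHat Qz (n + 1) ω ≤ u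
          · simp only [mem_ofPred_eq, c1, c2, indicator_of_mem, sub_self, abs_zero]
            linarith
          · have : ω ∈ {ω | X.S (n + 1) ω ∈ Ioc (u - η) (u + η)} :=
              ⟨by linarith [not_le.1 c2], by linarith⟩
            rw [indicator_of_mem this]
            simp only [mem_ofPred_eq, c1, c2, indicator_of_mem, indicator_of_notMem,
              not_false_eq_true, sub_zero, abs_one]
            linarith
          · have : ω ∈ {ω | X.S (n + 1) ω ∈ Ioc (u - η) (u + η)} :=
              ⟨by linarith [not_le.1 c1], by linarith⟩
            rw [indicator_of_mem this]
            simp only [mem_ofPred_eq, c1, c2, indicator_of_mem, indicator_of_notMem,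
              not_false_eq_true, zero_sub, abs_neg, abs_one]
            linarith
          · simp only [mem_ofPred_eq, c1, c2, indicator_of_notMem,
              not_false_eq_true, sub_self, abs_zero]
            linarith
    _ ≤ _ := by
        rw [condHat, integral_add iD iA, integral_add iD (integrable_const _),
          integral_indicator hA, setIntegral_one_eq_measureReal, integral_const, probReal_univ,
          one_smul]
        gcongr

end Rate

end ObservedProcess

end

end PODP

/-! ### The `L^p` norm and contraction under conditioning -/

namespace PODP

noncomputable section

section Norm

variable {Ω : Type*} [MeasurableSpace Ω] {P : Measure Ω} {p : ℝ}

theorem normLp_nonneg (P : Measure Ω) (p : ℝ) (X : Ω → ℝ) : 0 ≤ normLp P p X :=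
  Real.rpow_nonneg (integral_nonneg fun _ => Real.rpow_nonneg (abs_nonneg _) _) _

/-- Gives access to Minkowski's inequality. `MemLp` matters here, as the integral inside `normLp` is
`0` by convention when it diverges. -/
theorem normLp_eq_toReal_eLpNorm (hp : 1 ≤ p) {X : Ω → ℝ} (hX : MemLp X (ENNReal.ofReal p) P) :
    normLp P p X = (eLpNorm X (ENNReal.ofReal p) P).toReal := by
  have hp0 : 0 < p := by linarith
  rw [hX.eLpNorm_eq_integral_rpow_norm (by simpa using hp0) ENNReal.ofReal_ne_top,
    ENNReal.toReal_ofReal hp0.le, ENNReal.toReal_ofReal, normLp, one_div]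
  · rfl
  · exact Real.rpow_nonneg (integral_nonneg fun _ => Real.rpow_nonneg (norm_nonneg _) _) _

theorem normLp_add_le (hp : 1 ≤ p) {X Y : Ω → ℝ} (hX : MemLp X (ENNReal.ofReal p) P)
    (hY : MemLp Y (ENNReal.ofReal p) P) :
    normLp P p (fun ω => X ω + Y ω) ≤ normLp P p X + normLp P p Y := by
  have e : normLp P p (fun ω => X ω + Y ω) = _ := normLp_eq_toReal_eLpNorm hp (hX.add hY)
  rw [e, normLp_eq_toReal_eLpNorm hp hX, normLp_eq_toReal_eLpNorm hp hY, ← ENNReal.toReal_add hX.2.ne hY.2.ne]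
  exact ENNReal.toReal_mono (ENNReal.add_ne_top.2 ⟨hX.2.ne, hY.2.ne⟩)
    (eLpNorm_add_le hX.1 hY.1 (by simpa using hp))

theorem normLp_mono (hp : 1 ≤ p) {X Y : Ω → ℝ} (hX : MemLp X (ENNReal.ofReal p) P)
    (hY : MemLp Y (ENNReal.ofReal p) P) (h : ∀ᵐ ω ∂P, |X ω| ≤ Y ω) :
    normLp P p X ≤ normLp P p Y := by
  rw [normLp_eq_toReal_eLpNorm hp hX, normLp_eq_toReal_eLpNorm hp hY]
  exact ENNReal.toReal_mono hY.2.ne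
    (eLpNorm_mono_ae (h.mono fun ω hω => hω.trans (le_abs_self _)))

theorem normLp_const_mul (hp : 1 ≤ p) {c : ℝ} (hc : 0 ≤ c) (X : Ω → ℝ) :
    normLp P p (fun ω => c * X ω) = c * normLp P p X := by
  have hp0 : p ≠ 0 := by linarith
  simp_rw [normLp, abs_mul, abs_of_nonneg hc, Real.mul_rpow hc (abs_nonneg _)]
  rw [integral_const_mul, Real.mul_rpow (Real.rpow_nonneg hc _)
    (integral_nonneg fun _ => Real.rpow_nonneg (abs_nonneg _) _), ← Real.rpow_mul hc,
    mul_one_div_cancel hp0, Real.rpow_one]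

theorem normLp_abs (X : Ω → ℝ) : normLp P p (fun ω => |X ω|) = normLp P p X := by
  simp [normLp]

theorem normLp_const [IsProbabilityMeasure P] (hp : 1 ≤ p) (c : ℝ) :
    normLp P p (fun _ : Ω => c) = |c| := by
  have hp0 : p ≠ 0 := by linarith
  rw [normLp, integral_const, probReal_univ, one_smul, ← Real.rpow_mul (abs_nonneg _),
    mul_one_div_cancel hp0, Real.rpow_one]

theorem abs_integral_rpow_le [IsProbabilityMeasure P] (hp : 1 ≤ p) {f : Ω → ℝ}
    (hf : MemLp f (ENNReal.ofReal p) P) :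
    |∫ ω, f ω ∂P| ^ p ≤ ∫ ω, |f ω| ^ p ∂P := by
  have hp0 : 0 ≤ p := by linarith
  have h1 : Integrable (fun ω => |f ω|) P := (hf.integrable (by simpa using hp)).abs
  have h2 : Integrable (fun ω => |f ω| ^ p) P := by
    have := hf.integrable_norm_rpow (by simpa using (by linarith : 0 < p)) ENNReal.ofReal_ne_top
    rwa [ENNReal.toReal_ofReal hp0] at this
  refine (Real.rpow_le_rpow (abs_nonneg _) abs_integral_le_integral_abs hp0).trans ?_
  exact (convexOn_rpow hp).map_integral_le (continuousOn_id.rpow_const fun _ _ => Or.inr hp0)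
    isClosed_Ici (Filter.Eventually.of_forall fun ω => mem_Ici.2 (abs_nonneg (f ω))) h1 h2

end Norm

namespace ObservedProcess

variable {d q : ℕ} {M : ObservedModel d q} {Ω : Type*} [MeasurableSpace Ω] {P : Measure Ω}
  (X : ObservedProcess M P) [IsProbabilityMeasure P]
  {nrm : (Fin q → ℝ) × ℝ → ℝ} (Qz : Quantizer q nrm)

/-- The tower property, summed over finitely many atoms. A null atom contributes nothing to either
side. -/
theorem integral_condHat (n : ℕ) {f : Ω → ℝ} (hf : Integrable f P) :
    ∫ ω, X.condHat Qz n (X.filterHat Qz n ω) f ∂P = ∫ ω, f ω ∂P := by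
  classical
  simp_rw [X.comp_filterHat_eq_sum Qz n fun π => X.condHat Qz n π f]
  have hB := X.measurableSet_filterHat_eq Qz n
  have e : ∀ ω, f ω = ∑ π ∈ filterGrid Qz n, ({ω | X.filterHat Qz n ω = π}).indicator f ω := by
    intro ω
    rw [Finset.sum_eq_single (X.filterHat Qz n ω)]
    · simp
    · exact fun π _ hπ => indicator_of_notMem (fun h => hπ h.symm) _
    · exact fun h => absurd (X.filterHat_mem_grid Qz n ω) h
  conv_rhs => rw [integral_congr_ae (Filter.Eventually.of_forall e)]
  rw [integral_finsetSum _ fun π _ => (integrable_const _).indicator (hB π),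
    integral_finsetSum _ fun π _ => hf.indicator (hB π)]
  refine Finset.sum_congr rfl fun π _ => ?_
  rw [integral_indicator (hB π), integral_indicator (hB π), setIntegral_const, condHat,
    integral_cond_eq, smul_eq_mul]
  by_cases h0 : P.real {ω | X.filterHat Qz n ω = π} = 0
  · rw [h0, zero_mul, Measure.restrict_eq_zero.2, integral_zero_measure]
    exact (measureReal_eq_zero_iff).1 h0
  · rw [← mul_assoc, mul_inv_cancel₀ h0, one_mul]

theorem memLp_comp_filterHat (n : ℕ) (v : (Fin q → ℝ) → ℝ) (r : ENNReal) :
    MemLp (fun ω => v (X.filterHat Qz n ω)) r P := by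
  obtain ⟨C, hC⟩ := X.exists_bound_comp_filterHat Qz n v
  exact MemLp.of_bound (X.measurable_comp_filterHat Qz n v).aestronglyMeasurable C
    (Filter.Eventually.of_forall hC)

/-- Elementary conditioning on the quantized filter is a contraction in `L^p`. -/
theorem normLp_condHat_le {p : ℝ} (hp : 1 ≤ p) (n : ℕ) {f : Ω → ℝ}
    (hf : MemLp f (ENNReal.ofReal p) P) :
    normLp P p (fun ω => X.condHat Qz n (X.filterHat Qz n ω) f) ≤ normLp P p f := by
  have hp0 : 0 < p := by linarith
  have hfp : Integrable (fun ω => |f ω| ^ p) P := by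
    have := hf.integrable_norm_rpow (by simpa using hp0) ENNReal.ofReal_ne_top
    rwa [ENNReal.toReal_ofReal hp0.le] at this
  refine Real.rpow_le_rpow (integral_nonneg fun _ => Real.rpow_nonneg (abs_nonneg _) _) ?_
    (by positivity)
  rw [← X.integral_condHat Qz n hfp]
  refine integral_mono
    ((X.memLp_comp_filterHat Qz n (fun π => |X.condHat Qz n π f| ^ p) 1).integrable le_rfl)
    ((X.memLp_comp_filterHat Qz n (fun π => X.condHat Qz n π fun ω => |f ω| ^ p) 1).integrable
      le_rfl) fun ω => ?_
  change |X.condHat Qz n _ f| ^ p ≤ X.condHat Qz n _ fun ω => |f ω| ^ p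
  -- On null atoms the conditioned measure is zero and both sides vanish; elsewhere it is a
  -- probability and Jensen's inequality applies.
  by_cases h0 : P {ω' | X.filterHat Qz n ω' = X.filterHat Qz n ω} = 0
  · simp [condHat, cond_eq_zero_of_meas_eq_zero h0, Real.zero_rpow hp0.ne']
  · have := cond_isProbabilityMeasure h0
    refine abs_integral_rpow_le hp ?_
    rw [ProbabilityTheory.cond]
    exact hf.restrict _ |>.smul_measure (by simpa using h0)

end ObservedProcess

end

end PODP

/-! ### One step of the quantized dynamic programming operator -/

namespace PODP

noncomputable section

namespace ObservedProcess

variable {d q : ℕ} {M : ObservedModel d q} {Ω : Type*} [MeasurableSpace Ω] {P : Measure Ω}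
  (X : ObservedProcess M P) [IsProbabilityMeasure P]
  {nrm : (Fin q → ℝ) × ℝ → ℝ} (Qz : Quantizer q nrm)

omit [IsProbabilityMeasure P] in
theorem integrable_cond {f : Ω → ℝ} (hf : Integrable f P) (B : Set Ω) :
    Integrable f (ProbabilityTheory.cond P B) := by
  by_cases h0 : P B = 0
  · rw [cond_eq_zero_of_meas_eq_zero h0]
    exact integrable_zero_measure
  · exact hf.restrict.smul_measure (by simpa using h0)

theorem memLp_l1_sub (n : ℕ) (r : ENNReal) :
    MemLp (fun ω => l1 (X.filter n ω - X.filterHat Qz n ω)) r P := by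
  refine MemLp.of_bound (measurable_l1.comp ((X.measurable_filter n).sub
    (X.measurable_filterHat Qz n))).aestronglyMeasurable 2 ?_
  filter_upwards [X.filter_ae_mem n] with ω h
  rw [Real.norm_of_nonneg (l1_nonneg _)]
  exact l1_sub_le_two h (X.filterHat_mem Qz n ω)

omit [IsProbabilityMeasure P] in
theorem ae_measure_filterHat_eq_ne_zero (n : ℕ) :
    ∀ᵐ ω ∂P, P {ω' | X.filterHat Qz n ω' = X.filterHat Qz n ω} ≠ 0 := by
  have h : ∀ π ∈ filterGrid Qz n, ∀ᵐ ω ∂P, X.filterHat Qz n ω = π →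
      P {ω' | X.filterHat Qz n ω' = π} ≠ 0 := by
    intro π _
    by_cases h0 : P {ω' | X.filterHat Qz n ω' = π} = 0
    · have : ∀ᵐ ω ∂P, ¬ X.filterHat Qz n ω = π := by
        rw [ae_iff]; simpa using h0
      exact this.mono fun ω h1 h2 => absurd h2 h1
    · exact Filter.Eventually.of_forall fun _ _ => h0
  have h' := (Filter.eventually_all_finset _).2 h
  filter_upwards [h'] with ω hω
  exact hω _ (X.filterHat_mem_grid Qz n ω) rfl

theorem memLp_comp_filter [NeZero q] {v : (Fin q → ℝ) → ℝ} {K C : ℝ} (hv : LipOnSimplex v K)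
    (hb : BddOnSimplex v C) (n : ℕ) (r : ENNReal) : MemLp (fun ω => v (X.filter n ω)) r P :=
  MemLp.of_bound (X.aestronglyMeasurable_comp_filter hv n) C
    ((X.filter_ae_mem n).mono fun _ h => hb _ h)

section Rate

variable {Clam : ℝ} (hC : 0 ≤ Clam) (hrate : ∀ y ∈ closure M.E, M.rate y ≤ Clam)
include hC hrate

theorem memLp_time_sub (n : ℕ) (r : ENNReal) :
    MemLp (fun ω => X.S (n + 1) ω - X.SHat Qz (n + 1) ω) r P := by
  obtain ⟨Ch, hCh⟩ := X.exists_bound_SHat Qz (n + 1)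
  refine MemLp.of_bound ((X.measurable_S _).sub
    (X.measurable_SHat Qz _)).aestronglyMeasurable (M.lastExit + Ch) ?_
  filter_upwards [X.time_mem_ae hC hrate n] with ω h
  refine (norm_sub_le _ _).trans (add_le_add ?_ (hCh ω))
  rw [Real.norm_of_nonneg h.1]
  exact h.2

variable [NeZero q] {v : (Fin q → ℝ) → ℝ} {K C : ℝ} (hv : LipOnSimplex v K) (hK : 0 ≤ K)
  (hb : BddOnSimplex v C) {g : Vec d → ℝ} (hg : ∀ y ∈ closure M.E, |g y| ≤ C)
  {g2 : ℝ} (hg2 : 0 ≤ g2)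
  (hg_lip : ∀ i, ∀ t ∈ Set.Icc 0 (M.exit i), ∀ u ∈ Set.Icc 0 (M.exit i),
    |g (M.flow (M.x i) t) - g (M.flow (M.x i) u)| ≤ g2 * |t - u|)
  {Δ : ℝ} (hΔ : M.IsStep Δ) {η : ℝ} (hη : 0 < η) (hηΔ : η < Δ)
  (n : ℕ) (w : (Fin q → ℝ) → ℝ)
include hv hK hb hg hg2 hg_lip hΔ hη hηΔ

/-- Comparison of the dynamic programming operator with its quantized and discretized counterpart
at a value of the quantized filter. -/
theorem abs_L_sub_LHat_le {π : Fin q → ℝ} (hπ : π ∈ stdSimplex ℝ (Fin q))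
    (hP : P {ω | X.filterHat Qz n ω = π} ≠ 0) :
    |M.L v g π - X.LHat Qz Δ n w g π| ≤ (g2 + 2 * C * Clam) * Δ
      + X.condHat Qz n π fun ω => (4 * C + 2 * K) * l1 (X.filter n ω - X.filterHat Qz n ω)
        + |v (X.filter (n + 1) ω) - w (X.filterHat Qz (n + 1) ω)|
        + 2 * C * (|X.S (n + 1) ω - X.SHat Qz (n + 1) ω| / η + 2 * Clam * η) := by
  have hC0 : 0 ≤ C := ObservedModel.bound_nonneg hg
  set B := {ω | X.filterHat Qz n ω = π} with hB
  have hμP : IsProbabilityMeasure (ProbabilityTheory.cond P B) := cond_isProbabilityMeasure hP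
  have hac : ProbabilityTheory.cond P B ≪ P := cond_absolutelyContinuous
  obtain ⟨Cw, hCw⟩ := X.exists_bound_comp_filterHat Qz (n + 1) w
  have mw := X.measurable_comp_filterHat Qz (n + 1) w
  have i1 : Integrable (fun ω => (4 * C + 2 * K) * l1 (X.filter n ω - X.filterHat Qz n ω)
      + |v (X.filter (n + 1) ω) - w (X.filterHat Qz (n + 1) ω)|) (ProbabilityTheory.cond P B) :=
    integrable_cond
      ((((X.memLp_l1_sub Qz n 1).integrable le_rfl).const_mul _).add
      (((X.memLp_comp_filter hv hb (n + 1) 1).sub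
        (X.memLp_comp_filterHat Qz (n + 1) w 1)).integrable le_rfl).abs) B
  have i2 : Integrable (fun ω => |X.S (n + 1) ω - X.SHat Qz (n + 1) ω| / η + 2 * Clam * η)
      (ProbabilityTheory.cond P B) :=
    integrable_cond (((((X.memLp_time_sub Qz hC hrate n 1).integrable le_rfl).abs).div_const η).add
      (integrable_const _)) B
  have idis : ∀ {s : Ω → ℝ}, Measurable s → ∀ u : ℝ, Integrable (fun ω =>
      |({ω | X.S (n + 1) ω ≤ u}).indicator (fun _ => (1 : ℝ)) ω
        - ({ω | s ω ≤ u}).indicator (fun _ => (1 : ℝ)) ω|) (ProbabilityTheory.cond P B) :=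
    fun hs u => (((integrable_const (1 : ℝ)).indicator (X.measurable_S (n + 1)
      measurableSet_Iic)).sub ((integrable_const (1 : ℝ)).indicator (hs measurableSet_Iic))).abs
  set r := X.condHat Qz n π fun ω =>
      (4 * C + 2 * K) * l1 (X.filter n ω - X.filterHat Qz n ω)
        + |v (X.filter (n + 1) ω) - w (X.filterHat Qz (n + 1) ω)|
        + 2 * C * (|X.S (n + 1) ω - X.SHat Qz (n + 1) ω| / η + 2 * Clam * η) with hr
  have hr' : r = X.condHat Qz n π (fun ω =>
      (4 * C + 2 * K) * l1 (X.filter n ω - X.filterHat Qz n ω)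
        + |v (X.filter (n + 1) ω) - w (X.filterHat Qz (n + 1) ω)|)
      + 2 * C * X.condHat Qz n π fun ω =>
        |X.S (n + 1) ω - X.SHat Qz (n + 1) ω| / η + 2 * Clam * η := by
    rw [hr, condHat, condHat, condHat, ← integral_const_mul, ← integral_add i1 (i2.const_mul _)]
  -- The surrogate jump time `s` is left free so that one estimate covers both members of the
  -- maximum: `Ŝ` on the grid and the constant `0` for `KHat`.
  have key : ∀ {s : Ω → ℝ}, Measurable s → ∀ u : ℝ, 0 ≤ u →
      X.condHat Qz n π (fun ω => |({ω | X.S (n + 1) ω ≤ u}).indicator (fun _ => (1 : ℝ)) ω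
          - ({ω | s ω ≤ u}).indicator (fun _ => (1 : ℝ)) ω|)
        ≤ X.condHat Qz n π (fun ω =>
          |X.S (n + 1) ω - X.SHat Qz (n + 1) ω| / η + 2 * Clam * η) →
      |M.J v g π u - (M.flowReward g π u * X.condHat Qz n π ({ω | u < s ω}.indicator fun _ => 1)
        + X.condHat Qz n π ({ω | s ω ≤ u}.indicator
          fun ω => w (X.filterHat Qz (n + 1) ω)))| ≤ r := by
    intro s hs u hu hdis
    refine (X.abs_J_sub_cond_le hC hrate Qz hv hK hb hg n hπ hP hu mw hCw hs).trans ?_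
    rw [hr', condHat, integral_add i1 ((idis hs u).const_mul _), integral_const_mul]
    exact add_le_add le_rfl (mul_le_mul_of_nonneg_left hdis (by positivity))
  have hgrid : ∀ u ∈ M.grid Δ, |M.J v g π u - X.JHat Qz n w g π u| ≤ r := fun u hu =>
    key (X.measurable_SHat Qz (n + 1)) u (hΔ.1.le.trans (ObservedModel.grid_pos hΔ hu))
      (X.cond_disagree_le hC hrate Qz n hP hΔ hu hη hηΔ)
  have hlast : |M.J v g π M.lastExit - X.KHat Qz n w π| ≤ r := by
    -- With surrogate time `0` and `u = lastExit`, the quantized expression reduces to `KHat`. The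
    -- indicators agree almost surely, because the true jump has occurred by `lastExit`.
    have h := key (measurable_const (a := (0 : ℝ))) M.lastExit ObservedModel.lastExit_nonneg ?_
    · have e1 : ({_ω : Ω | M.lastExit < 0}).indicator (fun _ => (1 : ℝ)) = fun _ => 0 := by
        ext ω; simp [ObservedModel.lastExit_nonneg]
      have e2 : ({_ω : Ω | (0 : ℝ) ≤ M.lastExit}).indicator
          (fun ω => w (X.filterHat Qz (n + 1) ω)) = fun ω => w (X.filterHat Qz (n + 1) ω) := by
        ext ω; simp [ObservedModel.lastExit_nonneg]
      rw [e1, e2, condHat, integral_zero, mul_zero, zero_add] at h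
      exact h
    · have h0 : X.condHat Qz n π (fun ω =>
          |({ω | X.S (n + 1) ω ≤ M.lastExit}).indicator (fun _ => (1 : ℝ)) ω
            - ({_ω : Ω | (0 : ℝ) ≤ M.lastExit}).indicator (fun _ => (1 : ℝ)) ω|) = 0 := by
        refine integral_eq_zero_of_ae ?_
        filter_upwards [hac.ae_le (X.time_mem_ae hC hrate n)] with ω h
        simp [h.2, ObservedModel.lastExit_nonneg]
      rw [h0]
      exact integral_nonneg fun ω => by
        change 0 ≤ |X.S (n + 1) ω - X.SHat Qz (n + 1) ω| / η + 2 * Clam * η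
        positivity
  have hbd : BddAbove (M.J v g π '' M.grid Δ) := ⟨C, by
    rintro _ ⟨u, hu, rfl⟩
    exact (abs_le.1 (ObservedModel.abs_J_le hC hrate hv hb hg hπ
      (hΔ.1.le.trans (ObservedModel.grid_pos hΔ hu)))).2⟩
  have hbd' : BddAbove (X.JHat Qz n w g π '' M.grid Δ) := by
    obtain ⟨c, hc⟩ := hbd
    refine ⟨c + r, ?_⟩
    rintro _ ⟨u, hu, rfl⟩
    have := hc (mem_image_of_mem _ hu)
    have := (abs_le.1 (hgrid u hu)).1
    linarith
  have h1 := ObservedModel.abs_L_sub_grid_le hC hrate hv hb hg hg2 hg_lip hΔ hπ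
  have h2 := abs_max_sub_max_le_max (sSup (M.J v g π '' M.grid Δ)) (M.J v g π M.lastExit)
    (sSup (X.JHat Qz n w g π '' M.grid Δ)) (X.KHat Qz n w π)
  have h3 := h2.trans (max_le
    (abs_sSup_image_sub_le ObservedModel.grid_nonempty hbd hbd' hgrid) hlast)
  have h4 := abs_sub_le (M.L v g π)
    (max (sSup (M.J v g π '' M.grid Δ)) (M.J v g π M.lastExit)) (X.LHat Qz Δ n w g π)
  exact h4.trans (add_le_add h1 h3)

/-- The filter is moved to `Π̂_n` inside `M.L v g` at cost `K'`, then `abs_L_sub_LHat_le` is used at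
the value reached and norms are taken. The difference at step `n + 1` keeps coefficient one, because
`w` is compared with `v` only through these composed values. -/
theorem normLp_L_sub_LHat_le {p : ℝ} (hp : 1 ≤ p) {K' C' : ℝ} (hK' : 0 ≤ K')
    (hv' : LipOnSimplex (M.L v g) K') (hb' : BddOnSimplex (M.L v g) C') :
    normLp P p (fun ω => M.L v g (X.filter n ω) - X.LHat Qz Δ n w g (X.filterHat Qz n ω))
      ≤ normLp P p (fun ω => v (X.filter (n + 1) ω) - w (X.filterHat Qz (n + 1) ω))
        + (g2 + 2 * C * Clam) * Δ + 2 * C * (X.errS Qz p (n + 1) / η + 2 * Clam * η)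
        + (K' + 4 * C + 2 * K) * X.errFilter Qz p n := by
  have hC0 : 0 ≤ C := ObservedModel.bound_nonneg hg
  have hΔ0 := hΔ.1
  set r := ENNReal.ofReal p
  set a := (g2 + 2 * C * Clam) * Δ with ha
  have ha0 : 0 ≤ a := by positivity
  set l : Ω → ℝ := fun ω => l1 (X.filter n ω - X.filterHat Qz n ω) with hl
  set D : Ω → ℝ := fun ω => v (X.filter (n + 1) ω) - w (X.filterHat Qz (n + 1) ω) with hD
  set T : Ω → ℝ := fun ω => X.S (n + 1) ω - X.SHat Qz (n + 1) ω with hT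
  have ml : MemLp l r P := X.memLp_l1_sub Qz n r
  have mD : MemLp D r P := (X.memLp_comp_filter hv hb (n + 1) r).sub
    (X.memLp_comp_filterHat Qz (n + 1) w r)
  have mT : MemLp T r P := X.memLp_time_sub Qz hC hrate n r
  have mD' : MemLp (fun ω => |D ω|) r P := mD.abs
  have mc : ∀ c : ℝ, MemLp (fun _ : Ω => c) r P := fun c => memLp_const c
  have m1 : MemLp (fun ω => (4 * C + 2 * K) * l ω) r P := ml.const_mul _
  have m2 : MemLp (fun ω => (4 * C + 2 * K) * l ω + |D ω|) r P := m1.add mD'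
  have m3 : MemLp (fun ω => η⁻¹ * |T ω|) r P := mT.abs.const_mul _
  have m4 : MemLp (fun ω => η⁻¹ * |T ω| + 2 * Clam * η) r P := m3.add (mc _)
  have m5 : MemLp (fun ω => 2 * C * (η⁻¹ * |T ω| + 2 * Clam * η)) r P := m4.const_mul _
  set R : Ω → ℝ := fun ω => ((4 * C + 2 * K) * l ω + |D ω|)
    + 2 * C * (η⁻¹ * |T ω| + 2 * Clam * η) with hR
  have mR : MemLp R r P := m2.add m5
  set A : Ω → ℝ := fun ω => X.condHat Qz n (X.filterHat Qz n ω) R with hA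
  have mA : MemLp A r P := X.memLp_comp_filterHat Qz n (fun π => X.condHat Qz n π R) r
  have m6 : MemLp (fun ω => K' * l ω) r P := ml.const_mul _
  have m7 : MemLp (fun ω => a + A ω) r P := (mc a).add mA
  have m8 : MemLp (fun ω => K' * l ω + (a + A ω)) r P := m6.add m7
  have m9 : MemLp (fun ω => M.L v g (X.filter n ω)
      - X.LHat Qz Δ n w g (X.filterHat Qz n ω)) r P :=
    (X.memLp_comp_filter hv' hb' n r).sub (X.memLp_comp_filterHat Qz n _ r)
  have hRn : normLp P p R ≤ (4 * C + 2 * K) * normLp P p l + normLp P p D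
      + 2 * C * (η⁻¹ * normLp P p T + 2 * Clam * η) := by
    have b1 := normLp_add_le hp m2 m5
    have b2 := normLp_add_le hp m1 mD'
    have b3 := normLp_add_le hp m3 (mc (2 * Clam * η))
    rw [normLp_const_mul hp (by positivity), normLp_abs] at b2
    rw [normLp_const_mul hp (by positivity)] at b1
    rw [normLp_const_mul hp (by positivity), normLp_abs, normLp_const hp,
      abs_of_nonneg (by positivity)] at b3
    have b4 := mul_le_mul_of_nonneg_left b3 (by positivity : 0 ≤ 2 * C)
    linarith
  have hpt : ∀ᵐ ω ∂P, |M.L v g (X.filter n ω) - X.LHat Qz Δ n w g (X.filterHat Qz n ω)|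
      ≤ K' * l ω + (a + A ω) := by
    filter_upwards [X.filter_ae_mem n, X.ae_measure_filterHat_eq_ne_zero Qz n] with ω h hP
    have hm := X.filterHat_mem Qz n ω
    have h1 := hv' _ h _ hm
    have h2 := X.abs_L_sub_LHat_le Qz hC hrate hv hK hb hg hg2 hg_lip hΔ hη hηΔ n w hm hP
    have h3 := abs_sub_le (M.L v g (X.filter n ω)) (M.L v g (X.filterHat Qz n ω))
      (X.LHat Qz Δ n w g (X.filterHat Qz n ω))
    simp_rw [div_eq_inv_mul] at h2
    exact h3.trans (add_le_add h1 h2)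
  have c1 := normLp_mono hp m9 m8 hpt
  have c2 := normLp_add_le hp m6 m7
  have c3 := normLp_add_le hp (mc a) mA
  have c4 : normLp P p A ≤ normLp P p R := X.normLp_condHat_le Qz hp n mR
  rw [normLp_const_mul hp hK'] at c2
  rw [normLp_const hp, abs_of_nonneg ha0] at c3
  have e1 : normLp P p l = X.errFilter Qz p n := rfl
  have e2 : normLp P p T = X.errS Qz p (n + 1) := rfl
  rw [e1, e2] at hRn
  rw [e1] at c2
  rw [div_eq_inv_mul]
  linarith

end Rate

end ObservedProcess

end

end PODP

/-! ### Error propagation and convergence -/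

namespace PODP

noncomputable section

theorem ObservedModel.value_of_lt {d q : ℕ} (M : ObservedModel d q) (g : Vec d → ℝ) {N n : ℕ}
    (hn : n < N) : M.value g N n = M.L (M.value g N (n + 1)) g := by
  have h : N - n = N - (n + 1) + 1 := by omega
  rw [value, h]
  rfl

namespace ObservedProcess

variable {d q : ℕ} {M : ObservedModel d q} {Ω : Type*} [MeasurableSpace Ω] {P : Measure Ω}
  (X : ObservedProcess M P) {nrm : (Fin q → ℝ) × ℝ → ℝ} (Qz : Quantizer q nrm)

theorem valueHat_of_lt (Δ : ℝ) (g : Vec d → ℝ) {N n : ℕ} (hn : n < N) :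
    X.valueHat Qz Δ g N n = X.LHat Qz Δ n (X.valueHat Qz Δ g N (n + 1)) g := by
  have h : N - n = N - (n + 1) + 1 := by omega
  have h' : N - (N - (n + 1) + 1) = n := by omega
  rw [valueHat, h, valueHatRev, h']
  rfl

theorem observed_zero : X.observed 0 = ⊥ := by
  have e : (fun ω (k : Fin (0 + 1)) => (X.Y k ω, X.S k ω))
      = fun _ _ => (M.x M.start, (0 : ℝ)) := by
    ext ω k : 2
    obtain rfl : k = 0 := Fin.fin_one_eq_zero k
    exact Prod.ext rfl (X.S_zero ω)
  rw [observed, e, MeasurableSpace.comap_const]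

/-- The initial observation generates the trivial σ-algebra, over which the conditional expectation
is a constant for every `ω`. -/
theorem exists_V_sub_VHat_zero_eq_const [IsProbabilityMeasure P] (Δ : ℝ) (g : Vec d → ℝ)
    (N : ℕ) : ∃ c, ∀ ω, X.V g N 0 ω - X.VHat Qz Δ g N 0 ω = c := by
  have h : ∃ π, ∀ ω, X.filter 0 ω = π := by
    refine ⟨fun i => ∫ ω, ({ω | X.Z 0 ω = i}).indicator (fun _ => (1 : ℝ)) ω ∂P, fun ω => ?_⟩
    ext i
    rw [filter, observed_zero, condExp_bot]
  obtain ⟨π, hπ⟩ := h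
  exact ⟨M.value g N 0 π - X.valueHat Qz Δ g N 0 (Qz.proj 0 (π, 0)).1, fun ω => by
    rw [V, VHat, filterHat, hπ, X.S_zero]⟩

variable [IsProbabilityMeasure P] [NeZero q]
  {Clam : ℝ} (hC : 0 < Clam) (hrate : ∀ y ∈ closure M.E, M.rate y ≤ Clam)
  {g : Vec d → ℝ} {Cg : ℝ} (hg : ∀ y ∈ closure M.E, |g y| ≤ Cg) {N : ℕ}
include hC hrate hg

theorem memLp_V_sub_VHat (Δ : ℝ) (n : ℕ) (r : ENNReal) :
    MemLp (fun ω => X.V g N n ω - X.VHat Qz Δ g N n ω) r P := by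
  have h := ObservedModel.valueRev_bdd_lip hC.le hrate hg (N - n)
  exact (X.memLp_comp_filter h.2 h.1 n r).sub (X.memLp_comp_filterHat Qz n _ r)

/-- At the horizon both value functions coincide, so only the quantization of the filter
contributes. -/
theorem errV_last_le {p : ℝ} (hp : 1 ≤ p) (Δ : ℝ) :
    X.errV Qz Δ g p N N ≤ Cg * X.errFilter Qz p N := by
  have hCg := ObservedModel.bound_nonneg hg
  have h := (ObservedModel.valueRev_bdd_lip hC.le hrate hg 0).2
  rw [errV, errFilter, ← normLp_const_mul hp hCg]
  refine normLp_mono hp (X.memLp_V_sub_VHat Qz hC hrate hg Δ N _)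
    ((X.memLp_l1_sub Qz N _).const_mul _) ?_
  filter_upwards [X.filter_ae_mem N] with ω hω
  have := h _ hω _ (X.filterHat_mem Qz N ω)
  rw [V, VHat, ObservedModel.value, valueHat, Nat.sub_self]
  norm_num at this
  exact this

variable {g2 : ℝ} (hg2 : 0 ≤ g2)
  (hg_lip : ∀ i, ∀ t ∈ Set.Icc 0 (M.exit i), ∀ u ∈ Set.Icc 0 (M.exit i),
    |g (M.flow (M.x i) t) - g (M.flow (M.x i) u)| ≤ g2 * |t - u|)
  {Δ : ℝ} (hΔ : M.IsStep Δ) {p : ℝ} (hp : 1 ≤ p)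
include hg2 hg_lip hΔ hp

theorem errV_le_of_lt_step {n : ℕ} (hn : n < N) {η : ℝ} (hη : 0 < η) (hηΔ : η < Δ) :
    X.errV Qz Δ g p N n ≤ X.errV Qz Δ g p N (n + 1) + (g2 + 2 * Cg * Clam) * Δ
      + 2 * Cg * (X.errS Qz p (n + 1) / η + 2 * Clam * η)
      + (lipConst (M.value g N n) + 4 * Cg + 2 * lipConst (M.value g N (n + 1)))
        * X.errFilter Qz p n := by
  have h := ObservedModel.valueRev_bdd_lip hC.le hrate hg (N - n)
  have h' := ObservedModel.valueRev_bdd_lip hC.le hrate hg (N - (n + 1))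
  have hl := h.2.lipConst
  have hb := h.1
  change LipOnSimplex (M.value g N n) (lipConst (M.value g N n)) at hl
  change BddOnSimplex (M.value g N n) Cg at hb
  rw [ObservedModel.value_of_lt M g hn] at hl hb
  have := X.normLp_L_sub_LHat_le Qz hC.le hrate h'.2.lipConst (lipConst_nonneg _) h'.1 hg hg2
    hg_lip hΔ hη hηΔ n (X.valueHat Qz Δ g N (n + 1)) hp (lipConst_nonneg _) hl hb
  simp only [errV, V, VHat, X.valueHat_of_lt Qz Δ g hn, ObservedModel.value_of_lt M g hn]
  exact this

/-- The one-step error bound, with the optimal choice of the tolerance on the jump time. -/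
theorem errV_le {n : ℕ} (hn : n < N)
    (hS : (2 * Clam) ^ (-(1 / 2) : ℝ) * X.errS Qz p (n + 1) ^ (1 / 2 : ℝ) < Δ) :
    X.errV Qz Δ g p N n ≤ X.errV Qz Δ g p N (n + 1) + (g2 + 2 * Cg * Clam) * Δ
      + 4 * Cg * (2 * Clam) ^ (1 / 2 : ℝ) * X.errS Qz p (n + 1) ^ (1 / 2 : ℝ)
      + (lipConst (M.value g N n) + 4 * Cg + 2 * lipConst (M.value g N (n + 1)))
        * X.errFilter Qz p n := by
  have hCg := ObservedModel.bound_nonneg hg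
  have hstep := fun η hη hηΔ => X.errV_le_of_lt_step Qz hC hrate hg hg2 hg_lip hΔ hp hn (η := η)
    hη hηΔ
  have hS0 : 0 ≤ X.errS Qz p (n + 1) := normLp_nonneg _ _ _
  set S := X.errS Qz p (n + 1)
  -- For a zero time error the balanced `η` would be `0`, which is not allowed; instead `η` tends to
  -- `0`. The `+ 1` in the denominator covers `Cg = 0`.
  rcases hS0.eq_or_lt with h0 | h0
  · rw [← h0, Real.zero_rpow (by norm_num), mul_zero, add_zero]
    refine le_of_forall_pos_le_add fun ε hε => ?_
    have hD : 0 < 4 * Cg * Clam + 1 := by positivity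
    have hη : 0 < min (Δ / 2) (ε / (4 * Cg * Clam + 1)) :=
      lt_min (half_pos hΔ.1) (by positivity)
    have h1 := hstep _ hη ((min_le_left _ _).trans_lt (half_lt_self hΔ.1))
    have h2 : (4 * Cg * Clam + 1) * min (Δ / 2) (ε / (4 * Cg * Clam + 1)) ≤ ε := by
      rw [mul_comm, ← le_div_iff₀ hD]
      exact min_le_right _ _
    rw [← h0, zero_div, zero_add] at h1
    linarith
  · have hs : 0 < (2 * Clam) ^ (1 / 2 : ℝ) := by positivity
    have ht : 0 < S ^ (1 / 2 : ℝ) := by positivity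
    have hss : (2 * Clam) ^ (1 / 2 : ℝ) * (2 * Clam) ^ (1 / 2 : ℝ) = 2 * Clam := by
      rw [← Real.rpow_add (by positivity)]; norm_num
    have htt : S ^ (1 / 2 : ℝ) * S ^ (1 / 2 : ℝ) = S := by
      rw [← Real.rpow_add h0]; norm_num
    rw [Real.rpow_neg (by positivity)] at hS
    have h1 := hstep _ (by positivity) hS
    set s := (2 * Clam) ^ (1 / 2 : ℝ)
    set t := S ^ (1 / 2 : ℝ)
    -- The choice `η = s⁻¹ * t` makes both terms equal to `s * t`; with the prefactor `2 * Cg` this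
    -- yields `4 * Cg`.
    have e : S / (s⁻¹ * t) + 2 * Clam * (s⁻¹ * t) = 2 * (s * t) := by
      rw [← htt, ← hss]
      field_simp
      ring
    rw [e] at h1
    linarith

/-- Backward induction from the horizon. As `δ ≤ 1`, every contribution is at most a constant times
`δ ^ (1 / 2)`, the scale imposed by the jump-time error, and `2 ^ (N + 2) * Cg` bounds all the
Lipschitz constants at once. -/
theorem errV_zero_le {δ : ℝ} (hδ1 : δ ≤ 1) (hΔδ : Δ < δ)
    (hS : ∀ n < N, (2 * Clam) ^ (-(1 / 2) : ℝ) * X.errS Qz p (n + 1) ^ (1 / 2 : ℝ) < Δ)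
    (hq : ∀ n ≤ N, X.errFilter Qz p n < δ ∧ X.errS Qz p n < δ) :
    X.errV Qz Δ g p N 0 ≤ (N + 1) * (g2 + 2 * Cg * Clam + 4 * Cg * (2 * Clam) ^ (1 / 2 : ℝ)
      + 4 * Cg + 3 * (2 ^ (N + 2) * Cg)) * δ ^ (1 / 2 : ℝ) := by
  have hCg := ObservedModel.bound_nonneg hg
  have hΔ0 := hΔ.1
  have hδ : 0 < δ := hΔ0.trans hΔδ
  set t := δ ^ (1 / 2 : ℝ) with ht
  have hδt : δ ≤ t := by
    conv_lhs => rw [← Real.rpow_one δ]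
    exact Real.rpow_le_rpow_of_exponent_ge hδ hδ1 (by norm_num)
  have ht0 : 0 ≤ t := hδ.le.trans hδt
  set s := (2 * Clam) ^ (1 / 2 : ℝ)
  have hs : 0 ≤ s := by positivity
  set Λ : ℝ := 2 ^ (N + 2) * Cg with hΛ
  have hΛ0 : 0 ≤ Λ := by positivity
  have hCgΛ : Cg ≤ Λ := le_mul_of_one_le_left hCg (one_le_pow₀ (by norm_num))
  have hlip : ∀ n, lipConst (M.value g N n) ≤ Λ := by
    intro n
    have h4 : (4 : ℝ) ≤ 2 ^ (N - n + 2) := by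
      rw [pow_add]
      have : (1 : ℝ) ≤ 2 ^ (N - n) := one_le_pow₀ (by norm_num)
      linarith
    have h5 : (2 : ℝ) ^ (N - n + 2) ≤ 2 ^ (N + 2) :=
      pow_le_pow_right₀ (by norm_num) (by omega)
    refine ((ObservedModel.valueRev_bdd_lip hC.le hrate hg (N - n)).2.lipConst_le
      (mul_nonneg (by linarith) hCg)).trans ?_
    exact mul_le_mul_of_nonneg_right (by linarith) hCg
  set A := g2 + 2 * Cg * Clam + 4 * Cg * s + 4 * Cg + 3 * Λ with hA
  have hind : ∀ k ≤ N, X.errV Qz Δ g p N (N - k) ≤ (k + 1) * A * t := by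
    intro k
    induction k with
    | zero =>
      intro _
      have h1 := X.errV_last_le Qz hC hrate hg (N := N) hp Δ
      have h2 : Cg * X.errFilter Qz p N ≤ Λ * t :=
        mul_le_mul hCgΛ ((hq N le_rfl).1.le.trans hδt) (normLp_nonneg _ _ _) hΛ0
      have h3 : Λ * t ≤ A * t := by
        refine mul_le_mul_of_nonneg_right ?_ ht0
        have : 0 ≤ g2 + 2 * Cg * Clam + 4 * Cg * s + 4 * Cg := by positivity
        linarith
      rw [Nat.sub_zero, Nat.cast_zero, zero_add, one_mul]
      linarith
    | succ k ih =>
      intro hk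
      have hn : N - (k + 1) < N := by omega
      have hn' : N - (k + 1) + 1 = N - k := by omega
      have h1 := X.errV_le Qz hC hrate hg hg2 hg_lip hΔ hp hn (hS _ hn)
      rw [hn'] at h1
      have h2 := ih (by omega)
      have h3 : (g2 + 2 * Cg * Clam) * Δ ≤ (g2 + 2 * Cg * Clam) * t :=
        mul_le_mul_of_nonneg_left (hΔδ.le.trans hδt) (by positivity)
      have h4 : 4 * Cg * s * X.errS Qz p (N - k) ^ (1 / 2 : ℝ) ≤ 4 * Cg * s * t :=
        mul_le_mul_of_nonneg_left (Real.rpow_le_rpow (normLp_nonneg _ _ _)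
          (hq _ (by omega)).2.le (by norm_num)) (by positivity)
      have h5 : (lipConst (M.value g N (N - (k + 1))) + 4 * Cg
          + 2 * lipConst (M.value g N (N - k))) * X.errFilter Qz p (N - (k + 1))
          ≤ (4 * Cg + 3 * Λ) * t := by
        refine mul_le_mul ?_ ((hq _ (by omega)).1.le.trans hδt) (normLp_nonneg _ _ _)
          (by positivity)
        linarith [hlip (N - (k + 1)), hlip (N - k)]
      push_cast
      calc _ ≤ (k + 1) * A * t + (g2 + 2 * Cg * Clam) * t + 4 * Cg * s * t
            + (4 * Cg + 3 * Λ) * t := by linarith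
        _ = _ := by rw [hA]; ring
  have := hind N le_rfl
  rwa [Nat.sub_self] at this

end ObservedProcess

end

end PODP

theorem theorem5p2 {d q : ℕ} (M : ObservedModel d q)
    (g : Vec d → ℝ) (Clam Cg g2 : ℝ)
    -- the jump rate is bounded by `C_λ > 0`
    (hClam : 0 < Clam) (hrate : ∀ y ∈ closure M.E, M.rate y ≤ Clam)
    -- the reward is measurable, bounded by `C_g`, and `[g]_2`-Lipschitz along the flow
    (hg_meas : Measurable ((closure M.E).domRestrict g))
    (hg : ∀ y ∈ closure M.E, |g y| ≤ Cg)
    (hg2 : 0 ≤ g2)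
    (hg_lip : ∀ i, ∀ t ∈ Set.Icc 0 (M.exit i), ∀ u ∈ Set.Icc 0 (M.exit i),
      |g (M.flow (M.x i) t) - g (M.flow (M.x i) u)| ≤ g2 * |t - u|)
    {Ω : Type*} [MeasurableSpace Ω] (P : Measure Ω) [IsProbabilityMeasure P]
    (X : ObservedProcess M P)
    -- the norm used for the nearest-neighbour projections
    (nrm : Seminorm ℝ ((Fin q → ℝ) × ℝ)) (hnrm : ∀ θ, nrm θ = 0 → θ = 0)
    (N : ℕ) (p : ℝ) (hp : 1 ≤ p) :
    -- the functions `v_n` are bounded and Lipschitz, so that the constants `[v_n]` are meaningful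
    (∀ n ≤ N, (∀ π ∈ stdSimplex ℝ (Fin q), |M.value g N n π| ≤ Cg) ∧
      BddAbove (lipQuotients (M.value g N n)) ∧
      lipConst (M.value g N n) ≤ (2 ^ (N - n + 2) - 3) * Cg) ∧
    -- the one-step error bound
    (∀ (K : Quantizer q nrm) (Δ : ℝ), M.IsStep Δ →
      (∀ n ≤ N, MemLp (fun ω => X.V g N n ω - X.VHat K Δ g N n ω) (ENNReal.ofReal p) P) ∧
      ∀ n < N, (2 * Clam) ^ (-(1 / 2) : ℝ) * X.errS K p (n + 1) ^ (1 / 2 : ℝ) < Δ →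
        X.errV K Δ g p N n ≤ X.errV K Δ g p N (n + 1)
          + (g2 + 2 * Cg * Clam) * Δ
          + 4 * Cg * (2 * Clam) ^ (1 / 2 : ℝ) * X.errS K p (n + 1) ^ (1 / 2 : ℝ)
          + (lipConst (M.value g N n) + 4 * Cg + 2 * lipConst (M.value g N (n + 1)))
            * X.errFilter K p n
          + 2 * lipConst (M.value g N (n + 1)) * X.errFilter K p (n + 1)) ∧
    -- convergence: `V_0 - V̂_0` is arbitrarily small for small quantization errors and steps
    (∀ ε > 0, ∃ δ > 0, ∀ (K : Quantizer q nrm) (Δ : ℝ), M.IsStep Δ → Δ < δ →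
      (∀ n < N, (2 * Clam) ^ (-(1 / 2) : ℝ) * X.errS K p (n + 1) ^ (1 / 2 : ℝ) < Δ) →
      (∀ n ≤ N, X.errFilter K p n < δ ∧ X.errS K p n < δ) →
      X.errV K Δ g p N 0 < ε ∧
        ∀ᵐ ω ∂P, |X.V g N 0 ω - X.VHat K Δ g N 0 ω| < ε) := by
  have : NeZero q := ⟨by rintro rfl; exact M.start.elim0⟩
  have hCg := ObservedModel.bound_nonneg hg
  refine ⟨fun n _ => ?_, fun K Δ hΔ => ⟨fun n _ => X.memLp_V_sub_VHat K hClam hrate hg Δ n _,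
    fun n hn hS => ?_⟩, fun ε hε => ?_⟩
  · obtain ⟨hb, hl⟩ := ObservedModel.valueRev_bdd_lip hClam.le hrate hg (N - n)
    refine ⟨hb, hl.bddAbove, hl.lipConst_le (mul_nonneg ?_ hCg)⟩
    have : (1 : ℝ) ≤ 2 ^ (N - n) := one_le_pow₀ (by norm_num)
    rw [pow_add]
    linarith
  -- The bound already holds without its last term, which is nonnegative.
  · refine (X.errV_le K hClam hrate hg hg2 hg_lip hΔ hp hn hS).trans (le_add_of_nonneg_right ?_)
    exact mul_nonneg (mul_nonneg zero_le_two (lipConst_nonneg _)) (normLp_nonneg _ _ _)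
  · set A : ℝ := (N + 1) * (g2 + 2 * Cg * Clam + 4 * Cg * (2 * Clam) ^ (1 / 2 : ℝ)
      + 4 * Cg + 3 * (2 ^ (N + 2) * Cg)) with hA
    have hA0 : 0 ≤ A := by positivity
    have hε' : 0 < ε / (A + 1) := by positivity
    -- The error is at most `A` times the square root of `δ`, hence the square; `A + 1` covers `A =
    -- 0` and gives a strict inequality.
    refine ⟨min 1 ((ε / (A + 1)) ^ 2), lt_min one_pos (by positivity),
      fun K Δ hΔ hΔδ hS hq => ?_⟩
    have h1 : X.errV K Δ g p N 0 < ε := by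
      refine (X.errV_zero_le K hClam hrate hg hg2 hg_lip hΔ hp (min_le_left _ _) hΔδ hS
        hq).trans_lt ?_
      have h2 : min 1 ((ε / (A + 1)) ^ 2) ^ (1 / 2 : ℝ) ≤ ε / (A + 1) := by
        rw [← Real.sqrt_eq_rpow]
        exact (Real.sqrt_le_sqrt (min_le_right _ _)).trans_eq (Real.sqrt_sq hε'.le)
      calc _ ≤ A * (ε / (A + 1)) := mul_le_mul_of_nonneg_left h2 hA0
        _ < (A + 1) * (ε / (A + 1)) := mul_lt_mul_of_pos_right (lt_add_one A) hε'
        _ = ε := mul_div_cancel₀ ε (by positivity)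
    refine ⟨h1, Filter.Eventually.of_forall fun ω => ?_⟩
    obtain ⟨c, hc⟩ := X.exists_V_sub_VHat_zero_eq_const K Δ g N
    rw [ObservedProcess.errV] at h1
    simp_rw [hc] at h1 ⊢
    rwa [normLp_const hp] at h1
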